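/- **Setting.** Let $d\ge 2$, let $M$ be a smooth $d$-manifold with boundary, let $D\subseteq\partial M$ be an embedded disc of codimension zero, parametrised by the cube $[-1,1]^{d-1}$, and let $\hat M=M\cup_D([0,\infty)\times D)$ and $\hat M_t=M\cup_D([0,t]\times D)$. Let $\xi\colon E\to M$ be a fibre bundle with fibre $X$, let $x_0\in X$, fix a trivialisation $\xi|_D\cong D\times X$, and let $\hat\xi\colon\hat E\to\hat M$ be the extension of $\xi$ by the trivial $X$-bundle over $[0,\infty)\times D$. *Singularity conditions.* Let $\Sigma(\xi)$ be the covering space of the interior of $M$ whose points are the pairs $(p,[B,\sigma]_p)$, where $B\subseteq M$ is a ball with $p$ in its interior, $\sigma$ is a section of $\xi|_{\partial B}$, and the equivalence relation is generated by $(B,\sigma)\sim(B',\sigma')$ if $B\subseteq\mathrm{int}(B')$ and $\sigma\sqcup\sigma'$ extends to a section over $B'\smallsetminus\mathrm{int}(B)$; its topology is generated by the sets $\{(q,[B,\sigma]_q)\mid q\in\mathrm{int}(B)\}$. Let $c\subseteq\pi_0(\Sigma(\xi))$. Let $\hat c\subseteq\pi_0(\Sigma(\hat\xi))$ be its image under the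 inclusion, and let $c_D\subseteq[S^{d-1},X]$ be the preimage of $\hat c$ under the map $[S^{d-1},X]\to\pi_0(\Sigma(\hat\xi))$ given by the trivialisation of $\hat\xi$ over $[0,\infty)\times D$. *Spaces.* - $C(\mathring D^d)$ is the space of finite unordered configurations in the open unit disc. - $\dot C(M)$ is the space of pairs $(z,t)$ with $t>0$ and $z$ a finite configuration in the interior of $\hat M_t$. - $\mathrm{CMap}^{c,\partial}(D^d;X)$ is the space of pairs $(z,f)$ with $z\in C(\mathring D^d)$ and $f\colon D^d\smallsetminus z\to X$ continuous, such that $f=x_0$ on $\partial D^d$ and such that $[f\circ e|_{S^{d-1}}]\in c_D$ for each orientation-preserving embedding $e\colon D^d\hookrightarrow D^d$ whose image contains exactly one point of $z$, in its interior. $\mathrm{CMap}^{c,\frac12\partial}(D^d;X)$ is defined in the same way, but with $f=x_0$ required only on the southern hemisphere $\{x\in\partial D^d\mid x_d\le0\}$. - $C\dot\Gamma^{c,D}(M;\xi)$ is the space of triples $(z,s,t)$ with $(z,t)\in\dot C(M)$ and $s$ a section of $\hat\xi$ over $\hat M\smallsetminus z$ that is constant at $x_0$ on $[t,\infty)\times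 D$, such that for each $p\in z$ and each ball $B$ with $p\in\mathrm{int}(B)$ and $B\cap z=\{p\}$ the component of $(p,[B,s|_{\partial B}]_p)$ lies in $\hat c$. *Operads.* The linear Swiss cheese operad $\mathsf{LSC}_n$ ($n\ge1$) has two colours $\mathsf a,\mathsf m$. $\mathsf{LSC}_n(\mathsf a^k;\mathsf a)$ is the space of $k$ little round discs $(x_i,r_i)$ with disjoint interiors in $D^n$. $\mathsf{LSC}_n(\mathsf a^k,\mathsf m;\mathsf m)$ is the space of $t\ge0$ together with $k$ such little discs in $[0,t]\times[-1,1]^{n-1}$, with all radii $r_i\le1$ (this is automatic for $n\ge2$). All other spaces of operations are empty. Composition inserts discs into discs by translation and dilation and puts cuboids end-to-end. The inclusions $D^n\subset D^{n+1}$ and $[-1,1]^{n-1}\subset[-1,1]^n$, $x\mapsto(x,0)$, induce an inclusion $\mathsf{LSC}_n\to\mathsf{LSC}_{n+1}$. An $\mathsf{LSC}_n$-algebra structure on a pair of spaces $(P,A)$ consists of continuous, unital, associative and equivariant maps $\mathsf{LSC}_n(\mathsf a^k;\mathsf a)\times A^k\to A$ and $\mathsf{LSC}_n(\mathsf a^k,\mathsf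 m;\mathsf m)\times A^k\times P\to P$. **Proposition.** The following constructions are well defined and give algebra structures over linear Swiss cheese operads: 1. $(\dot C(M),C(\mathring D^d))$ is an $\mathsf{LSC}_d$-algebra: the given configurations in $D^d$ are inserted into the little discs by translation and dilation, where for the colour $\mathsf m$ an operation of width $t$ is placed in the part $[t',t'+t]\times D\cong[t',t'+t]\times[-1,1]^{d-1}$ of $\hat M$, is added to $(z,t')\in\dot C(M)$, and $t'$ is replaced by $t'+t$. 2. $(C\dot\Gamma^{c,D}(M;\xi),\mathrm{CMap}^{c,\partial}(D^d;X))$ is an $\mathsf{LSC}_d$-algebra: configurations are inserted as in 1., together with the maps defined on their complements; outside the little discs (and, for the colour $\mathsf m$, outside $\hat M_{t'}$, where the given section is kept) the section is constant at $x_0$. 3. $(C\dot\Gamma^{c,D}(M;\xi),\mathrm{CMap}^{c,\frac12\partial}(D^d;X))$ is an $\mathsf{LSC}_{d-1}$-algebra: the little $(d-1)$-discs are thickened to $d$-discs with the same centres and radii by means of $\mathbb R^{d-1}=\mathbb R^{d-1}\times\{0\}\subset\mathbb R^d$, data are inserted as in 2., and vertically above each thickened disc (in the direction of the last coordinate) the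 map is extended from the northern hemisphere independently of the vertical coordinate; elsewhere it is constant at $x_0$. Moreover, in the sequence of maps of pairs $$(C\dot\Gamma^{c,D}(M;\xi),\mathrm{CMap}^{c,\partial}(D^d;X))\hookrightarrow(C\dot\Gamma^{c,D}(M;\xi),\mathrm{CMap}^{c,\frac12\partial}(D^d;X))\to(\dot C(M),C(\mathring D^d)),$$ where the first map is the inclusion and the second one forgets the section, both maps are (continuous) maps of $\mathsf{LSC}_{d-1}$-algebras, where the structures of 1. and 2. are restricted along $\mathsf{LSC}_{d-1}\to\mathsf{LSC}_d$, and their composition is a map of $\mathsf{LSC}_d$-algebras. -/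

import Mathlib

open Set Topology
open scoped Manifold ContDiff

noncomputable section

namespace SwissCheese

/-! ## Euclidean spaces, discs, cubes -/

/-- Euclidean `n`-space. -/
abbrev Rn (n : ℕ) : Type := EuclideanSpace ℝ (Fin n)

/-- The closed unit disc `D^n`. -/
abbrev Disc (n : ℕ) : Type := Metric.closedBall (0 : Rn n) 1

/-- The unit sphere `S^{n-1}` in `ℝ^n`. -/
abbrev Sph (n : ℕ) : Type := Metric.sphere (0 : Rn n) 1

/-- The inclusion of the unit sphere into the unit disc. -/
def Sph.toDisc {n : ℕ} (u : Sph n) : Disc n := ⟨u.1, Metric.sphere_subset_closedBall u.2⟩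

/-- The cube `[-1,1]^n`. -/
abbrev Cube (n : ℕ) : Type := Set.Icc (-1 : Fin n → ℝ) 1

/-- The inclusion `ℝ^n → ℝ^{n+1}`, `x ↦ (x, 0)`; the last coordinate is the "vertical" one. -/
def susp {n : ℕ} (x : Rn n) : Rn (n + 1) := WithLp.toLp 2 (Fin.snoc (α := fun _ => ℝ) x 0)

@[simp] lemma susp_castSucc {n : ℕ} (x : Rn n) (j : Fin n) : susp x j.castSucc = x j := by
  simp [susp]

@[simp] lemma susp_last {n : ℕ} (x : Rn n) : susp x (Fin.last n) = 0 := by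
  simp [susp]

@[simp] lemma susp_zero_coord {n : ℕ} [NeZero n] (x : Rn n) : susp x 0 = x 0 := by
  have h := susp_castSucc x 0
  rwa [Fin.castSucc_zero'] at h

lemma susp_zero {n : ℕ} : susp (0 : Rn n) = 0 := by
  ext j
  refine Fin.lastCases ?_ (fun j => ?_) j <;> simp

lemma susp_add {n : ℕ} (x y : Rn n) : susp (x + y) = susp x + susp y := by
  ext j
  refine Fin.lastCases ?_ (fun j => ?_) j <;> simp

lemma susp_smul {n : ℕ} (a : ℝ) (x : Rn n) : susp (a • x) = a • susp x := by
  ext j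
  refine Fin.lastCases ?_ (fun j => ?_) j <;> simp

lemma susp_sub {n : ℕ} (x y : Rn n) : susp (x - y) = susp x - susp y := by
  ext j
  refine Fin.lastCases ?_ (fun j => ?_) j <;> simp

lemma norm_susp {n : ℕ} (x : Rn n) : ‖susp x‖ = ‖x‖ := by
  simp [EuclideanSpace.norm_eq, Fin.sum_univ_castSucc]

lemma dist_susp {n : ℕ} (x y : Rn n) : dist (susp x) (susp y) = dist x y := by
  rw [dist_eq_norm, dist_eq_norm, ← susp_sub, norm_susp]

lemma continuous_susp {n : ℕ} : Continuous (susp : Rn n → Rn (n + 1)) :=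
  (Isometry.of_dist_eq dist_susp).continuous

/-- The vector `(a, 0, …, 0)`. -/
def horiz {n : ℕ} [NeZero n] (a : ℝ) : Rn n := EuclideanSpace.single 0 a

/-- The vector `(0, …, 0, a)`. -/
def vert {n : ℕ} (a : ℝ) : Rn (n + 1) := EuclideanSpace.single (Fin.last n) a

lemma susp_horiz {n : ℕ} [NeZero n] (a : ℝ) : susp (horiz a : Rn n) = horiz a := by
  ext j
  refine Fin.lastCases ?_ (fun j => ?_) j
  · have : Fin.last n ≠ 0 := by
      intro h
      exact NeZero.ne n (by simpa using congrArg Fin.val h)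
    simp [horiz, this]
  · have : (j.castSucc = 0) ↔ (j = 0) := Fin.castSucc_eq_zero_iff
    simp [horiz, this]

lemma coord_abs_le {n : ℕ} (x : Rn n) (j : Fin n) : |x j| ≤ ‖x‖ := by
  simpa using PiLp.norm_apply_le x j

/-- Shrinking discs inside two non-overlapping discs keeps them non-overlapping. -/
lemma subdisc_sep {n : ℕ} {x y b b' : Rn n} {r r' s s' : ℝ} (hr : 0 < r) (hr' : 0 < r')
    (h : r + r' ≤ dist x y) (hb : ‖b‖ ≤ 1 - s) (hb' : ‖b'‖ ≤ 1 - s') :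
    r * s + r' * s' ≤ dist (x + r • b) (y + r' • b') := by
  have h1 : dist x y ≤ ‖r • b‖ + dist (x + r • b) (y + r' • b') + ‖r' • b'‖ := by
    rw [dist_eq_norm, dist_eq_norm]
    have e : x - y = (-(r • b) + (x + r • b - (y + r' • b'))) + r' • b' := by abel
    calc ‖x - y‖ ≤ ‖-(r • b) + (x + r • b - (y + r' • b'))‖ + ‖r' • b'‖ := by
            conv_lhs => rw [e]
            exact norm_add_le _ _
      _ ≤ _ := by
            gcongr
            simpa using norm_add_le (-(r • b)) (x + r • b - (y + r' • b'))
  rw [norm_smul, norm_smul, Real.norm_of_nonneg hr.le, Real.norm_of_nonneg hr'.le] at h1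
  nlinarith [mul_le_mul_of_nonneg_left hb hr.le, mul_le_mul_of_nonneg_left hb' hr'.le]

lemma dist_smul_self {n : ℕ} {x b b' : Rn n} {r : ℝ} (hr : 0 < r) :
    dist (x + r • b) (x + r • b') = r * dist b b' := by
  rw [dist_add_left, dist_smul₀, Real.norm_of_nonneg hr.le]

/-! ## The linear Swiss cheese operad

`LSC_n` has two colours `a`, `m`; its non-empty spaces of operations are `LSC_n(a^k; a)`, the
little `n`-discs, and `LSC_n(a^k, m; m)`, the little `n`-discs in a cuboid. As usual for symmetric
operads, inputs are labelled by an arbitrary finite set `ι` (instead of only by `{1, …, k}`). -/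

/-- `LSC_n(a^ι; a)`: little `n`-discs in `D^n` with disjoint interiors, indexed by `ι`. -/
@[ext] structure LittleDiscs (n : ℕ) (ι : Type) where
  centre : ι → Rn n
  radius : ι → ℝ
  radius_pos : ∀ i, 0 < radius i
  inside : ∀ i, ‖centre i‖ ≤ 1 - radius i
  sep : ∀ i j, i ≠ j → radius i + radius j ≤ dist (centre i) (centre j)

/-- `LSC_n(a^ι, m; m)`: little `n`-discs with disjoint interiors in `[0,t] × [-1,1]^{n-1}`, indexed
by `ι`, together with `t ≥ 0`. All radii are at most `1`; for `n ≥ 2` this is implied by `inside`.-/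
@[ext] structure LinearDiscs (n : ℕ) [NeZero n] (ι : Type) where
  centre : ι → Rn n
  radius : ι → ℝ
  width : ℝ
  radius_pos : ∀ i, 0 < radius i
  radius_le : ∀ i, radius i ≤ 1
  width_nonneg : 0 ≤ width
  inside_zero : ∀ i, radius i ≤ centre i 0 ∧ centre i 0 ≤ width - radius i
  inside : ∀ i j, j ≠ 0 → radius i - 1 ≤ centre i j ∧ centre i j ≤ 1 - radius i
  sep : ∀ i j, i ≠ j → radius i + radius j ≤ dist (centre i) (centre j)

instance (n : ℕ) (ι : Type) : TopologicalSpace (LittleDiscs n ι) :=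
  .induced (fun θ => (θ.centre, θ.radius)) inferInstance

instance (n : ℕ) [NeZero n] (ι : Type) : TopologicalSpace (LinearDiscs n ι) :=
  .induced (fun θ => (θ.centre, θ.radius, θ.width)) inferInstance

namespace LittleDiscs

variable {n : ℕ} {ι κ : Type}

/-- The operadic unit of colour `a`: the disc `D^n` itself. -/
def one (n : ℕ) : LittleDiscs n Unit where
  centre _ := 0
  radius _ := 1
  radius_pos _ := one_pos
  inside _ := by simp
  sep i j h := absurd (Subsingleton.elim i j) h

/-- Relabelling of the inputs. -/
def reindex (e : ι ≃ κ) (θ : LittleDiscs n ι) : LittleDiscs n κ where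
  centre := θ.centre ∘ e.symm
  radius := θ.radius ∘ e.symm
  radius_pos _ := θ.radius_pos _
  inside _ := θ.inside _
  sep _ _ h := θ.sep _ _ (e.symm.injective.ne h)

/-- Operadic composition: `φ i` is inserted in the `i`-th disc of `θ` by translation and
dilation. -/
def comp {κ : ι → Type} (θ : LittleDiscs n ι) (φ : ∀ i, LittleDiscs n (κ i)) :
    LittleDiscs n (Σ i, κ i) where
  centre p := θ.centre p.1 + θ.radius p.1 • (φ p.1).centre p.2
  radius p := θ.radius p.1 * (φ p.1).radius p.2
  radius_pos p := mul_pos (θ.radius_pos _) ((φ p.1).radius_pos _)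
  inside p := by
    have h := norm_add_le (θ.centre p.1) (θ.radius p.1 • (φ p.1).centre p.2)
    rw [norm_smul, Real.norm_of_nonneg (θ.radius_pos _).le] at h
    nlinarith [θ.inside p.1,
      mul_le_mul_of_nonneg_left ((φ p.1).inside p.2) (θ.radius_pos p.1).le]
  sep := by
    rintro ⟨i, j⟩ ⟨i', j'⟩ h
    by_cases hi : i = i'
    · subst hi
      have hj : j ≠ j' := fun e => h (by rw [e])
      rw [dist_smul_self (θ.radius_pos i), ← mul_add]
      exact mul_le_mul_of_nonneg_left ((φ i).sep j j' hj) (θ.radius_pos i).le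
    · exact subdisc_sep (θ.radius_pos i) (θ.radius_pos i') (θ.sep i i' hi)
        ((φ i).inside j) ((φ i').inside j')

/-- The dimension-increasing inclusion, induced by `D^n ⊆ D^{n+1}`. -/
def suspend (θ : LittleDiscs n ι) : LittleDiscs (n + 1) ι where
  centre i := susp (θ.centre i)
  radius := θ.radius
  radius_pos := θ.radius_pos
  inside i := by rw [norm_susp]; exact θ.inside i
  sep i j h := by rw [dist_susp]; exact θ.sep i j h

lemma suspend_one : (one n).suspend = one (n + 1) := by
  ext1
  · funext i
    exact susp_zero
  · rfl

lemma suspend_comp {κ : ι → Type} (θ : LittleDiscs n ι) (φ : ∀ i, LittleDiscs n (κ i)) :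
    (θ.comp φ).suspend = θ.suspend.comp fun i => (φ i).suspend := by
  ext1
  · funext p
    simp [suspend, comp, susp_add, susp_smul]
  · rfl

lemma continuous_suspend : Continuous (suspend : LittleDiscs n ι → LittleDiscs (n + 1) ι) := by
  refine continuous_induced_rng.2 ?_
  have h : Continuous fun θ : LittleDiscs n ι => (θ.centre, θ.radius) := continuous_induced_dom
  refine Continuous.prodMk ?_ h.snd
  exact continuous_pi fun i => continuous_susp.comp ((continuous_apply i).comp h.fst)

end LittleDiscs

namespace LinearDiscs

variable {n : ℕ} [NeZero n] {ι κ : Type}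

/-- The operadic unit of colour `m`: no discs, in the cuboid of width `0`. -/
def one (n : ℕ) [NeZero n] : LinearDiscs n Empty where
  centre := Empty.elim
  radius := Empty.elim
  width := 0
  radius_pos i := i.elim
  radius_le i := i.elim
  width_nonneg := le_rfl
  inside_zero i := i.elim
  inside i := i.elim
  sep i := i.elim

/-- Relabelling of the inputs of colour `a`. -/
def reindex (e : ι ≃ κ) (θ : LinearDiscs n ι) : LinearDiscs n κ where
  centre := θ.centre ∘ e.symm
  radius := θ.radius ∘ e.symm
  width := θ.width
  radius_pos _ := θ.radius_pos _
  radius_le _ := θ.radius_le _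
  width_nonneg := θ.width_nonneg
  inside_zero _ := θ.inside_zero _
  inside _ := θ.inside _
  sep _ _ h := θ.sep _ _ (e.symm.injective.ne h)

/-- Operadic composition: `φ i` is inserted in the `i`-th disc of `θ`, and the cuboid of `θ` is
placed to the right of the cuboid of `ψ`, the operation inserted in the input of colour `m`. -/
def comp {κ : ι → Type} {μ : Type} (θ : LinearDiscs n ι) (φ : ∀ i, LittleDiscs n (κ i))
    (ψ : LinearDiscs n μ) : LinearDiscs n ((Σ i, κ i) ⊕ μ) where
  centre := Sum.elim
    (fun p => (horiz ψ.width + θ.centre p.1) + θ.radius p.1 • (φ p.1).centre p.2) ψ.centre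
  radius := Sum.elim (fun p => θ.radius p.1 * (φ p.1).radius p.2) ψ.radius
  width := ψ.width + θ.width
  radius_pos := by
    rintro (p | k)
    · exact mul_pos (θ.radius_pos _) ((φ p.1).radius_pos _)
    · exact ψ.radius_pos k
  radius_le := by
    rintro (p | k)
    · have h1 := (φ p.1).inside p.2
      have h2 := norm_nonneg ((φ p.1).centre p.2)
      exact mul_le_one₀ (θ.radius_le _) ((φ p.1).radius_pos _).le (by linarith)
    · exact ψ.radius_le k
  width_nonneg := add_nonneg ψ.width_nonneg θ.width_nonneg
  inside_zero := by
    rintro (p | k)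
    · have h1 := abs_le.1 ((coord_abs_le ((φ p.1).centre p.2) 0).trans ((φ p.1).inside p.2))
      have h2 := θ.inside_zero p.1
      have h3 := θ.radius_pos p.1
      have h4 := mul_le_mul_of_nonneg_left h1.1 h3.le
      have h5 := mul_le_mul_of_nonneg_left h1.2 h3.le
      have h6 := ψ.width_nonneg
      simp only [Sum.elim_inl, PiLp.add_apply, PiLp.smul_apply, smul_eq_mul, horiz,
        PiLp.single_apply, if_true]
      constructor <;> linarith
    · have := ψ.inside_zero k
      have h := θ.width_nonneg
      simp only [Sum.elim_inr]
      constructor <;> linarith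
  inside := by
    rintro (p | k) j hj
    · have h1 := abs_le.1 ((coord_abs_le ((φ p.1).centre p.2) j).trans ((φ p.1).inside p.2))
      have h2 := θ.inside p.1 j hj
      have h3 := θ.radius_pos p.1
      have h4 := mul_le_mul_of_nonneg_left h1.1 h3.le
      have h5 := mul_le_mul_of_nonneg_left h1.2 h3.le
      simp only [Sum.elim_inl, PiLp.add_apply, PiLp.smul_apply, smul_eq_mul, horiz,
        PiLp.single_apply, if_neg hj]
      constructor <;> linarith
    · exact ψ.inside k j hj
  sep := by
    have key : ∀ (p : Σ i, κ i) (k : μ), θ.radius p.1 * (φ p.1).radius p.2 + ψ.radius k ≤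
        dist ((horiz ψ.width + θ.centre p.1) + θ.radius p.1 • (φ p.1).centre p.2)
          (ψ.centre k) := by
      intro p k
      rw [dist_eq_norm]
      refine le_trans ?_ ((le_abs_self _).trans (coord_abs_le _ 0))
      have h1 := abs_le.1 ((coord_abs_le ((φ p.1).centre p.2) 0).trans ((φ p.1).inside p.2))
      have h2 := θ.inside_zero p.1
      have h3 := θ.radius_pos p.1
      have h4 := mul_le_mul_of_nonneg_left h1.1 h3.le
      have h6 := ψ.inside_zero k
      simp only [PiLp.sub_apply, PiLp.add_apply, PiLp.smul_apply, smul_eq_mul, horiz,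
        PiLp.single_apply, if_true]
      linarith
    rintro (⟨i, j⟩ | k) (⟨i', j'⟩ | k') h
    · by_cases hi : i = i'
      · subst hi
        have hj : j ≠ j' := fun e => h (by rw [e])
        simp only [Sum.elim_inl]
        rw [dist_smul_self (θ.radius_pos i), ← mul_add]
        exact mul_le_mul_of_nonneg_left ((φ i).sep j j' hj) (θ.radius_pos i).le
      · refine subdisc_sep (θ.radius_pos i) (θ.radius_pos i') ?_
          ((φ i).inside j) ((φ i').inside j')
        rw [dist_add_left]
        exact θ.sep i i' hi
    · exact key ⟨i, j⟩ k'
    · have := key ⟨i', j'⟩ k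
      rw [add_comm, dist_comm] at this
      exact this
    · exact ψ.sep k k' fun e => h (by rw [e])

/-- The dimension-increasing inclusion, induced by `[-1,1]^{n-1} ⊆ [-1,1]^n`. -/
def suspend (θ : LinearDiscs n ι) : LinearDiscs (n + 1) ι where
  centre i := susp (θ.centre i)
  radius := θ.radius
  width := θ.width
  radius_pos := θ.radius_pos
  radius_le := θ.radius_le
  width_nonneg := θ.width_nonneg
  inside_zero i := by rw [susp_zero_coord]; exact θ.inside_zero i
  inside i j := by
    refine Fin.lastCases ?_ (fun j => ?_) j
    · intro _
      have := θ.radius_le i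
      rw [susp_last]
      constructor <;> linarith
    · intro h
      rw [susp_castSucc]
      exact θ.inside i j fun e => h (by rw [e, Fin.castSucc_zero'])
  sep i j h := by rw [dist_susp]; exact θ.sep i j h

lemma suspend_one : (one n).suspend = one (n + 1) := by
  ext1
  · funext i
    exact i.elim
  · rfl
  · rfl

lemma suspend_comp {κ : ι → Type} {μ : Type} (θ : LinearDiscs n ι)
    (φ : ∀ i, LittleDiscs n (κ i)) (ψ : LinearDiscs n μ) :
    (θ.comp φ ψ).suspend = θ.suspend.comp (fun i => (φ i).suspend) ψ.suspend := by
  ext1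
  · funext p
    rcases p with p | k
    · simp [suspend, comp, LittleDiscs.suspend, susp_add, susp_smul, susp_horiz]
    · rfl
  · rfl
  · rfl

lemma continuous_suspend : Continuous (suspend : LinearDiscs n ι → LinearDiscs (n + 1) ι) := by
  refine continuous_induced_rng.2 ?_
  have h : Continuous fun θ : LinearDiscs n ι => (θ.centre, θ.radius, θ.width) :=
    continuous_induced_dom
  refine Continuous.prodMk ?_ h.snd
  exact continuous_pi fun i => continuous_susp.comp ((continuous_apply i).comp h.fst)

end LinearDiscs

/-! ## Algebras over the linear Swiss cheese operad -/

/-- The structure of an `LSC_n`-algebra on a pair of spaces `(P, A)`, where `P` has colour `m` and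
`A` has colour `a`: continuous action maps `LSC_n(a^ι; a) × A^ι → A` and
`LSC_n(a^ι, m; m) × A^ι × P → P` that are unital, associative and equivariant. -/
structure LSCAlgebra (n : ℕ) [NeZero n] (P A : Type*) [TopologicalSpace P]
    [TopologicalSpace A] where
  actA : ∀ {ι : Type} [Finite ι], LittleDiscs n ι → (ι → A) → A
  actM : ∀ {ι : Type} [Finite ι], LinearDiscs n ι → (ι → A) → P → P
  continuous_actA : ∀ {ι : Type} [Finite ι],
    Continuous fun p : LittleDiscs n ι × (ι → A) => actA p.1 p.2
  continuous_actM : ∀ {ι : Type} [Finite ι],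
    Continuous fun p : LinearDiscs n ι × (ι → A) × P => actM p.1 p.2.1 p.2.2
  actA_one : ∀ x : Unit → A, actA (LittleDiscs.one n) x = x ()
  actM_one : ∀ (x : Empty → A) (y : P), actM (LinearDiscs.one n) x y = y
  actA_reindex : ∀ {ι κ : Type} [Finite ι] [Finite κ] (e : ι ≃ κ) (θ : LittleDiscs n ι)
    (x : κ → A), actA (θ.reindex e) x = actA θ (x ∘ e)
  actM_reindex : ∀ {ι κ : Type} [Finite ι] [Finite κ] (e : ι ≃ κ) (θ : LinearDiscs n ι)
    (x : κ → A) (y : P), actM (θ.reindex e) x y = actM θ (x ∘ e) y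
  actA_comp : ∀ {ι : Type} {κ : ι → Type} [Finite ι] [∀ i, Finite (κ i)] (θ : LittleDiscs n ι)
    (φ : ∀ i, LittleDiscs n (κ i)) (x : (Σ i, κ i) → A),
    actA (θ.comp φ) x = actA θ fun i => actA (φ i) fun j => x ⟨i, j⟩
  actM_comp : ∀ {ι μ : Type} {κ : ι → Type} [Finite ι] [Finite μ] [∀ i, Finite (κ i)]
    (θ : LinearDiscs n ι) (φ : ∀ i, LittleDiscs n (κ i)) (ψ : LinearDiscs n μ)
    (x : (Σ i, κ i) ⊕ μ → A) (y : P),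
    actM (θ.comp φ ψ) x y =
      actM θ (fun i => actA (φ i) fun j => x (Sum.inl ⟨i, j⟩)) (actM ψ (fun k => x (Sum.inr k)) y)

/-- Restriction of an algebra along the dimension-increasing inclusion `LSC_n → LSC_{n+1}`. -/
def LSCAlgebra.restrict {n : ℕ} [NeZero n] {P A : Type*} [TopologicalSpace P]
    [TopologicalSpace A] (S : LSCAlgebra (n + 1) P A) : LSCAlgebra n P A where
  actA θ x := S.actA θ.suspend x
  actM θ x y := S.actM θ.suspend x y
  continuous_actA := S.continuous_actA.comp
    ((LittleDiscs.continuous_suspend.comp continuous_fst).prodMk continuous_snd)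
  continuous_actM := S.continuous_actM.comp
    ((LinearDiscs.continuous_suspend.comp continuous_fst).prodMk continuous_snd)
  actA_one x := by rw [LittleDiscs.suspend_one]; exact S.actA_one x
  actM_one x y := by rw [LinearDiscs.suspend_one]; exact S.actM_one x y
  actA_reindex e θ x := S.actA_reindex e θ.suspend x
  actM_reindex e θ x y := S.actM_reindex e θ.suspend x y
  actA_comp θ φ x := by rw [LittleDiscs.suspend_comp]; exact S.actA_comp _ _ x
  actM_comp θ φ ψ x y := by rw [LinearDiscs.suspend_comp]; exact S.actM_comp _ _ _ x y

/-- `(f, g)` is a map of `LSC_n`-algebras. -/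
structure IsLSCMap {n : ℕ} [NeZero n] {P A P' A' : Type*} [TopologicalSpace P]
    [TopologicalSpace A] [TopologicalSpace P'] [TopologicalSpace A'] (S : LSCAlgebra n P A)
    (S' : LSCAlgebra n P' A') (f : P → P') (g : A → A') : Prop where
  continuous_left : Continuous f
  continuous_right : Continuous g
  map_actA : ∀ {ι : Type} [Finite ι] (θ : LittleDiscs n ι) (x : ι → A),
    g (S.actA θ x) = S'.actA θ fun i => g (x i)
  map_actM : ∀ {ι : Type} [Finite ι] (θ : LinearDiscs n ι) (x : ι → A) (y : P),
    f (S.actM θ x y) = S'.actM θ (fun i => g (x i)) (f y)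

/-! ## Configurations, and maps defined on the complement of a configuration -/

/-- A finite configuration of (distinct, unordered) points of `N`. -/
@[ext] structure Conf (N : Type*) where
  pts : Set N
  finite : pts.Finite

/-- `C(N) = ⨆_k F_k(N) / Σ_k`, with the quotient topology, where `F_k(N)` is the space of injective
maps `{1, …, k} → N`. -/
instance {N : Type*} [TopologicalSpace N] : TopologicalSpace (Conf N) :=
  .coinduced
    (fun x : Σ k : ℕ, {x : Fin k → N // Function.Injective x} => ⟨range x.2.1, finite_range _⟩)
    inferInstance

/-- A finite configuration in `N` together with a map to `Y` defined on its complement. -/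
structure ConfMap (N Y : Type*) [TopologicalSpace N] [TopologicalSpace Y] extends Conf N where
  sec : C({p : N // p ∉ pts}, Y)

/-- The topology on `ConfMap N Y`: the coarsest one for which the underlying configuration is
continuous and which contains all sets of pairs `(z, s)` such that the compact set `K` is disjoint
from `z` and `s(K) ⊆ U`, with `U` open. For a manifold `N` it restricts to the compact-open
topology on each space of maps with fixed `z`, and is the product topology in the local
trivialisations (over the space of configurations) that are given by pushing points around. -/
instance {N Y : Type*} [TopologicalSpace N] [TopologicalSpace Y] :
    TopologicalSpace (ConfMap N Y) :=
  .induced ConfMap.toConf inferInstance ⊓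
    .generateFrom {S | ∃ (K : Set N) (U : Set Y), IsCompact K ∧ IsOpen U ∧
      S = {s | ∀ p ∈ K, ∃ h : p ∉ s.pts, s.sec ⟨p, h⟩ ∈ U}}

/-! ## The covering space of local sections and singularity conditions -/

/-- A local section of `ξ : E → N` on the boundary of a `d`-dimensional ball in `N`, where `I` is
the interior of the `d`-manifold `N`. The ball `B` is the image of a topological embedding of `D^d`;
its interior is the image of the open disc, and its boundary is the image of the sphere. -/
structure LocalSection (d : ℕ) {N E : Type*} [TopologicalSpace N] [TopologicalSpace E] (I : Set N)
    (ξ : E → N) where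
  ball : Disc d → N
  isEmbedding : IsEmbedding ball
  isOpen_int : IsOpen (ball '' {u | ‖u.1‖ < 1})
  int_subset : ball '' {u | ‖u.1‖ < 1} ⊆ I
  sec : C(Sph d, E)
  sec_proj : ∀ u, ξ (sec u) = ball u.toDisc

namespace LocalSection

variable {d : ℕ} {N E : Type*} [TopologicalSpace N] [TopologicalSpace E] {I : Set N} {ξ : E → N}

/-- The ball `B`. -/
def carrier (l : LocalSection d I ξ) : Set N := range l.ball

/-- The interior of the ball `B`. -/
def int (l : LocalSection d I ξ) : Set N := l.ball '' {u | ‖u.1‖ < 1}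

/-- `(B, σ)` and `(B', σ')` are related if `B` lies in the interior of `B'` and `σ ⊔ σ'` extends to
a section over `B' ∖ int B`. -/
def Extends (l l' : LocalSection d I ξ) : Prop :=
  l.carrier ⊆ l'.int ∧ ∃ τ : N → E, ContinuousOn τ (l'.carrier \ l.int) ∧
    (∀ x ∈ l'.carrier \ l.int, ξ (τ x) = x) ∧
    ∀ u : Sph d, τ (l.ball u.toDisc) = l.sec u ∧ τ (l'.ball u.toDisc) = l'.sec u

end LocalSection

/-- The underlying set of the covering space `Σ(ξ)`: pairs `(p, [B, σ]_p)`, where `[B, σ]_p` is an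
equivalence class of local sections on the boundaries of balls with `p` in their interior. -/
structure SingSpace (d : ℕ) {N E : Type*} [TopologicalSpace N] [TopologicalSpace E] (I : Set N)
    (ξ : E → N) where
  pt : N
  germ : Quot fun l l' : {l : LocalSection d I ξ // pt ∈ l.int} => l.1.Extends l'.1

/-- The point `(p, [B, σ]_p)` of `Σ(ξ)`. -/
def LocalSection.at {d : ℕ} {N E : Type*} [TopologicalSpace N] [TopologicalSpace E] {I : Set N}
    {ξ : E → N} (l : LocalSection d I ξ) {p : N} (hp : p ∈ l.int) : SingSpace d I ξ :=
  ⟨p, Quot.mk _ ⟨l, hp⟩⟩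

/-- The topology of `Σ(ξ)` is generated by the sets `{(q, [B, σ]_q) | q ∈ int B}`. -/
instance {d : ℕ} {N E : Type*} [TopologicalSpace N] [TopologicalSpace E] {I : Set N} {ξ : E → N} :
    TopologicalSpace (SingSpace d I ξ) :=
  .generateFrom {S | ∃ l : LocalSection d I ξ, S = {x | ∃ (q : N) (hq : q ∈ l.int), x = l.at hq}}

/-- The set `π_0(Σ(ξ))`; its subsets are the singularity conditions for `ξ`. -/
abbrev SingClass (d : ℕ) {N E : Type*} [TopologicalSpace N] [TopologicalSpace E] (I : Set N)
    (ξ : E → N) : Type _ := ZerothHomotopy (SingSpace d I ξ)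

/-- All charges of the configuration-section `s` lie in `c`: for each point `p` of the configuration
and each ball `B` with `p` in its interior that contains no other point of the configuration, the
component of `(p, [B, s|_{∂B}]_p)` in `Σ(ξ)` belongs to `c`. -/
def ConfMap.HasCharges {d : ℕ} {N E : Type*} [TopologicalSpace N] [TopologicalSpace E] {I : Set N}
    {ξ : E → N} (s : ConfMap N E) (c : Set (SingClass d I ξ)) : Prop :=
  ∀ p ∈ s.pts, ∀ (l : LocalSection d I ξ) (hp : p ∈ l.int),
    (∀ q ∈ s.pts, q ∈ l.carrier → q = p) →
    (∀ u : Sph d, ∃ h : l.ball u.toDisc ∉ s.pts, s.sec ⟨l.ball u.toDisc, h⟩ = l.sec u) →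
    ZerothHomotopy.mk (l.at hp) ∈ c

/-! ## The manifold with an infinite cylinder attached, and the extended bundle -/

/-- A codimension-zero disc `D` in the boundary of an `(n+1)`-dimensional manifold `M`, given by a
parametrisation by the cube `[-1,1]^n`. -/
structure BoundaryDisc (n : ℕ) (M : Type*) [TopologicalSpace M]
    [ChartedSpace (EuclideanHalfSpace (n + 1)) M] where
  emb : Cube n → M
  isEmbedding : IsEmbedding emb
  mem_boundary : ∀ v, emb v ∈ (𝓡∂ (n + 1)).boundary M

section Hat

variable {n : ℕ} {M E X : Type*} [TopologicalSpace M]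
  [ChartedSpace (EuclideanHalfSpace (n + 1)) M] [TopologicalSpace E] [TopologicalSpace X]

/-- The subset `D ⊆ ∂M`. -/
def BoundaryDisc.carrier (D : BoundaryDisc n M) : Set M := range D.emb

/-- The interior of the disc `D`. -/
def BoundaryDisc.int (D : BoundaryDisc n M) : Set M := D.emb '' {v | ∀ j, |v.1 j| < 1}

/-- A trivialisation `ξ|_D ≅ D × X` of the restriction of `ξ` to the disc `D`. -/
structure DiscTrivialization (D : BoundaryDisc n M) (ξ : E → M) (X : Type*)
    [TopologicalSpace X] where
  homeo : {e : E // ξ e ∈ D.carrier} ≃ₜ Cube n × X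
  proj : ∀ e, D.emb (homeo e).1 = ξ e.1

/-- `M̂ = M ∪_D ([0,∞) × D)`, realised as the closed subspace `M × {0} ∪ D × [0,∞)` of
`M × [0,∞)`. (Gluing `ℝ × D` to `M` along a collar `(-∞,0] × D` yields the same space.) -/
def Hat (D : BoundaryDisc n M) : Type _ :=
  {p : M × ℝ // 0 ≤ p.2 ∧ (p.2 = 0 ∨ p.1 ∈ D.carrier)}

/-- The total space `Ê = E ∪ ([0,∞) × ξ⁻¹(D))` of the extended bundle `ξ̂` over `M̂`. -/
def HatE (D : BoundaryDisc n M) (ξ : E → M) : Type _ :=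
  {e : E × ℝ // 0 ≤ e.2 ∧ (e.2 = 0 ∨ ξ e.1 ∈ D.carrier)}

instance (D : BoundaryDisc n M) : TopologicalSpace (Hat D) :=
  inferInstanceAs (TopologicalSpace {p : M × ℝ // 0 ≤ p.2 ∧ (p.2 = 0 ∨ p.1 ∈ D.carrier)})

instance (D : BoundaryDisc n M) (ξ : E → M) : TopologicalSpace (HatE D ξ) :=
  inferInstanceAs (TopologicalSpace {e : E × ℝ // 0 ≤ e.2 ∧ (e.2 = 0 ∨ ξ e.1 ∈ D.carrier)})

/-- The projection `ξ̂ : Ê → M̂`. -/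
def hatProj (D : BoundaryDisc n M) (ξ : E → M) (e : HatE D ξ) : Hat D :=
  ⟨(ξ e.1.1, e.1.2), e.2⟩

/-- The coordinate in `[0,∞)` along the cylinder (it is `0` on `M`). -/
def Hat.height {D : BoundaryDisc n M} (p : Hat D) : ℝ := p.1.2

/-- The interior of `M̂`. -/
def hatInt (D : BoundaryDisc n M) : Set (Hat D) :=
  {p | (p.1.2 = 0 ∧ p.1.1 ∈ (𝓡∂ (n + 1)).interior M) ∨ p.1.1 ∈ D.int}

/-- The interior of `M̂_t = M ∪ ([0,t] × D)`. -/
def hatIntBelow (D : BoundaryDisc n M) (t : ℝ) : Set (Hat D) :=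
  {p | p ∈ hatInt D ∧ p.height < t}

/-- `p` is the point of the cylinder `[0,∞) × D` with coordinates `q ∈ [0,∞) × [-1,1]^n`. -/
def Hat.IsAt {D : BoundaryDisc n M} (p : Hat D) (q : Rn (n + 1)) : Prop :=
  p.height = q 0 ∧ ∃ v : Cube n, D.emb v = p.1.1 ∧ ∀ j, v.1 j = q j.succ

/-- `e` lies over the cylinder `[0,∞) × D` and its `X`-coordinate in the trivialisation is `x`. -/
def HatE.HasValue {D : BoundaryDisc n M} {ξ : E → M} (T : DiscTrivialization D ξ X)
    (e : HatE D ξ) (x : X) : Prop :=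
  ∃ h : ξ e.1.1 ∈ D.carrier, (T.homeo ⟨e.1.1, h⟩).2 = x

/-- The inclusion `M ⊆ M̂`. -/
def Hat.ofM (D : BoundaryDisc n M) (p : M) : Hat D := ⟨(p, 0), le_rfl, Or.inl rfl⟩

/-- The inclusion `E ⊆ Ê`. -/
def HatE.ofE (D : BoundaryDisc n M) (ξ : E → M) (e : E) : HatE D ξ := ⟨(e, 0), le_rfl, Or.inl rfl⟩

/-- The inclusion `[0,∞) × D ⊆ M̂`. -/
def Hat.cyl (D : BoundaryDisc n M) (u : ℝ) (hu : 0 ≤ u) (v : Cube n) : Hat D :=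
  ⟨(D.emb v, u), hu, Or.inr ⟨v, rfl⟩⟩

/-- The inclusion `[0,∞) × D × X ⊆ Ê` given by the trivialisation. -/
def HatE.cyl {D : BoundaryDisc n M} {ξ : E → M} (T : DiscTrivialization D ξ X) (u : ℝ)
    (hu : 0 ≤ u) (v : Cube n) (x : X) : HatE D ξ :=
  ⟨((T.homeo.symm (v, x)).1, u), hu, Or.inr (T.homeo.symm (v, x)).2⟩

lemma isEmbedding_ofM (D : BoundaryDisc n M) : IsEmbedding (Hat.ofM D) := by
  have h : IsEmbedding fun p : M => (p, (0 : ℝ)) := isEmbedding_prodMkLeft 0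
  exact IsEmbedding.of_comp
    (Continuous.subtype_mk h.continuous _) continuous_subtype_val h

lemma not_mem_carrier_of_interior (D : BoundaryDisc n M) {p : M}
    (hp : p ∈ (𝓡∂ (n + 1)).interior M) : p ∉ D.carrier := by
  rintro ⟨v, rfl⟩
  exact Set.disjoint_left.1 ModelWithCorners.disjoint_interior_boundary hp (D.mem_boundary v)

/-- A local section of `ξ` regarded as a local section of the extended bundle `ξ̂`. -/
def LocalSection.hat (D : BoundaryDisc n M) {ξ : E → M}
    (l : LocalSection (n + 1) ((𝓡∂ (n + 1)).interior M) ξ) :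
    LocalSection (n + 1) (hatInt D) (hatProj D ξ) where
  ball u := Hat.ofM D (l.ball u)
  isEmbedding := (isEmbedding_ofM D).comp l.isEmbedding
  isOpen_int := by
    have h : (fun u => Hat.ofM D (l.ball u)) '' {u | ‖u.1‖ < 1} =
        (fun p : Hat D => p.1.1) ⁻¹' (l.ball '' {u | ‖u.1‖ < 1}) := by
      ext p
      constructor
      · rintro ⟨u, hu, rfl⟩
        exact ⟨u, hu, rfl⟩
      · rintro ⟨u, hu, h⟩
        refine ⟨u, hu, Subtype.ext (Prod.ext h ?_)⟩
        have h' : p.1.1 ∈ (𝓡∂ (n + 1)).interior M := l.int_subset ⟨u, hu, h⟩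
        exact (p.2.2.resolve_right (not_mem_carrier_of_interior D h')).symm
    rw [h]
    exact l.isOpen_int.preimage (continuous_fst.comp continuous_subtype_val)
  int_subset := by
    rintro _ ⟨u, hu, rfl⟩
    exact Or.inl ⟨rfl, l.int_subset ⟨u, hu, rfl⟩⟩
  sec := ⟨fun u => HatE.ofE D ξ (l.sec u), by
    exact Continuous.subtype_mk (l.sec.continuous.prodMk continuous_const) _⟩
  sec_proj u := Subtype.ext (Prod.ext (l.sec_proj u) rfl)

lemma LocalSection.mem_hat_int (D : BoundaryDisc n M) {ξ : E → M}
    (l : LocalSection (n + 1) ((𝓡∂ (n + 1)).interior M) ξ) {p : M} (hp : p ∈ l.int) :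
    Hat.ofM D p ∈ (l.hat D).int := by
  obtain ⟨u, hu, rfl⟩ := hp
  exact ⟨u, hu, rfl⟩

/-- The subset `ĉ ⊆ π_0(Σ(ξ̂))` corresponding to `c ⊆ π_0(Σ(ξ))`: the image of `c` under the map
induced by the inclusion of bundles. -/
def hatClass (D : BoundaryDisc n M) (ξ : E → M)
    (c : Set (SingClass (n + 1) ((𝓡∂ (n + 1)).interior M) ξ)) :
    Set (SingClass (n + 1) (hatInt D) (hatProj D ξ)) :=
  {k | ∃ (l : LocalSection (n + 1) ((𝓡∂ (n + 1)).interior M) ξ) (p : M) (hp : p ∈ l.int),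
    ZerothHomotopy.mk (l.at hp) ∈ c ∧ k = ZerothHomotopy.mk ((l.hat D).at (l.mem_hat_int D hp))}

/-- The set `[S^{d-1}, X]` of unbased homotopy classes of maps. -/
def SphClass (d : ℕ) (X : Type*) [TopologicalSpace X] : Type _ :=
  Quotient (⟨ContinuousMap.Homotopic, ContinuousMap.Homotopic.equivalence⟩ : Setoid C(Sph d, X))

/-- The homotopy class of a map `S^{d-1} → X`. -/
def SphClass.mk {d : ℕ} {X : Type*} [TopologicalSpace X] (g : C(Sph d, X)) : SphClass d X :=
  Quotient.mk _ g

/-- First coordinate, shifted, of a point of a standard ball inside the cylinder. -/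
def stdHeight (u : Disc (n + 1)) : ℝ := 1 + u.1 0 / 2

/-- Remaining coordinates of a point of a standard ball inside the cylinder. -/
def stdCube (u : Disc (n + 1)) : Cube n :=
  ⟨fun j => u.1 j.succ / 2, by
    have h : ‖u.1‖ ≤ 1 := mem_closedBall_zero_iff.1 u.2
    constructor <;> intro j <;>
      have := abs_le.1 ((coord_abs_le u.1 j.succ).trans h) <;> simp <;> linarith⟩

lemma stdHeight_pos (u : Disc (n + 1)) : 0 < stdHeight u := by
  have h : ‖u.1‖ ≤ 1 := mem_closedBall_zero_iff.1 u.2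
  have := abs_le.1 ((coord_abs_le u.1 0).trans h)
  unfold stdHeight
  linarith

lemma continuous_stdHeight : Continuous (stdHeight : Disc (n + 1) → ℝ) := by
  unfold stdHeight
  fun_prop

lemma continuous_stdCube : Continuous (stdCube : Disc (n + 1) → Cube n) := by
  refine Continuous.subtype_mk ?_ _
  fun_prop

lemma isEmbedding_std : IsEmbedding fun u : Disc (n + 1) => (stdCube u, stdHeight u) := by
  have : CompactSpace (Disc (n + 1)) :=
    isCompact_iff_compactSpace.1 (isCompact_closedBall _ _)
  refine (Continuous.isClosedEmbedding (continuous_stdCube.prodMk continuous_stdHeight)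
    ?_).isEmbedding
  intro u w h
  have h1 : ∀ j, u.1 (Fin.succ j) = w.1 j.succ := fun j => by
    have := congrFun (congrArg (fun z : Cube n × ℝ => z.1.1) h) j
    simp only [stdCube] at this
    linarith
  have h2 : u.1 0 = w.1 0 := by
    have := congrArg Prod.snd h
    simp only [stdHeight] at this
    linarith
  refine Subtype.ext (PiLp.ext fun j => ?_)
  exact Fin.cases h2 h1 j

lemma isOpen_std :
    IsOpen ((fun u : Disc (n + 1) => (stdCube u, stdHeight u)) '' {u | ‖u.1‖ < 1}) := by
  let f : Cube n × ℝ → Rn (n + 1) := fun z =>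
    WithLp.toLp 2 (Fin.cons (α := fun _ => ℝ) (2 * (z.2 - 1)) fun j => 2 * z.1.1 j)
  have hf : Continuous f := by
    refine (PiLp.continuous_toLp 2 _).comp (continuous_pi fun j => ?_)
    refine Fin.cases ?_ (fun j => ?_) j
    · simp only [Fin.cons_zero]
      fun_prop
    · simp only [Fin.cons_succ]
      exact continuous_const.mul ((continuous_apply j).comp
        (continuous_subtype_val.comp continuous_fst))
  have h : (fun u : Disc (n + 1) => (stdCube u, stdHeight u)) '' {u | ‖u.1‖ < 1} =
      f ⁻¹' Metric.ball 0 1 := by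
    ext z
    constructor
    · rintro ⟨u, hu, rfl⟩
      have : f (stdCube u, stdHeight u) = u.1 := by
        ext j
        refine Fin.cases ?_ (fun j => ?_) j
        · simp [f, stdHeight]
          ring
        · simp [f, stdCube]
          ring
      rw [mem_preimage, this]
      exact mem_ball_zero_iff.2 hu
    · intro hz
      have hz' : ‖f z‖ < 1 := mem_ball_zero_iff.1 hz
      refine ⟨⟨f z, mem_closedBall_zero_iff.2 hz'.le⟩, hz', Prod.ext (Subtype.ext ?_) ?_⟩
      · funext j
        simp [f, stdCube]
      · simp [f, stdHeight]
  rw [h]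
  exact Metric.isOpen_ball.preimage hf

/-- The local section of `ξ̂` on the boundary of the ball of radius `1/2` about `(1, 0)` in
`[0,∞) × D` that corresponds to the map `g : S^n → X` under the trivialisation. -/
def stdSection {D : BoundaryDisc n M} {ξ : E → M} (T : DiscTrivialization D ξ X)
    (g : C(Sph (n + 1), X)) : LocalSection (n + 1) (hatInt D) (hatProj D ξ) where
  ball u := Hat.cyl D (stdHeight u) (stdHeight_pos u).le (stdCube u)
  isEmbedding := by
    have h := (D.isEmbedding.prodMap IsEmbedding.id).comp (isEmbedding_std (n := n))
    refine IsEmbedding.of_comp ?_ continuous_subtype_val h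
    exact Continuous.subtype_mk h.continuous _
  isOpen_int := by
    have hE : IsEmbedding (Prod.map D.emb (id : ℝ → ℝ)) := D.isEmbedding.prodMap IsEmbedding.id
    obtain ⟨O, hO, hO'⟩ := hE.isInducing.isOpen_iff.1 (isOpen_std (n := n))
    have h : (fun u : Disc (n + 1) => Hat.cyl D (stdHeight u) (stdHeight_pos u).le (stdCube u)) ''
        {u | ‖u.1‖ < 1} = {p : Hat D | p.1 ∈ O ∧ 0 < p.1.2} := by
      ext p
      constructor
      · rintro ⟨u, hu, rfl⟩
        have : (stdCube u, stdHeight u) ∈ Prod.map D.emb (id : ℝ → ℝ) ⁻¹' O := by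
          rw [hO']
          exact ⟨u, hu, rfl⟩
        exact ⟨this, stdHeight_pos u⟩
      · rintro ⟨h1, h2⟩
        obtain ⟨v, hv⟩ := p.2.2.resolve_left h2.ne'
        have : (v, p.1.2) ∈ Prod.map D.emb (id : ℝ → ℝ) ⁻¹' O := by
          change (D.emb v, p.1.2) ∈ O
          rw [hv]
          exact h1
        rw [hO'] at this
        obtain ⟨u, hu, h3⟩ := this
        have h4 : stdCube u = v := congrArg Prod.fst h3
        have h5 : stdHeight u = p.1.2 := congrArg Prod.snd h3
        refine ⟨u, hu, Subtype.ext (Prod.ext ?_ h5)⟩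
        change D.emb (stdCube u) = p.1.1
        rw [← hv, h4]
    rw [h]
    exact (hO.preimage continuous_subtype_val).inter
      (isOpen_lt continuous_const (continuous_snd.comp continuous_subtype_val))
  int_subset := by
    rintro _ ⟨u, hu, rfl⟩
    refine Or.inr ⟨stdCube u, fun j => ?_, rfl⟩
    have h : ‖u.1‖ ≤ 1 := mem_closedBall_zero_iff.1 u.2
    have := (coord_abs_le u.1 j.succ).trans h
    change |u.1 j.succ / 2| < 1
    rw [abs_div, abs_two]
    linarith
  sec := ⟨fun u => HatE.cyl T (stdHeight u.toDisc) (stdHeight_pos _).le (stdCube u.toDisc) (g u), by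
    have h1 : Continuous (Sph.toDisc : Sph (n + 1) → Disc (n + 1)) :=
      Continuous.subtype_mk continuous_subtype_val _
    refine Continuous.subtype_mk (Continuous.prodMk ?_ (continuous_stdHeight.comp h1)) _
    exact continuous_subtype_val.comp
      (T.homeo.symm.continuous.comp ((continuous_stdCube.comp h1).prodMk g.continuous))⟩
  sec_proj u := by
    refine Subtype.ext (Prod.ext ?_ rfl)
    have := T.proj (T.homeo.symm (stdCube u.toDisc, g u))
    rw [Homeomorph.apply_symm_apply] at this
    exact this.symm

/-- The centre of the disc. -/
def Disc.origin (d : ℕ) : Disc d := ⟨0, by simp⟩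

lemma stdSection_origin_mem {D : BoundaryDisc n M} {ξ : E → M} (T : DiscTrivialization D ξ X)
    (g : C(Sph (n + 1), X)) :
    (stdSection T g).ball (Disc.origin (n + 1)) ∈ (stdSection T g).int :=
  ⟨Disc.origin (n + 1), by simp [Disc.origin], rfl⟩

/-- The subset `c_D ⊆ [S^n, X]` determined by `c`: the preimage of `c` under
`[S^n, X] ≅ π_0(Σ(trivial bundle over [0,∞) × D)) → π_0(Σ(ξ̂)) ≅ π_0(Σ(ξ))`. -/
def discClass {D : BoundaryDisc n M} {ξ : E → M} (T : DiscTrivialization D ξ X)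
    (c : Set (SingClass (n + 1) ((𝓡∂ (n + 1)).interior M) ξ)) : Set (SphClass (n + 1) X) :=
  {a | ∃ g : C(Sph (n + 1), X), SphClass.mk g = a ∧
    ZerothHomotopy.mk ((stdSection T g).at (stdSection_origin_mem T g)) ∈ hatClass D ξ c}

end Hat

/-! ## Configuration-mapping spaces of the disc -/

/-- `e` restricts to an orientation-preserving smooth embedding `D^d → D^d`. -/
structure IsOrientedDiscEmbedding {d : ℕ} (e : Rn d → Rn d) : Prop where
  contDiffOn : ContDiffOn ℝ ∞ e (Metric.closedBall 0 1)
  injOn : InjOn e (Metric.closedBall 0 1)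
  mapsTo : MapsTo e (Metric.closedBall 0 1) (Metric.closedBall 0 1)
  det_pos : ∀ x ∈ Metric.closedBall (0 : Rn d) 1,
    0 < (fderivWithin ℝ e (Metric.closedBall 0 1) x).det

/-- The monodromy of `(z, f)` lies in `c`: for each orientation-preserving embedding
`e : D^d → D^d` whose image meets `z` in a single point, which lies in the interior of the image,
the homotopy class of `f ∘ e|_{S^{d-1}}` is in `c`. -/
def ConfMap.HasMonodromy {d : ℕ} {X : Type*} [TopologicalSpace X] (s : ConfMap (Disc d) X)
    (c : Set (SphClass d X)) : Prop :=
  ∀ e : Rn d → Rn d, IsOrientedDiscEmbedding e → ∀ p ∈ s.pts, p.1 ∈ e '' Metric.ball 0 1 →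
    (∀ q ∈ s.pts, q.1 ∈ e '' Metric.closedBall 0 1 → q = p) →
    ∀ g : C(Sph d, X),
      (∀ u : Sph d, ∃ (x : Disc d) (h : x ∉ s.pts), x.1 = e u.1 ∧ s.sec ⟨x, h⟩ = g u) →
      SphClass.mk g ∈ c

/-- The configuration space `C(D̊^d)` of the open disc. -/
abbrev CDisc (d : ℕ) : Type := {z : Conf (Disc d) // ∀ p ∈ z.pts, ‖p.1‖ < 1}

/-- The configuration-mapping space `CMap^{c,A}(D^d; X)` of pairs `(z, f)`, where `z` is a finite
subset of the open disc and `f : D^d ∖ z → X` has monodromy in `c` and sends `A` to `x₀`. -/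
abbrev CMapDisc {d : ℕ} {X : Type*} [TopologicalSpace X] (A : Set (Rn d)) (x₀ : X)
    (c : Set (SphClass d X)) : Type _ :=
  {s : ConfMap (Disc d) X // (∀ p ∈ s.pts, ‖p.1‖ < 1) ∧
    (∀ (p : Disc d) (h : p ∉ s.pts), p.1 ∈ A → s.sec ⟨p, h⟩ = x₀) ∧ s.HasMonodromy c}

/-- The boundary `∂D^d`. -/
def bdry (d : ℕ) : Set (Rn d) := {p | ‖p‖ = 1}

/-- The southern hemisphere of `∂D^{n+1}`, where the last coordinate is non-positive. -/
def halfBdry (n : ℕ) : Set (Rn (n + 1)) := {p | ‖p‖ = 1 ∧ p (Fin.last n) ≤ 0}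

/-- The inclusion of the configuration-mapping spaces with boundary conditions on `∂D^d` and on
`½∂D^d`. -/
def CMapDisc.incl {n : ℕ} {X : Type*} [TopologicalSpace X] {x₀ : X} {c : Set (SphClass (n + 1) X)}
    (s : CMapDisc (bdry (n + 1)) x₀ c) : CMapDisc (halfBdry n) x₀ c :=
  ⟨s.1, s.2.1, fun p h hp => s.2.2.1 p h hp.1, s.2.2.2⟩

/-- The underlying configuration. -/
def CMapDisc.forget {d : ℕ} {X : Type*} [TopologicalSpace X] {A : Set (Rn d)} {x₀ : X}
    {c : Set (SphClass d X)} (s : CMapDisc A x₀ c) : CDisc d :=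
  ⟨s.1.toConf, s.2.1⟩

/-! ## The models of configuration and configuration-section spaces of `M` -/

section Dot

variable {n : ℕ} {M E X : Type*} [TopologicalSpace M]
  [ChartedSpace (EuclideanHalfSpace (n + 1)) M] [TopologicalSpace E] [TopologicalSpace X]

/-- `Ċ(M)`: pairs `(z, t)` with `t > 0` and `z` a finite subset of the interior of `M̂_t`. -/
abbrev CDot (D : BoundaryDisc n M) : Type _ :=
  {w : Conf (Hat D) × ℝ // 0 < w.2 ∧ w.1.pts ⊆ hatIntBelow D w.2}

/-- `CΓ̇^{c,D}(M; ξ)`: triples `(z, s, t)` with `t > 0`, `z` a finite subset of the interior of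
`M̂_t` and `s` a section of `ξ̂` on `M̂ ∖ z`, with all charges in `ĉ`, that is constant at `x₀` on
`[t,∞) × D`. -/
abbrev CGammaDot {D : BoundaryDisc n M} {ξ : E → M} (T : DiscTrivialization D ξ X) (x₀ : X)
    (c : Set (SingClass (n + 1) ((𝓡∂ (n + 1)).interior M) ξ)) : Type _ :=
  {w : ConfMap (Hat D) (HatE D ξ) × ℝ // 0 < w.2 ∧ w.1.pts ⊆ hatIntBelow D w.2 ∧
    (∀ p, hatProj D ξ (w.1.sec p) = p.1) ∧ w.1.HasCharges (hatClass D ξ c) ∧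
    ∀ p, w.2 ≤ p.1.height → (w.1.sec p).HasValue T x₀}

/-- Forgetting the section. -/
def CGammaDot.forget {D : BoundaryDisc n M} {ξ : E → M} {T : DiscTrivialization D ξ X} {x₀ : X}
    {c : Set (SingClass (n + 1) ((𝓡∂ (n + 1)).interior M) ξ)} (w : CGammaDot T x₀ c) : CDot D :=
  ⟨(w.1.1.toConf, w.1.2), w.2.1, w.2.2.1⟩

end Dot

/-! ## The geometric actions

The actions insert the given data in the little discs, and extend by the constant `x₀`; in the case
of the boundary condition on the southern hemisphere, the data are first extended upwards from the
northern hemisphere of each little disc, independently of the vertical coordinate. -/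

/-- `q` is the point of the disc with centre `c` and radius `r` that corresponds to `y ∈ D^d`. -/
def InDisc {d : ℕ} (c : Rn d) (r : ℝ) (y q : Rn d) : Prop := q = c + r • y

/-- `q` either is the point of the `(n+1)`-dimensional disc with centre `(c, 0)` and radius `r` that
corresponds to `y ∈ D^{n+1}`, or `y` lies in the northern hemisphere and `q` lies vertically above
the point that corresponds to `y`. -/
def InColumn {n : ℕ} (c : Rn n) (r : ℝ) (y q : Rn (n + 1)) : Prop :=
  InDisc (susp c) r y q ∨
    (‖y‖ = 1 ∧ 0 ≤ y (Fin.last n) ∧ ∃ h : ℝ, 0 ≤ h ∧ q = susp c + r • y + vert h)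

section Glue

variable {d n : ℕ} {ι : Type} {M E X : Type*} [TopologicalSpace M]
  [ChartedSpace (EuclideanHalfSpace (n + 1)) M] [TopologicalSpace E] [TopologicalSpace X]

/-- `z'` is the union of the configurations `z i`, transported along the relations `R i`. -/
def IsGluedConf (R : ι → Rn d → Rn d → Prop) (z : ι → Conf (Disc d)) (z' : Conf (Disc d)) : Prop :=
  ∀ p, p ∈ z'.pts ↔ ∃ i, ∃ y ∈ (z i).pts, R i y.1 p.1

/-- `s` is glued from the configuration-maps `x i`, transported along the relations `R i`, and from
the constant map at `x₀` elsewhere. -/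
structure IsGluedMap (R : ι → Rn d → Rn d → Prop) (x₀ : X) (x : ι → ConfMap (Disc d) X)
    (s : ConfMap (Disc d) X) : Prop where
  conf : IsGluedConf R (fun i => (x i).toConf) s.toConf
  sec_in : ∀ p i (y : {y : Disc d // y ∉ (x i).pts}), R i y.1.1 p.1.1 → s.sec p = (x i).sec y
  sec_out : ∀ p, (∀ i (y : Disc d), ¬ R i y.1 p.1.1) → s.sec p = x₀

/-- `z'` is the union of `w` and of the configurations `z i`, transported along the relations `R i`
into the part `[t,∞) × D` of the cylinder. -/
def IsGluedConfHat {D : BoundaryDisc n M} (R : ι → Rn (n + 1) → Rn (n + 1) → Prop) (t : ℝ)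
    (z : ι → Conf (Disc (n + 1))) (w z' : Conf (Hat D)) : Prop :=
  ∀ p, p ∈ z'.pts ↔ p ∈ w.pts ∨ ∃ i, ∃ y ∈ (z i).pts, ∃ q, R i y.1 q ∧ p.IsAt (horiz t + q)

/-- `s'` is glued from the configuration-section `s` on `M̂_t`, the configuration-maps `x i`,
transported along the relations `R i` into `[t,∞) × D`, and the constant map at `x₀` elsewhere. -/
structure IsGluedSec {D : BoundaryDisc n M} {ξ : E → M} (T : DiscTrivialization D ξ X)
    (R : ι → Rn (n + 1) → Rn (n + 1) → Prop) (x₀ : X) (t : ℝ)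
    (x : ι → ConfMap (Disc (n + 1)) X) (s s' : ConfMap (Hat D) (HatE D ξ)) : Prop where
  conf : IsGluedConfHat R t (fun i => (x i).toConf) s.toConf s'.toConf
  sec_old : ∀ p (h' : p ∉ s'.pts) (h : p ∉ s.pts), p.height ≤ t → s'.sec ⟨p, h'⟩ = s.sec ⟨p, h⟩
  sec_in : ∀ p i (y : {y : Disc (n + 1) // y ∉ (x i).pts}) q, R i y.1.1 q →
    p.1.IsAt (horiz t + q) → (s'.sec p).HasValue T ((x i).sec y)
  sec_out : ∀ p, t ≤ p.1.height →
    (∀ i (y : Disc (n + 1)) q, R i y.1 q → ¬ p.1.IsAt (horiz t + q)) → (s'.sec p).HasValue T x₀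

/-- The geometric action of `LSC_{n+1}` on `(Ċ(M), C(D̊^{n+1}))`. -/
structure IsConfAction {D : BoundaryDisc n M} (S : LSCAlgebra (n + 1) (CDot D) (CDisc (n + 1))) :
    Prop where
  actA : ∀ {ι : Type} [Finite ι] (θ : LittleDiscs (n + 1) ι) (z : ι → CDisc (n + 1)),
    IsGluedConf (fun i => InDisc (θ.centre i) (θ.radius i)) (fun i => (z i).1) (S.actA θ z).1
  actM : ∀ {ι : Type} [Finite ι] (θ : LinearDiscs (n + 1) ι) (z : ι → CDisc (n + 1)) (w : CDot D),
    IsGluedConfHat (fun i => InDisc (θ.centre i) (θ.radius i)) w.1.2 (fun i => (z i).1) w.1.1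
      (S.actM θ z w).1.1
  actM_width : ∀ {ι : Type} [Finite ι] (θ : LinearDiscs (n + 1) ι) (z : ι → CDisc (n + 1))
    (w : CDot D), (S.actM θ z w).1.2 = w.1.2 + θ.width

/-- The geometric action of `LSC_{n+1}` on `(CΓ̇^{c,D}(M; ξ), CMap^{c,∂}(D^{n+1}; X))`. -/
structure IsSecAction {D : BoundaryDisc n M} {ξ : E → M} {T : DiscTrivialization D ξ X} {x₀ : X}
    {c : Set (SingClass (n + 1) ((𝓡∂ (n + 1)).interior M) ξ)}
    (S : LSCAlgebra (n + 1) (CGammaDot T x₀ c) (CMapDisc (bdry (n + 1)) x₀ (discClass T c))) :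
    Prop where
  actA : ∀ {ι : Type} [Finite ι] (θ : LittleDiscs (n + 1) ι)
    (x : ι → CMapDisc (bdry (n + 1)) x₀ (discClass T c)),
    IsGluedMap (fun i => InDisc (θ.centre i) (θ.radius i)) x₀ (fun i => (x i).1) (S.actA θ x).1
  actM : ∀ {ι : Type} [Finite ι] (θ : LinearDiscs (n + 1) ι)
    (x : ι → CMapDisc (bdry (n + 1)) x₀ (discClass T c)) (w : CGammaDot T x₀ c),
    IsGluedSec T (fun i => InDisc (θ.centre i) (θ.radius i)) x₀ w.1.2 (fun i => (x i).1) w.1.1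
      (S.actM θ x w).1.1
  actM_width : ∀ {ι : Type} [Finite ι] (θ : LinearDiscs (n + 1) ι)
    (x : ι → CMapDisc (bdry (n + 1)) x₀ (discClass T c)) (w : CGammaDot T x₀ c),
    (S.actM θ x w).1.2 = w.1.2 + θ.width

/-- The geometric action of `LSC_n` on `(CΓ̇^{c,D}(M; ξ), CMap^{c,½∂}(D^{n+1}; X))`. -/
structure IsHalfSecAction [NeZero n] {D : BoundaryDisc n M} {ξ : E → M}
    {T : DiscTrivialization D ξ X} {x₀ : X}
    {c : Set (SingClass (n + 1) ((𝓡∂ (n + 1)).interior M) ξ)}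
    (S : LSCAlgebra n (CGammaDot T x₀ c) (CMapDisc (halfBdry n) x₀ (discClass T c))) :
    Prop where
  actA : ∀ {ι : Type} [Finite ι] (θ : LittleDiscs n ι)
    (x : ι → CMapDisc (halfBdry n) x₀ (discClass T c)),
    IsGluedMap (fun i => InColumn (θ.centre i) (θ.radius i)) x₀ (fun i => (x i).1) (S.actA θ x).1
  actM : ∀ {ι : Type} [Finite ι] (θ : LinearDiscs n ι)
    (x : ι → CMapDisc (halfBdry n) x₀ (discClass T c)) (w : CGammaDot T x₀ c),
    IsGluedSec T (fun i => InColumn (θ.centre i) (θ.radius i)) x₀ w.1.2 (fun i => (x i).1) w.1.1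
      (S.actM θ x w).1.1
  actM_width : ∀ {ι : Type} [Finite ι] (θ : LinearDiscs n ι)
    (x : ι → CMapDisc (halfBdry n) x₀ (discClass T c)) (w : CGammaDot T x₀ c),
    (S.actM θ x w).1.2 = w.1.2 + θ.width

end Glue

end SwissCheese

end

open SwissCheese

open Filter

noncomputable section

namespace SwissCheese

/-! ## The topology of configuration spaces -/

namespace Conf

variable {N : Type*} [TopologicalSpace N]

/-! All operations are given by explicit formulas, so the content is their continuity, the
preservation of the singularity conditions, and the algebra laws. Structures 2 and 3 are treated
together by means of a `Shape`: a closed region of ℝ^d with a retraction to the unit disc. The disc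
itself gives structure 2; the column, consisting of the disc and everything above it, gives
structure 3. A map on the disc is pulled back along the retraction to each rescaled region, and the
glued map is x₀ elsewhere. The core of a region is the part that the retraction sends outside the
set A on which maps are required to be x₀. No region meets the core of another one, and off the core
the pulled back map is x₀. Hence the glued value is given by one continuous formula on each member
of a finite closed cover (`continuousAt_glueVal`). In the cylinder the old section and the new one
match at height t, where both are x₀ (`glueHatVal_of_ge`).

Continuity is tested on configurations and on values. Unions of moving configurations vary
continuously (`Conf.continuousAt_iUnion_image`), evaluation is jointly continuous by local
compactness (`ConfMap.continuousAt_ev`), and conversely joint continuity of the values gives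
continuity into the space of configuration-maps (`ConfMap.continuous_of_ev`).

Monodromy and charge are local: an arbitrary disc or ball around a point can be shrunk into the
region where the glued map is a copy of a given one, without changing the homotopy class or the germ
(`mem_sphClass_of_agree`, `ConfMap.HasCharges.of_agree`). For points inserted in the cylinder,
homotopy classes of maps on spheres have to be compared with components of Σ(ξ̂). Round balls do
this (`IsRound.mk_eq`): on nested round balls, homotopic maps are joined by an extension built from
the homotopy, and moving the centre through the connected open box does not change the component.
Thus monodromy in c_D gives charge in ĉ (`mem_hatClass_of_agree`).

For the laws, the relations `IsGluedMap` and `IsGluedSec` determine their result uniquely, and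
gluing twice is gluing along composite relations, so associativity reduces to `Shape.rel_comp`. For
columns this says that lowering a point to the northern hemisphere of the large disc, and then to
that of a small disc inside it, is the same as lowering it to the small one directly.

Finally, a map that is x₀ on the whole sphere extends upwards by x₀, so the two kinds of gluing
agree on such maps (`glueVal_discShape_eq`). Points of configurations are interior to the disc,
where retractions do not move them; all three structures therefore use the same formula for
configurations, and forgetting the section respects the actions by definition. -/

/-- The configurations with exactly one point in each of the sets `U p`. -/
def near (z : Conf N) (U : z.pts → Set N) : Set (Conf N) :=
  {w | ∃ x : z.pts → N, (∀ p, x p ∈ U p) ∧ range x = w.pts}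

/-- Openness is checked on ordered configurations. Disjointness of the sets `U p` forces a bijection
between the points of `z` and the labels, and the same bijection still works for all nearby tuples.
-/
lemma near_mem_nhds (z : Conf N) (U : z.pts → Set N) (hU : ∀ p, IsOpen (U p))
    (hz : ∀ p, p.1 ∈ U p) (hd : Pairwise fun p q => Disjoint (U p) (U q)) : z.near U ∈ 𝓝 z := by
  refine IsOpen.mem_nhds ?_ ⟨Subtype.val, hz, Subtype.range_val⟩
  refine isOpen_coinduced.2 (isOpen_sigma_iff.2 fun k => isOpen_iff_mem_nhds.2 ?_)
  rintro y ⟨x, hx, hr⟩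
  have hinj : Function.Injective x := by
    intro p q h
    by_contra hne
    exact Set.disjoint_left.1 (hd hne) (hx p) (h ▸ hx q)
  have hr' : range x = range y.1 := hr
  have e : ∀ i, ∃ p, x p = y.1 i := fun i => by
    have : y.1 i ∈ range x := hr' ▸ mem_range_self i
    exact this
  have e' : ∀ p, ∃ i, y.1 i = x p := fun p => by
    have : x p ∈ range y.1 := hr' ▸ mem_range_self p
    exact this
  choose a ha using e
  choose b hb using e'
  have hO : IsOpen {y' : {x : Fin k → N // Function.Injective x} | ∀ i, y'.1 i ∈ U (a i)} := by
    have : {y' : {x : Fin k → N // Function.Injective x} | ∀ i, y'.1 i ∈ U (a i)} =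
        ⋂ i, (fun y' : {x : Fin k → N // Function.Injective x} => y'.1 i) ⁻¹' U (a i) := by
      ext
      simp
    rw [this]
    exact isOpen_iInter_of_finite fun i =>
      (hU _).preimage ((continuous_apply i).comp continuous_subtype_val)
  refine mem_of_superset (hO.mem_nhds fun i => ?_) ?_
  · have := hx (a i)
    rwa [ha] at this
  · intro y' hy'
    have hab : ∀ p, a (b p) = p := fun p => hinj (by rw [ha, hb])
    have hba : ∀ i, b (a i) = i := fun i => y.2 (by rw [hb, ha])
    refine ⟨fun p => y'.1 (b p), fun p => ?_, ?_⟩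
    · have := hy' (b p)
      rwa [hab] at this
    · ext q
      constructor
      · rintro ⟨p, rfl⟩
        exact ⟨b p, rfl⟩
      · rintro ⟨i, rfl⟩
        exact ⟨a i, by simp only [hba]⟩

/-- Together with `near_mem_nhds` this gives a neighbourhood basis of `z`: enumerate `z`, take a
basic product neighbourhood of the resulting tuple, and intersect its factors with disjoint
neighbourhoods of the points. -/
lemma exists_near_subset [T2Space N] (z : Conf N) {S : Set (Conf N)} (hS : S ∈ 𝓝 z) :
    ∃ U : z.pts → Set N, (∀ p, IsOpen (U p)) ∧ (∀ p, p.1 ∈ U p) ∧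
      (Pairwise fun p q => Disjoint (U p) (U q)) ∧ z.near U ⊆ S := by
  obtain ⟨O, hOS, hO, hzO⟩ := mem_nhds_iff.1 hS
  have : Finite z.pts := z.finite
  obtain ⟨k, ⟨e⟩⟩ := Finite.exists_equiv_fin z.pts
  let y : {x : Fin k → N // Function.Injective x} :=
    ⟨fun i => (e.symm i).1, Subtype.val_injective.comp e.symm.injective⟩
  have hy : (⟨range y.1, finite_range _⟩ : Conf N) = z := by
    ext p
    constructor
    · rintro ⟨i, rfl⟩
      exact (e.symm i).2
    · intro hp
      exact ⟨e ⟨p, hp⟩, by simp [y]⟩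
  have h1 := isOpen_sigma_iff.1 (isOpen_coinduced.1 hO) k
  obtain ⟨V, hV, hVO⟩ := isOpen_induced_iff.1 h1
  have hyV : y.1 ∈ V := by
    have : y ∈ Subtype.val ⁻¹' V := by
      rw [hVO]
      change (⟨range y.1, finite_range _⟩ : Conf N) ∈ O
      rw [hy]
      exact hzO
    exact this
  obtain ⟨W, hW, hWV⟩ := isOpen_pi_iff'.1 hV y.1 hyV
  obtain ⟨G, hG, hGd⟩ := z.finite.t2_separation
  refine ⟨fun p => W (e p) ∩ G p.1, fun p => (hW _).1.inter (hG _).2, fun p => ⟨?_, (hG _).1⟩,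
    fun p q h => ?_, ?_⟩
  · have := (hW (e p)).2
    simpa [y] using this
  · exact (hGd p.2 q.2 (fun h' => h (Subtype.ext h'))).mono inter_subset_right inter_subset_right
  · rintro w ⟨x, hx, hr⟩
    have hinj : Function.Injective x := by
      intro p q h
      by_contra hne
      exact Set.disjoint_left.1 (hGd p.2 q.2 (fun h' => hne (Subtype.ext h')))
        (hx p).2 (h ▸ (hx q).2)
    let y' : {x : Fin k → N // Function.Injective x} :=
      ⟨fun i => x (e.symm i), hinj.comp e.symm.injective⟩
    have hy' : y' ∈ Subtype.val ⁻¹' V := by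
      refine hWV fun i _ => ?_
      have := (hx (e.symm i)).1
      simpa [y'] using this
    rw [hVO] at hy'
    have hw : (⟨range y'.1, finite_range _⟩ : Conf N) = w := by
      refine Conf.ext ?_
      change range (x ∘ e.symm) = w.pts
      rw [e.symm.surjective.range_comp, hr]
    exact hOS (hw ▸ hy')

/-- Finite disjoint unions of images of configurations depend continuously on all data. -/
theorem continuousAt_iUnion_image [T2Space N] {N' Z ι : Type*} [TopologicalSpace N'] [T2Space N']
    [TopologicalSpace Z] [Finite ι] (z : Z → ι → Conf N) (f : Z → ι → N → N') (g : Z → Conf N')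
    (a : Z) (hz : ∀ i, ContinuousAt (fun ζ => z ζ i) a)
    (hf : ∀ i, ∀ p ∈ (z a i).pts, ContinuousAt (fun q : Z × N => f q.1 i q.2) (a, p))
    (hinj : ∀ i j p q, p ∈ (z a i).pts → q ∈ (z a j).pts → f a i p = f a j q →
      (⟨i, p⟩ : ι × N) = ⟨j, q⟩)
    (hg : ∀ ζ p', p' ∈ (g ζ).pts ↔ ∃ i, ∃ p ∈ (z ζ i).pts, f ζ i p = p') :
    ContinuousAt g a := by
  intro S hS
  obtain ⟨U, hU, hUm, -, hUS⟩ := exists_near_subset _ hS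
  have hmem : ∀ i, ∀ p : (z a i).pts, f a i p ∈ (g a).pts := fun i p =>
    (hg a _).2 ⟨i, p.1, p.2, rfl⟩
  have hsep := fun i => (z a i).finite.t2_separation
  choose G hG hGd using hsep
  -- Joint continuity of `f` at (a, p) keeps the images of all points near `p` inside the prescribed
  -- neighbourhood of `f a i p`, for all parameters near `a`.
  have key : ∀ i, ∀ p : (z a i).pts, ∃ (V : Set Z) (W : Set N), V ∈ 𝓝 a ∧ IsOpen W ∧ p.1 ∈ W ∧
      ∀ ζ ∈ V, ∀ q ∈ W, f ζ i q ∈ U ⟨f a i p, hmem i p⟩ := by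
    intro i p
    have h := hf i p.1 p.2 ((hU ⟨f a i p, hmem i p⟩).mem_nhds (hUm _))
    rw [mem_map, mem_nhds_prod_iff] at h
    obtain ⟨V, hV, W, hW, hVW⟩ := h
    obtain ⟨W', hW', hWo, hpW⟩ := mem_nhds_iff.1 hW
    exact ⟨V, W', hV, hWo, hpW, fun ζ hζ q hq => hVW (mk_mem_prod hζ (hW' hq))⟩
  choose V W hV hWo hpW hVW using key
  have hev : ∀ i, ∀ᶠ ζ in 𝓝 a, z ζ i ∈ (z a i).near fun p => W i p ∩ G i p.1 := by
    intro i
    refine hz i (near_mem_nhds _ _ (fun p => (hWo i p).inter (hG i _).2)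
      (fun p => ⟨hpW i p, (hG i _).1⟩) fun p q h => ?_)
    exact (hGd i p.2 q.2 (fun h' => h (Subtype.ext h'))).mono inter_subset_right
      inter_subset_right
  have hVe : ∀ i, ∀ᶠ ζ in 𝓝 a, ∀ p, ζ ∈ V i p := by
    intro i
    have : Finite (z a i).pts := (z a i).finite
    exact eventually_all.2 fun p => hV i p
  rw [mem_map]
  filter_upwards [eventually_all.2 hev, eventually_all.2 hVe] with ζ h1 h2
  refine hUS ?_
  choose x hx hxr using h1
  have hch : ∀ p' : (g a).pts, ∃ (i : ι) (p : (z a i).pts), f a i p = p'.1 := fun p' => by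
    obtain ⟨i, p, hp, h⟩ := (hg a p'.1).1 p'.2
    exact ⟨i, ⟨p, hp⟩, h⟩
  choose I P hP using hch
  refine ⟨fun p' => f ζ (I p') (x (I p') (P p')), fun p' => ?_, ?_⟩
  · have := hVW (I p') (P p') ζ (h2 _ _) _ (hx (I p') (P p')).1
    convert this
    exact (hP p').symm
  · ext q
    rw [hg]
    constructor
    · rintro ⟨p', rfl⟩
      refine ⟨I p', _, ?_, rfl⟩
      rw [← hxr]
      exact mem_range_self _
    · rintro ⟨i, p, hp, rfl⟩
      rw [← hxr] at hp
      obtain ⟨p, rfl⟩ := hp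
      refine ⟨⟨f a i p, hmem i p⟩, ?_⟩
      -- Injectivity is needed at the parameter `a` only: it identifies the chosen preimage of `f a
      -- i p` with (i, p), so that no moved point is missed.
      have h := hinj _ _ _ _ (P ⟨f a i p, hmem i p⟩).2 p.2 (hP ⟨f a i p, hmem i p⟩)
      have h3 : ∀ (j : ι) (r : (z a j).pts), (⟨j, r.1⟩ : ι × N) = ⟨i, p.1⟩ →
          f ζ j (x j r) = f ζ i (x i p) := by
        rintro j ⟨r, hr⟩ h
        obtain ⟨rfl, h'⟩ := Prod.mk.inj h
        have h'' : (⟨r, hr⟩ : (z a j).pts) = p := Subtype.ext h'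
        rw [h'']
      exact h3 _ _ h

/-- Being outside the configuration is an open condition on the pair: separate `p` and the points of
`z` by disjoint open sets. -/
lemma eventually_notMem [T2Space N] (z : Conf N) {p : N} (hp : p ∉ z.pts) :
    ∀ᶠ q in 𝓝 (z, p), q.2 ∉ q.1.pts := by
  obtain ⟨G, hG, hGd⟩ := (z.finite.insert p).t2_separation
  rw [nhds_prod_eq]
  have h1 : z.near (fun q => G q.1) ∈ 𝓝 z := by
    refine near_mem_nhds _ _ (fun q => (hG _).2) (fun q => (hG _).1) fun q r h => ?_
    exact hGd (mem_insert_of_mem _ q.2) (mem_insert_of_mem _ r.2) fun h' => h (Subtype.ext h')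
  have h2 : G p ∈ 𝓝 p := (hG p).2.mem_nhds (hG p).1
  filter_upwards [prod_mem_prod h1 h2]
  rintro ⟨w, q⟩ ⟨⟨x, hx, hr⟩, hq⟩ h
  change q ∈ w.pts at h
  rw [← hr] at h
  obtain ⟨r, rfl⟩ := h
  have hne : r.1 ≠ p := fun h => hp (h ▸ r.2)
  exact Set.disjoint_left.1 (hGd (mem_insert_of_mem _ r.2) (mem_insert _ _) hne) (hx r) hq

end Conf

/-! ## Evaluation of configuration-maps -/

namespace ConfMap

variable {N Y : Type*} [TopologicalSpace N] [TopologicalSpace Y]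

lemma continuous_toConf : Continuous (ConfMap.toConf : ConfMap N Y → Conf N) :=
  continuous_iff_le_induced.2 inf_le_left

lemma ext_of_sec {s s' : ConfMap N Y} (h : ∀ p, p ∈ s.pts ↔ p ∈ s'.pts)
    (h' : ∀ p (hp : p ∉ s.pts) (hp' : p ∉ s'.pts), s.sec ⟨p, hp⟩ = s'.sec ⟨p, hp'⟩) : s = s' := by
  obtain ⟨⟨z, hz⟩, f⟩ := s
  obtain ⟨⟨z', hz'⟩, f'⟩ := s'
  obtain rfl : z = z' := Set.ext h
  congr
  ext p
  exact h' p.1 p.2 p.2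

variable [Nonempty Y]

open Classical in
/-- The value at `p`, with an arbitrary value at the points of the configuration. -/
def ev (s : ConfMap N Y) (p : N) : Y :=
  if h : p ∉ s.pts then s.sec ⟨p, h⟩ else Classical.arbitrary Y

lemma ev_eq (s : ConfMap N Y) {p : N} (h : p ∉ s.pts) : s.ev p = s.sec ⟨p, h⟩ :=
  dif_pos h

/-- By local compactness `p` has a compact neighbourhood `K` that avoids the configuration and is
mapped into `U`; the pair (K, U) then defines a subbasic neighbourhood of `s`. -/
theorem continuousAt_ev [T2Space N] [LocallyCompactSpace N] (s : ConfMap N Y) {p : N}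
    (hp : p ∉ s.pts) : ContinuousAt (fun q : ConfMap N Y × N => q.1.ev q.2) (s, p) := by
  intro S hS
  change S ∈ 𝓝 (s.ev p) at hS
  rw [s.ev_eq hp] at hS
  obtain ⟨U, hUS, hU, hpU⟩ := mem_nhds_iff.1 hS
  have hopen : IsOpen s.ptsᶜ := s.finite.isClosed.isOpen_compl
  obtain ⟨O, hO, hO'⟩ := isOpen_induced_iff.1 (hU.preimage s.sec.continuous)
  have hpO : p ∈ O := by
    have : (⟨p, hp⟩ : {p : N // p ∉ s.pts}) ∈ Subtype.val ⁻¹' O := by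
      rw [hO']
      exact hpU
    exact this
  obtain ⟨K, hK, hpK, hKO⟩ := exists_compact_subset (hO.inter hopen) ⟨hpO, hp⟩
  have h1 : {s : ConfMap N Y | ∀ p ∈ K, ∃ h : p ∉ s.pts, s.sec ⟨p, h⟩ ∈ U} ∈ 𝓝 s := by
    have hop : IsOpen {s : ConfMap N Y | ∀ p ∈ K, ∃ h : p ∉ s.pts, s.sec ⟨p, h⟩ ∈ U} := by
      have h0 : IsOpen[.generateFrom {S | ∃ (K : Set N) (U : Set Y), IsCompact K ∧ IsOpen U ∧
          S = {s : ConfMap N Y | ∀ p ∈ K, ∃ h : p ∉ s.pts, s.sec ⟨p, h⟩ ∈ U}}]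
          {s : ConfMap N Y | ∀ p ∈ K, ∃ h : p ∉ s.pts, s.sec ⟨p, h⟩ ∈ U} :=
        TopologicalSpace.isOpen_generateFrom_of_mem ⟨K, U, hK, hU, rfl⟩
      exact h0.mono inf_le_right
    refine hop.mem_nhds fun q hq => ⟨(hKO hq).2, ?_⟩
    have : (⟨q, (hKO hq).2⟩ : {p : N // p ∉ s.pts}) ∈ Subtype.val ⁻¹' O := (hKO hq).1
    rw [hO'] at this
    exact this
  rw [mem_map, nhds_prod_eq]
  filter_upwards [prod_mem_prod h1 (mem_interior_iff_mem_nhds.1 hpK)]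
  rintro ⟨s', q⟩ ⟨hs', hq⟩
  obtain ⟨h, h'⟩ := hs' q hq
  change s'.ev q ∈ S
  rw [s'.ev_eq h]
  exact hUS h'

/-- A map into the space of configuration-maps is continuous if the configuration depends
continuously on the parameter and the values depend continuously on parameter and point. -/
theorem continuous_of_ev [T2Space N] {Z : Type*} [TopologicalSpace Z] {f : Z → ConfMap N Y}
    (h : Continuous fun ζ => (f ζ).toConf)
    (h' : ∀ ζ p, p ∉ (f ζ).pts → ContinuousAt (fun q : Z × N => (f q.1).ev q.2) (ζ, p)) :
    Continuous f := by
  refine continuous_inf_rng.2 ⟨continuous_induced_rng.2 h, continuous_generateFrom_iff.2 ?_⟩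
  rintro _ ⟨K, U, hK, hU, rfl⟩
  refine isOpen_iff_mem_nhds.2 fun ζ hζ => ?_
  have : ∀ᶠ ζ' in 𝓝 ζ, ∀ p ∈ K, p ∉ (f ζ').pts ∧ (f ζ').ev p ∈ U := by
    -- Tube lemma: compactness of `K` makes the neighbourhood of the parameter uniform in the point.
    refine hK.eventually_forall_of_forall_eventually fun p hp => ?_
    obtain ⟨hpz, hpU⟩ := hζ p hp
    have h1 : Tendsto (fun q : Z × N => ((f q.1).toConf, q.2)) (𝓝 (ζ, p))
        (𝓝 ((f ζ).toConf, p)) :=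
      ((h.comp continuous_fst).prodMk continuous_snd).tendsto (ζ, p)
    rw [← (f ζ).ev_eq hpz] at hpU
    exact (h1.eventually ((f ζ).toConf.eventually_notMem hpz)).and
      (h' ζ p hpz (hU.mem_nhds hpU))
  filter_upwards [this] with ζ' h p hp
  obtain ⟨h1, h2⟩ := h p hp
  refine ⟨h1, ?_⟩
  rwa [← (f ζ').ev_eq h1]

/-- The configuration-map with given values outside the configuration. -/
def ofFun (z : Conf N) (v : N → Y) (hv : ∀ p ∉ z.pts, ContinuousAt v p) : ConfMap N Y where
  toConf := z
  sec := ⟨fun p => v p.1, continuous_iff_continuousAt.2 fun p =>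
    (hv p.1 p.2).comp continuous_subtype_val.continuousAt⟩

lemma ev_ofFun {z : Conf N} {v : N → Y} (hv : ∀ p ∉ z.pts, ContinuousAt v p) {p : N}
    (hp : p ∉ z.pts) : (ofFun z v hv).ev p = v p :=
  ev_eq _ hp

/-- Every continuity statement about glued maps is reduced by this to joint continuity of a formula.
The formula may take arbitrary values on the configuration, since a point outside it stays outside
under small changes. -/
theorem continuous_ofFun [T2Space N] {Z : Type*} [TopologicalSpace Z] {z : Z → Conf N}
    {v : Z → N → Y} (hv : ∀ ζ, ∀ p ∉ (z ζ).pts, ContinuousAt (v ζ) p) (hz : Continuous z)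
    (h : ∀ ζ, ∀ p ∉ (z ζ).pts, ContinuousAt (fun q : Z × N => v q.1 q.2) (ζ, p)) :
    Continuous fun ζ => ofFun (z ζ) (v ζ) (hv ζ) := by
  refine continuous_of_ev hz fun ζ p hp => ?_
  have h1 : Tendsto (fun q : Z × N => (z q.1, q.2)) (𝓝 (ζ, p)) (𝓝 (z ζ, p)) :=
    ((hz.comp continuous_fst).prodMk continuous_snd).tendsto (ζ, p)
  refine (h ζ p hp).congr ?_
  filter_upwards [h1.eventually ((z ζ).eventually_notMem hp)] with q hq
  exact (ev_ofFun (hv q.1) hq).symm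

end ConfMap

/-- Gluing continuous functions at a point along a finite closed cover. -/
lemma continuousAt_of_closed_cover {Z Y κ : Type*} [TopologicalSpace Z] [TopologicalSpace Y]
    [Finite κ] {f : Z → Y} {a : Z} (C : κ → Set Z) (hC : ∀ k, IsClosed (C k))
    (hcov : ∀ ζ, ∃ k, ζ ∈ C k) (h : ∀ k, a ∈ C k → ContinuousWithinAt f (C k) a) :
    ContinuousAt f a := by
  have h1 : ∀ k, Tendsto f (𝓝[C k] a) (𝓝 (f a)) := fun k => by
    by_cases ha : a ∈ C k
    · exact h k ha
    · exact continuousWithinAt_of_notMem_closure (by rwa [(hC k).closure_eq])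
  have h2 : (⋃ k, C k) = univ := eq_univ_of_forall fun ζ => mem_iUnion.2 (hcov ζ)
  have h3 : 𝓝 a = ⨆ k, 𝓝[C k] a := by
    rw [← nhdsWithin_univ a, ← h2, nhdsWithin_iUnion]
  change Tendsto f (𝓝 a) (𝓝 (f a))
  rw [h3]
  exact tendsto_iSup.2 h1

/-! ## Monodromy is a local invariant -/

/-- Restricts `e` to the small disc u + εD and reads the result in the coordinates of the disc with
centre `c` and radius `r`. The Jacobian determinant is multiplied by (ε/r)^d > 0. Strictness in `hu`
keeps everything in the open ball, where the derivative of `e` within the disc is an ordinary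
derivative. -/
lemma IsOrientedDiscEmbedding.rescale {d : ℕ} {e : Rn d → Rn d} (he : IsOrientedDiscEmbedding e)
    {u c : Rn d} {ε r : ℝ} (hε : 0 < ε) (hr : 0 < r) (hu : ‖u‖ + ε < 1)
    (hm : ∀ v : Rn d, ‖v‖ ≤ 1 → ‖r⁻¹ • (e (u + ε • v) - c)‖ ≤ 1) :
    IsOrientedDiscEmbedding fun v => r⁻¹ • (e (u + ε • v) - c) := by
  have hin : ∀ v : Rn d, v ∈ Metric.closedBall (0 : Rn d) 1 →
      u + ε • v ∈ Metric.ball (0 : Rn d) 1 := fun v hv => by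
    rw [mem_closedBall_zero_iff] at hv
    rw [mem_ball_zero_iff]
    have h := norm_add_le u (ε • v)
    rw [norm_smul, Real.norm_of_nonneg hε.le] at h
    nlinarith
  have hat : ∀ v ∈ Metric.closedBall (0 : Rn d) 1, ContDiffAt ℝ ∞ e (u + ε • v) := fun v hv =>
    he.contDiffOn.contDiffAt (mem_of_superset (Metric.isOpen_ball.mem_nhds (hin v hv))
      Metric.ball_subset_closedBall)
  constructor
  · intro v hv
    refine ContDiffAt.contDiffWithinAt ?_
    have h1 : ContDiffAt ℝ ∞ (fun v : Rn d => u + ε • v) v := by fun_prop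
    have h2 : ContDiffAt ℝ ∞ (e ∘ fun v : Rn d => u + ε • v) v := ContDiffAt.comp v (hat v hv) h1
    have h3 : ContDiffAt ℝ ∞ (fun v : Rn d => e (u + ε • v) - c) v := h2.sub contDiffAt_const
    exact h3.const_smul r⁻¹
  · intro v hv w hw h
    have h1 := smul_right_injective (Rn d) (inv_ne_zero hr.ne') h
    have h2 := he.injOn (Metric.ball_subset_closedBall (hin v hv))
      (Metric.ball_subset_closedBall (hin w hw)) (sub_left_injective h1)
    exact smul_right_injective (Rn d) hε.ne' (add_right_injective u h2)
  · intro v hv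
    rw [mem_closedBall_zero_iff] at hv ⊢
    exact hm v hv
  · intro v hv
    have hd : HasFDerivAt e (fderivWithin ℝ e (Metric.closedBall 0 1) (u + ε • v))
        (u + ε • v) := by
      rw [fderivWithin_of_mem_nhds (mem_of_superset (Metric.isOpen_ball.mem_nhds (hin v hv))
        Metric.ball_subset_closedBall)]
      exact ((hat v hv).differentiableAt (by simp)).hasFDerivAt
    have ha : HasFDerivAt (fun v : Rn d => u + ε • v) (ε • ContinuousLinearMap.id ℝ (Rn d)) v :=
      ((hasFDerivAt_id v).const_smul ε).const_add u
    have hc := ((hd.comp v ha).sub_const c).const_smul r⁻¹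
    have huniq : UniqueDiffWithinAt ℝ (Metric.closedBall (0 : Rn d) 1) v := by
      refine uniqueDiffOn_convex (convex_closedBall (0 : Rn d) 1) ?_ v hv
      rw [interior_closedBall _ one_ne_zero]
      exact ⟨0, by simp⟩
    have hdet := he.det_pos _ (Metric.ball_subset_closedBall (hin v hv))
    have hc' : HasFDerivAt (fun v => r⁻¹ • (e (u + ε • v) - c)) _ v := hc
    rw [hc'.hasFDerivWithinAt.fderivWithin huniq]
    set A := fderivWithin ℝ e (Metric.closedBall 0 1) (u + ε • v)
    have : r⁻¹ • (A.comp (ε • ContinuousLinearMap.id ℝ (Rn d))) = (r⁻¹ * ε) • A := by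
      ext w
      simp [mul_smul]
    rw [this]
    have h3 : ((r⁻¹ * ε) • A).det = (r⁻¹ * ε) ^ d * A.det := by
      have := LinearMap.det_smul (r⁻¹ * ε) (A : Rn d →ₗ[ℝ] Rn d)
      rw [finrank_euclideanSpace_fin] at this
      exact this
    rw [h3]
    positivity

lemma isOrientedDiscEmbedding_id (d : ℕ) : IsOrientedDiscEmbedding (fun v : Rn d => v) where
  contDiffOn := contDiffOn_id
  injOn := injOn_id _
  mapsTo := mapsTo_id _
  det_pos v hv := by
    have huniq : UniqueDiffWithinAt ℝ (Metric.closedBall (0 : Rn d) 1) v := by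
      refine uniqueDiffOn_convex (convex_closedBall (0 : Rn d) 1) ?_ v hv
      rw [interior_closedBall _ one_ne_zero]
      exact ⟨0, by simp⟩
    rw [fderivWithin_fun_id huniq]
    have : (ContinuousLinearMap.id ℝ (Rn d)).det = 1 := LinearMap.det_id
    rw [this]
    exact one_pos

lemma isOrientedDiscEmbedding_affine {d : ℕ} {u : Rn d} {ε : ℝ} (hε : 0 < ε) (hu : ‖u‖ + ε < 1) :
    IsOrientedDiscEmbedding fun v => u + ε • v := by
  have h := (isOrientedDiscEmbedding_id d).rescale (c := 0) hε one_pos hu fun v hv => by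
    have h := norm_add_le u (ε • v)
    rw [norm_smul, Real.norm_of_nonneg hε.le] at h
    simp only [inv_one, sub_zero, one_smul]
    nlinarith
  simpa using h

lemma norm_lt_of_le_of_add_lt {d : ℕ} {u v : Rn d} {ε : ℝ} (hε : 0 ≤ ε) (hu : ‖u‖ + ε < 1)
    (hv : ‖v‖ ≤ 1) : ‖u + ε • v‖ < 1 := by
  have h := norm_add_le u (ε • v)
  rw [norm_smul, Real.norm_of_nonneg hε] at h
  nlinarith

/-- If `s` agrees with a rescaled copy of `x` near `p`, then the monodromy of `s` around `p` is
that of `x`. -/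
theorem mem_sphClass_of_agree {d : ℕ} {X : Type*} [TopologicalSpace X] {c : Set (SphClass d X)}
    {s x : ConfMap (Disc d) X} (hx : x.HasMonodromy c) {C : Rn d} {r : ℝ} (hr : 0 < r)
    {p y : Disc d} (hyx : y ∈ x.pts) (hy : ‖y.1‖ < 1) (hpy : p.1 = C + r • y.1)
    (hpts : ∀ w q : Disc d, q.1 = C + r • w.1 → w ∈ x.pts → q ∈ s.pts)
    (hsec : ∀ (w q : Disc d) (hw : w ∉ x.pts) (hq : q ∉ s.pts), q.1 = C + r • w.1 →
      s.sec ⟨q, hq⟩ = x.sec ⟨w, hw⟩)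
    {e : Rn d → Rn d} (he : IsOrientedDiscEmbedding e) (hpe : p.1 ∈ e '' Metric.ball 0 1)
    (huniq : ∀ q ∈ s.pts, q.1 ∈ e '' Metric.closedBall 0 1 → q = p) (g : C(Sph d, X))
    (hg : ∀ u : Sph d, ∃ (x : Disc d) (h : x ∉ s.pts), x.1 = e u.1 ∧ s.sec ⟨x, h⟩ = g u) :
    SphClass.mk g ∈ c := by
  obtain ⟨u, hu, heu⟩ := hpe
  rw [mem_ball_zero_iff] at hu
  have hec : ContinuousAt e u :=
    (he.contDiffOn.continuousOn.continuousAt (mem_of_superset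
      (Metric.isOpen_ball.mem_nhds (mem_ball_zero_iff.2 hu)) Metric.ball_subset_closedBall))
  -- As ‖y‖ < 1, the point `p` is interior to the little disc, so `e` maps a small disc around `u`
  -- into it.
  have hball : ∀ᶠ v in 𝓝 u, e v ∈ Metric.ball C r := by
    refine hec (Metric.isOpen_ball.mem_nhds ?_)
    rw [heu, hpy, mem_ball_iff_norm, add_sub_cancel_left, norm_smul, Real.norm_of_nonneg hr.le]
    nlinarith
  obtain ⟨δ, hδ, hδb⟩ := Metric.eventually_nhds_iff.1 hball
  obtain ⟨ε, hε, hεδ, hεu⟩ : ∃ ε, 0 < ε ∧ ε < δ ∧ ‖u‖ + ε < 1 := by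
    refine ⟨min δ (1 - ‖u‖) / 2, ?_, ?_, ?_⟩
    · have : 0 < min δ (1 - ‖u‖) := lt_min hδ (by linarith)
      linarith
    · have := min_le_left δ (1 - ‖u‖)
      have : 0 < min δ (1 - ‖u‖) := lt_min hδ (by linarith)
      linarith
    · have := min_le_right δ (1 - ‖u‖)
      linarith
  have hcb : ∀ v : Rn d, ‖v‖ ≤ 1 → u + ε • v ∈ Metric.closedBall (0 : Rn d) 1 := fun v hv =>
    mem_closedBall_zero_iff.2 (norm_lt_of_le_of_add_lt hε.le hεu hv).le
  have hin : ∀ v : Rn d, ‖v‖ ≤ 1 → ‖r⁻¹ • (e (u + ε • v) - C)‖ ≤ 1 := fun v hv => by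
    have h1 : dist (u + ε • v) u < δ := by
      rw [dist_eq_norm, add_sub_cancel_left, norm_smul, Real.norm_of_nonneg hε.le]
      nlinarith
    have h2 := hδb h1
    rw [mem_ball_iff_norm] at h2
    rw [norm_smul, norm_inv, Real.norm_of_nonneg hr.le, inv_mul_le_iff₀ hr]
    linarith
  have he' := he.rescale (c := C) hε hr hεu hin
  -- The shrunk embedding in the coordinates of `x`; the monodromy hypothesis on `x` will be applied
  -- to it.
  set e' : Rn d → Rn d := fun v => r⁻¹ • (e (u + ε • v) - C) with he'd
  have hee : ∀ v, e (u + ε • v) = C + r • e' v := fun v => by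
    simp only [he'd]
    rw [smul_inv_smul₀ hr.ne']
    abel
  -- the only point of `s` in the image of `e` is `p = e u`
  have hns : ∀ (z : Rn d) (hz : ‖z‖ ≤ 1) (hze : ‖e z‖ ≤ 1), z ≠ u →
      (⟨e z, mem_closedBall_zero_iff.2 hze⟩ : Disc d) ∉ s.pts := by
    intro z hz hze hne h
    have h1 := huniq _ h ⟨z, mem_closedBall_zero_iff.2 hz, rfl⟩
    have h2 : e z = e u := by rw [heu, ← h1]
    exact hne (he.injOn (mem_closedBall_zero_iff.2 hz) (mem_closedBall_zero_iff.2 hu.le) h2)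
  have hen : ∀ z : Rn d, ‖z‖ ≤ 1 → ‖e z‖ ≤ 1 := fun z hz =>
    mem_closedBall_zero_iff.1 (he.mapsTo (mem_closedBall_zero_iff.2 hz))
  -- A point of `x` in the image of `e'` gives a point of `s` in the image of `e`, which can only be
  -- `p = e u`.
  have hxy : ∀ w ∈ x.pts, ∀ v : Rn d, ‖v‖ ≤ 1 → w.1 = e' v → u + ε • v = u := by
    intro w hw v hv hwv
    by_contra hne
    refine hns _ (mem_closedBall_zero_iff.1 (hcb v hv))
      (hen _ (mem_closedBall_zero_iff.1 (hcb v hv))) hne (hpts w _ ?_ hw)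
    rw [hwv, ← hee]
  have hv0 : ∀ v : Rn d, u + ε • v = u → v = 0 := fun v h => by
    have : ε • v = 0 := by simpa using h
    exact (smul_eq_zero.1 this).resolve_left hε.ne'
  have hy0 : y.1 = e' 0 := by
    simp only [he'd, smul_zero, add_zero]
    rw [heu, hpy, add_sub_cancel_left, inv_smul_smul₀ hr.ne']
  have hsph : ∀ v : Sph d, ‖v.1‖ = 1 := fun v => mem_sphere_zero_iff_norm.1 v.2
  have hsx : ∀ v : Sph d,
      (⟨e' v.1, mem_closedBall_zero_iff.2 (hin v.1 (hsph v).le)⟩ : Disc d) ∉ x.pts := by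
    intro v h
    have h1 := hv0 _ (hxy _ h v.1 (hsph v).le rfl)
    have h2 := hsph v
    rw [h1, norm_zero] at h2
    exact zero_ne_one h2
  have hce : Continuous fun z : Metric.closedBall (0 : Rn d) 1 => e z.1 :=
    continuousOn_iff_continuous_domRestrict.1 he.contDiffOn.continuousOn
  have hce' : Continuous fun z : Metric.closedBall (0 : Rn d) 1 => e' z.1 :=
    continuousOn_iff_continuous_domRestrict.1 he'.contDiffOn.continuousOn
  let g' : C(Sph d, X) := ⟨fun v => x.sec ⟨_, hsx v⟩, by
    refine x.sec.continuous.comp (Continuous.subtype_mk (Continuous.subtype_mk ?_ _) _)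
    exact hce'.comp (f := fun v : Sph d => v.toDisc) (Continuous.subtype_mk continuous_subtype_val _)⟩
  have hg' : SphClass.mk g' ∈ c := by
    refine hx e' he' y hyx ⟨0, by simp, hy0.symm⟩ ?_ g' fun v => ⟨_, hsx v, rfl, rfl⟩
    rintro q hq ⟨v, hv, hqv⟩
    have h1 := hv0 _ (hxy q hq v (mem_closedBall_zero_iff.1 hv) hqv.symm)
    exact Subtype.ext (by rw [← hqv, h1, hy0])
  -- the straight-line homotopy
  have hz1 : ∀ q : unitInterval × Sph d, ‖(1 - q.1.1) • (u + ε • q.2.1) + q.1.1 • q.2.1‖ ≤ 1 := by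
    intro q
    refine mem_closedBall_zero_iff.1 ((convex_closedBall (0 : Rn d) 1) (hcb _ (hsph q.2).le)
      (mem_closedBall_zero_iff.2 (hsph q.2).le) ?_ q.1.2.1 ?_)
    · linarith [q.1.2.2]
    · ring
  have hz2 : ∀ q : unitInterval × Sph d,
      (1 - q.1.1) • (u + ε • q.2.1) + q.1.1 • q.2.1 ≠ u := by
    intro q h
    obtain ⟨⟨τ, h0, h1⟩, v⟩ := q
    simp only at h
    -- The segment from u + εv to v misses `u`: otherwise comparing norms would give (1 - τ)ε + τ =
    -- τ‖u‖, which is impossible because ε > 0 and ‖u‖ < 1.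
    have h2 : ((1 - τ) * ε + τ) • v.1 = τ • u := by
      have : ((1 - τ) * ε + τ) • v.1 = (1 - τ) • (u + ε • v.1) + τ • v.1 - (1 - τ) • u := by
        module
      rw [this, h]
      module
    have h3 := congrArg norm h2
    have h4 : 0 ≤ (1 - τ) * ε + τ := by nlinarith
    rw [norm_smul, norm_smul, hsph v, Real.norm_of_nonneg h0, Real.norm_of_nonneg h4] at h3
    rcases h0.eq_or_lt with h5 | h5
    · subst h5
      linarith
    · nlinarith
  -- Composed with `e` and `s`, the segments join the small sphere, where `s` is a copy of `x`, to
  -- the boundary of the original disc, without meeting the configuration.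
  let H : ContinuousMap.Homotopy g' g :=
    { toFun := fun q => s.sec ⟨⟨e _, mem_closedBall_zero_iff.2 (hen _ (hz1 q))⟩,
        hns _ (hz1 q) (hen _ (hz1 q)) (hz2 q)⟩
      continuous_toFun := by
        refine s.sec.continuous.comp (Continuous.subtype_mk (Continuous.subtype_mk ?_ _) _)
        refine hce.comp (f := fun q : unitInterval × Sph d =>
          (⟨_, mem_closedBall_zero_iff.2 (hz1 q)⟩ : Metric.closedBall (0 : Rn d) 1)) ?_
        refine Continuous.subtype_mk ?_ _
        fun_prop
      map_zero_left := fun v => by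
        refine hsec _ _ (hsx v) _ ?_
        simp only [Set.Icc.coe_zero, sub_zero, one_smul, zero_smul, add_zero]
        exact hee v.1
      map_one_left := fun v => by
        obtain ⟨q, hq, hqe, hqg⟩ := hg v
        rw [← hqg]
        congr 2
        refine Subtype.ext ?_
        simp [hqe] }
  have : SphClass.mk g' = SphClass.mk g := Quotient.sound ⟨H⟩
  rwa [← this]

/-! ## Coordinates on the cylinder -/

/-- The coordinatewise retraction onto the cube. -/
def clampCube {n : ℕ} (v : Fin n → ℝ) : Cube n :=
  ⟨fun j => max (-1) (min 1 (v j)), fun j => le_max_left _ _, fun j =>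
    max_le (by norm_num [Pi.one_apply]) (min_le_left _ _)⟩

lemma continuous_clampCube {n : ℕ} : Continuous (clampCube : (Fin n → ℝ) → Cube n) := by
  refine Continuous.subtype_mk ?_ _
  fun_prop

lemma clampCube_apply {n : ℕ} {v : Fin n → ℝ} {j : Fin n} (h : |v j| ≤ 1) :
    (clampCube v).1 j = v j := by
  obtain ⟨h1, h2⟩ := abs_le.1 h
  simp only [clampCube]
  rw [min_eq_right h2, max_eq_right h1]

lemma Cube.abs_le {n : ℕ} (v : Cube n) (j : Fin n) : |v.1 j| ≤ 1 :=
  _root_.abs_le.2 ⟨v.2.1 j, v.2.2 j⟩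

/-- The part `[0,∞) × [-1,1]^n` of `ℝ^{n+1}`. -/
def box (n : ℕ) : Set (Rn (n + 1)) := {q | 0 ≤ q 0 ∧ ∀ j : Fin n, |q j.succ| ≤ 1}

/-- The part `(0,∞) × (-1,1)^n` of `ℝ^{n+1}`. -/
def openBox (n : ℕ) : Set (Rn (n + 1)) := {q | 0 < q 0 ∧ ∀ j : Fin n, |q j.succ| < 1}

lemma openBox_subset_box (n : ℕ) : openBox n ⊆ box n := fun _ h => ⟨h.1.le, fun j => (h.2 j).le⟩

lemma continuous_coord {n : ℕ} (j : Fin n) : Continuous fun q : Rn n => q j := by fun_prop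

lemma isOpen_openBox (n : ℕ) : IsOpen (openBox n) := by
  have : openBox n = {q | 0 < q 0} ∩ ⋂ j : Fin n, {q | |q j.succ| < 1} := by
    ext q
    simp [openBox]
  rw [this]
  exact (isOpen_lt continuous_const (continuous_coord 0)).inter (isOpen_iInter_of_finite fun j =>
    isOpen_lt (continuous_coord j.succ).abs continuous_const)

lemma convex_openBox (n : ℕ) : Convex ℝ (openBox n) := by
  intro p hp q hq a b ha hb hab
  constructor
  · simp only [PiLp.add_apply, PiLp.smul_apply, smul_eq_mul]
    have h1 := hp.1
    have h2 := hq.1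
    rcases ha.eq_or_lt with h | h
    · subst h
      have : b = 1 := by linarith
      subst this
      linarith
    · nlinarith [mul_pos h h1, mul_nonneg hb h2.le]
  · intro j
    have h1 : p j.succ ∈ Metric.ball (0 : ℝ) 1 := by simpa using hp.2 j
    have h2 : q j.succ ∈ Metric.ball (0 : ℝ) 1 := by simpa using hq.2 j
    simpa using (convex_ball (0 : ℝ) 1) h1 h2 ha hb hab

section Coord

variable {n : ℕ} {M E X : Type*} [TopologicalSpace M]
  [ChartedSpace (EuclideanHalfSpace (n + 1)) M] [TopologicalSpace E] [TopologicalSpace X]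
  {D : BoundaryDisc n M} {ξ : E → M}

instance [T2Space M] : T2Space (Hat D) :=
  inferInstanceAs (T2Space {p : M × ℝ // 0 ≤ p.2 ∧ (p.2 = 0 ∨ p.1 ∈ D.carrier)})

lemma BoundaryDisc.isClosed_carrier [T2Space M] : IsClosed D.carrier :=
  (isCompact_range D.isEmbedding.continuous).isClosed

/-- The disc D is compact, so M̂ is closed in M × ℝ. Local compactness is what joint continuity of
evaluation on M̂ requires. -/
lemma Hat.locallyCompactSpace [T2Space M] : LocallyCompactSpace (Hat D) := by
  have : LocallyCompactSpace M := Manifold.locallyCompact_of_finiteDimensional (𝓡∂ (n + 1))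
  have h : IsClosed {p : M × ℝ | 0 ≤ p.2 ∧ (p.2 = 0 ∨ p.1 ∈ D.carrier)} :=
    (isClosed_le continuous_const continuous_snd).inter
      ((isClosed_eq continuous_snd continuous_const).union
        (D.isClosed_carrier.preimage continuous_fst))
  exact h.locallyCompactSpace

lemma Hat.continuous_height : Continuous (Hat.height : Hat D → ℝ) :=
  continuous_snd.comp continuous_subtype_val

lemma Hat.height_nonneg (p : Hat D) : 0 ≤ p.height := p.2.1

lemma Hat.mem_carrier_of_height_pos {p : Hat D} (h : 0 < p.height) : p.1.1 ∈ D.carrier :=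
  p.2.2.resolve_left h.ne'

/-- The point of the cylinder with given coordinates in `[0,∞) × [-1,1]^n`. -/
def Hat.pt (D : BoundaryDisc n M) (q : Rn (n + 1)) : Hat D :=
  Hat.cyl D (max 0 (q 0)) (le_max_left _ _) (clampCube fun j => q j.succ)

lemma Hat.continuous_pt : Continuous (Hat.pt D) := by
  refine Continuous.subtype_mk (Continuous.prodMk ?_ ?_) _
  · exact D.isEmbedding.continuous.comp (continuous_clampCube.comp (by fun_prop))
  · fun_prop

lemma Hat.isAt_pt {q : Rn (n + 1)} (hq : q ∈ box n) : (Hat.pt D q).IsAt q :=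
  ⟨max_eq_right hq.1, clampCube fun j => q j.succ, rfl, fun j => clampCube_apply (hq.2 j)⟩

lemma Hat.IsAt.mem_box {p : Hat D} {q : Rn (n + 1)} (h : p.IsAt q) : q ∈ box n := by
  obtain ⟨h1, v, -, h2⟩ := h
  refine ⟨h1 ▸ p.height_nonneg, fun j => ?_⟩
  rw [← h2]
  exact v.abs_le j

lemma Hat.IsAt.mem_carrier {p : Hat D} {q : Rn (n + 1)} (h : p.IsAt q) : p.1.1 ∈ D.carrier := by
  obtain ⟨-, v, h, -⟩ := h
  exact ⟨v, h⟩

lemma Hat.IsAt.eq {p p' : Hat D} {q : Rn (n + 1)} (h : p.IsAt q) (h' : p'.IsAt q) : p = p' := by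
  obtain ⟨h1, v, h2, h3⟩ := h
  obtain ⟨h1', v', h2', h3'⟩ := h'
  have : v = v' := Subtype.ext (funext fun j => by rw [h3, h3'])
  subst this
  exact Subtype.ext (Prod.ext (h2.symm.trans h2') (h1.trans h1'.symm))

lemma Hat.IsAt.eq_pt {p : Hat D} {q : Rn (n + 1)} (h : p.IsAt q) : p = Hat.pt D q :=
  h.eq (Hat.isAt_pt h.mem_box)

lemma Hat.IsAt.unique {p : Hat D} {q q' : Rn (n + 1)} (h : p.IsAt q) (h' : p.IsAt q') :
    q = q' := by
  obtain ⟨h1, v, h2, h3⟩ := h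
  obtain ⟨h1', v', h2', h3'⟩ := h'
  have : v = v' := D.isEmbedding.injective (h2.trans h2'.symm)
  subst this
  ext j
  refine Fin.cases ?_ (fun j => ?_) j
  · rw [← h1, ← h1']
  · rw [← h3, ← h3']

open Classical in
/-- The cube coordinate of a point of the cylinder. -/
def Hat.cubeCoord (p : Hat D) : Cube n :=
  if h : p.1.1 ∈ D.carrier then D.isEmbedding.toHomeomorph.symm ⟨p.1.1, h⟩ else clampCube 0

lemma Hat.emb_cubeCoord {p : Hat D} (h : p.1.1 ∈ D.carrier) : D.emb p.cubeCoord = p.1.1 := by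
  rw [Hat.cubeCoord, dif_pos h]
  exact congrArg Subtype.val (D.isEmbedding.toHomeomorph.apply_symm_apply ⟨p.1.1, h⟩)

/-- Positive height forces a point to lie over D, and it is an open condition. At height 0 the
coordinate has a default value off D and need not be continuous. -/
lemma Hat.continuousAt_cubeCoord {p : Hat D} (h : 0 < p.height) :
    ContinuousAt (Hat.cubeCoord : Hat D → Cube n) p := by
  have h1 : ContinuousOn (Hat.cubeCoord : Hat D → Cube n) {p | 0 < p.height} := by
    rw [continuousOn_iff_continuous_domRestrict]
    have : Continuous fun q : {p : Hat D | 0 < p.height} =>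
        D.isEmbedding.toHomeomorph.symm ⟨q.1.1.1, Hat.mem_carrier_of_height_pos q.2⟩ := by
      refine (Homeomorph.continuous _).comp (Continuous.subtype_mk ?_ _)
      exact continuous_fst.comp (continuous_subtype_val.comp continuous_subtype_val)
    refine this.congr fun q => ?_
    change _ = Hat.cubeCoord q.1
    rw [Hat.cubeCoord, dif_pos (Hat.mem_carrier_of_height_pos q.2)]
  exact h1.continuousAt ((isOpen_lt continuous_const Hat.continuous_height).mem_nhds h)

/-- The coordinates in `[0,∞) × [-1,1]^n` of a point of the cylinder. -/
def Hat.coord (p : Hat D) : Rn (n + 1) :=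
  WithLp.toLp 2 (Fin.cons (α := fun _ => ℝ) p.height p.cubeCoord.1)

lemma Hat.isAt_coord {p : Hat D} (h : p.1.1 ∈ D.carrier) : p.IsAt p.coord :=
  ⟨by simp [Hat.coord], p.cubeCoord, Hat.emb_cubeCoord h, fun j => by simp [Hat.coord]⟩

lemma Hat.coord_zero (p : Hat D) : p.coord 0 = p.height := by simp [Hat.coord]

lemma Hat.continuousAt_coord {p : Hat D} (h : 0 < p.height) :
    ContinuousAt (Hat.coord : Hat D → Rn (n + 1)) p := by
  refine (PiLp.continuous_toLp 2 _).continuousAt.comp (continuousAt_pi.2 fun j => ?_)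
  refine Fin.cases ?_ (fun j => ?_) j
  · simp only [Fin.cons_zero]
    exact Hat.continuous_height.continuousAt
  · simp only [Fin.cons_succ]
    exact ((continuous_apply j).comp continuous_subtype_val).continuousAt.comp
      (Hat.continuousAt_cubeCoord h)

/-- On the open set of positive height `Hat.coord` is continuous and inverse to `Hat.pt`, so the
image is a preimage under `Hat.coord`. This provides the open interiors of balls in the cylinder. -/
lemma Hat.isOpen_image_pt {O : Set (Rn (n + 1))} (hO : IsOpen O) (hOb : O ⊆ openBox n) :
    IsOpen (Hat.pt D '' O) := by
  have h : Hat.pt D '' O = {p : Hat D | 0 < p.height ∧ p.coord ∈ O} := by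
    ext p
    constructor
    · rintro ⟨q, hq, rfl⟩
      have h1 := Hat.isAt_pt (D := D) (openBox_subset_box n (hOb hq))
      have h2 := (Hat.isAt_coord h1.mem_carrier).unique h1
      refine ⟨?_, ?_⟩
      · rw [h1.1]
        exact (hOb hq).1
      · rwa [h2]
    · rintro ⟨h1, h2⟩
      exact ⟨_, h2, (Hat.isAt_coord (Hat.mem_carrier_of_height_pos h1)).eq_pt.symm⟩
  rw [h]
  refine isOpen_iff_mem_nhds.2 fun p hp => ?_
  exact inter_mem ((isOpen_lt continuous_const Hat.continuous_height).mem_nhds hp.1)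
    (Hat.continuousAt_coord hp.1 (hO.mem_nhds hp.2))

/-- The point of `Ê` over the point `p` of the cylinder with given `X`-coordinate. -/
def HatE.over (T : DiscTrivialization D ξ X) (p : Hat D) (x : X) : HatE D ξ :=
  HatE.cyl T p.height p.height_nonneg p.cubeCoord x

lemma HatE.hatProj_over (T : DiscTrivialization D ξ X) {p : Hat D} (h : p.1.1 ∈ D.carrier)
    (x : X) : hatProj D ξ (HatE.over T p x) = p := by
  refine Subtype.ext (Prod.ext ?_ rfl)
  have h1 := T.proj (T.homeo.symm (p.cubeCoord, x))
  rw [Homeomorph.apply_symm_apply] at h1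
  exact h1.symm.trans (Hat.emb_cubeCoord h)

lemma HatE.hasValue_over (T : DiscTrivialization D ξ X) (p : Hat D) (x : X) :
    (HatE.over T p x).HasValue T x := by
  refine ⟨(T.homeo.symm (p.cubeCoord, x)).2, ?_⟩
  change (T.homeo (T.homeo.symm (p.cubeCoord, x))).2 = x
  rw [Homeomorph.apply_symm_apply]

/-- The trivialisation is injective, so over the cylinder a point of Ê is determined by its base
point and its X-coordinate. This turns statements about `HasValue` into equalities. -/
lemma HatE.HasValue.ext {T : DiscTrivialization D ξ X} {e e' : HatE D ξ} {x : X}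
    (h : e.HasValue T x) (h' : e'.HasValue T x) (hp : hatProj D ξ e = hatProj D ξ e') :
    e = e' := by
  obtain ⟨h1, h2⟩ := h
  obtain ⟨h1', h2'⟩ := h'
  have hp1 : ξ e.1.1 = ξ e'.1.1 := congrArg (fun p : Hat D => p.1.1) hp
  have hp2 : e.1.2 = e'.1.2 := congrArg (fun p : Hat D => p.1.2) hp
  have h3 : T.homeo ⟨e.1.1, h1⟩ = T.homeo ⟨e'.1.1, h1'⟩ := by
    refine Prod.ext (D.isEmbedding.injective ?_) (h2.trans h2'.symm)
    rw [T.proj, T.proj, hp1]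
  exact Subtype.ext (Prod.ext (congrArg Subtype.val (T.homeo.injective h3)) hp2)

lemma HatE.HasValue.eq_over {T : DiscTrivialization D ξ X} {e : HatE D ξ} {x : X}
    (h : e.HasValue T x) : e = HatE.over T (hatProj D ξ e) x := by
  refine h.ext (HatE.hasValue_over T _ x) ?_
  rw [HatE.hatProj_over]
  exact h.1

lemma HatE.continuousAt_over (T : DiscTrivialization D ξ X) {p : Hat D} (h : 0 < p.height)
    (x : X) : ContinuousAt (fun q : Hat D × X => HatE.over T q.1 q.2) (p, x) := by
  have hc : ContinuousAt (fun q : Hat D × X => q.1.cubeCoord) (p, x) :=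
    ContinuousAt.comp (f := Prod.fst) (g := Hat.cubeCoord) (Hat.continuousAt_cubeCoord h)
      continuous_fst.continuousAt
  have h1 : ContinuousAt (fun q : Hat D × X => (T.homeo.symm (q.1.cubeCoord, q.2)).1) (p, x) :=
    (continuous_subtype_val.comp T.homeo.symm.continuous).continuousAt.comp
      (hc.prodMk continuous_snd.continuousAt)
  have h2 : ContinuousAt (fun q : Hat D × X => q.1.height) (p, x) :=
    (Hat.continuous_height.comp continuous_fst).continuousAt
  exact (h1.prodMk h2).codRestrict (fun q => (HatE.over T q.1 q.2).2)

lemma _root_.ContinuousWithinAt.hatE_over (T : DiscTrivialization D ξ X) {Z : Type*}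
    [TopologicalSpace Z] {f : Z → Hat D} {g : Z → X} {s : Set Z} {a : Z}
    (hf : ContinuousWithinAt f s a) (hg : ContinuousWithinAt g s a) (h : 0 < (f a).height) :
    ContinuousWithinAt (fun z => HatE.over T (f z) (g z)) s a :=
  ContinuousAt.comp_continuousWithinAt (f := fun z => (f z, g z))
    (g := fun q : Hat D × X => HatE.over T q.1 q.2) (HatE.continuousAt_over T h _)
    (hf.prodMk hg)

lemma _root_.ContinuousAt.hatE_over (T : DiscTrivialization D ξ X) {Z : Type*}
    [TopologicalSpace Z] {f : Z → Hat D} {g : Z → X} {a : Z} (hf : ContinuousAt f a)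
    (hg : ContinuousAt g a) (h : 0 < (f a).height) :
    ContinuousAt (fun z => HatE.over T (f z) (g z)) a :=
  ContinuousAt.comp (f := fun z => (f z, g z))
    (g := fun q : Hat D × X => HatE.over T q.1 q.2) (HatE.continuousAt_over T h _)
    (hf.prodMk hg)

end Coord

/-! ## The covering space of local sections -/

namespace LocalSection

variable {d : ℕ} {N E : Type*} [TopologicalSpace N] [TopologicalSpace E] {I : Set N} {ξ : E → N}

lemma int_subset_carrier (l : LocalSection d I ξ) : l.int ⊆ l.carrier := by
  rintro _ ⟨u, -, rfl⟩
  exact mem_range_self u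

lemma Extends.at_eq {l l' : LocalSection d I ξ} (h : l.Extends l') {p : N} (hp : p ∈ l.int)
    (hp' : p ∈ l'.int) : l.at hp = l'.at hp' :=
  congrArg (SingSpace.mk p) (Quot.sound h)

/-- Equal germs at `p` are linked by a finite chain of extensions between balls that contain `p` in
their interiors; the same chain is available at every point of the intersection of these interiors.
-/
lemma eventually_at_eq {l l' : LocalSection d I ξ} {p : N} (hp : p ∈ l.int) (hp' : p ∈ l'.int)
    (h : l.at hp = l'.at hp') :
    ∀ᶠ q in 𝓝 p, ∃ (hq : q ∈ l.int) (hq' : q ∈ l'.int), l.at hq = l'.at hq' := by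
  have h1 : ∀ a b : {l : LocalSection d I ξ // p ∈ l.int},
      Relation.EqvGen (fun l l' : {l : LocalSection d I ξ // p ∈ l.int} => l.1.Extends l'.1) a b →
      ∀ᶠ q in 𝓝 p, ∃ (hq : q ∈ a.1.int) (hq' : q ∈ b.1.int), a.1.at hq = b.1.at hq' := by
    intro a b hab
    induction hab with
    | rel a b h =>
      filter_upwards [a.1.isOpen_int.mem_nhds a.2, b.1.isOpen_int.mem_nhds b.2] with q hq hq'
      exact ⟨hq, hq', h.at_eq hq hq'⟩
    | refl a =>
      filter_upwards [a.1.isOpen_int.mem_nhds a.2] with q hq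
      exact ⟨hq, hq, rfl⟩
    | symm a b _ ih =>
      filter_upwards [ih] with q ⟨hq, hq', h⟩
      exact ⟨hq', hq, h.symm⟩
    | trans a b c _ _ ih ih' =>
      filter_upwards [ih, ih'] with q ⟨hq, _, h⟩ ⟨_, hq', h'⟩
      exact ⟨hq, hq', h.trans h'⟩
  refine h1 ⟨l, hp⟩ ⟨l', hp'⟩ (Quot.eqvGen_exact ?_)
  have h2 : (⟨p, Quot.mk _ ⟨l, hp⟩⟩ : SingSpace d I ξ) = ⟨p, Quot.mk _ ⟨l', hp'⟩⟩ := h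
  simpa using h2

/-- The preimage of a generating open set is the set of points where two germs agree, which is open
by `eventually_at_eq`. -/
lemma continuous_at (l : LocalSection d I ξ) : Continuous fun q : l.int => l.at q.2 := by
  refine continuous_generateFrom_iff.2 ?_
  rintro _ ⟨l', rfl⟩
  refine isOpen_iff_mem_nhds.2 ?_
  rintro ⟨p, hp⟩ ⟨q, hq, h⟩
  have hpq : p = q := congrArg SingSpace.pt h
  subst hpq
  have h1 := eventually_at_eq hp hq h
  rw [nhds_subtype_eq_comap]
  filter_upwards [preimage_mem_comap h1]
  rintro ⟨r, hr⟩ ⟨_, hr', h2⟩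
  exact ⟨r, hr', h2⟩

/-- The interior of the ball is path connected, and `continuous_at` lifts its paths to Σ(ξ). -/
lemma mk_at_eq (l : LocalSection d I ξ) {p q : N} (hp : p ∈ l.int) (hq : q ∈ l.int) :
    ZerothHomotopy.mk (l.at hp) = ZerothHomotopy.mk (l.at hq) := by
  have ⟨u, hu, hup⟩ := hp
  have ⟨w, hw, hwq⟩ := hq
  obtain ⟨γ, hγ⟩ := ((convex_ball (0 : Rn d) 1).isPathConnected ⟨0, by simp⟩).joinedIn u.1
    (mem_ball_zero_iff.2 hu) w.1 (mem_ball_zero_iff.2 hw)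
  let f : unitInterval → Disc d := fun t => ⟨γ t, Metric.ball_subset_closedBall (hγ t)⟩
  have hf : Continuous f := Continuous.subtype_mk γ.continuous _
  have hm : ∀ t, l.ball (f t) ∈ l.int := fun t => mem_image_of_mem _ (mem_ball_zero_iff.1 (hγ t))
  have hc : Continuous fun t => (⟨_, hm t⟩ : l.int) :=
    Continuous.subtype_mk (l.isEmbedding.continuous.comp hf) _
  have e : ∀ (x y : N) (hx : x ∈ l.int) (hy : y ∈ l.int), x = y → l.at hx = l.at hy := by
    rintro x y hx hy rfl
    rfl
  have h0 : l.ball (f 0) = p := by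
    rw [← hup]
    exact congrArg l.ball (Subtype.ext γ.source)
  have h1 : l.ball (f 1) = q := by
    rw [← hwq]
    exact congrArg l.ball (Subtype.ext γ.target)
  let δ : Path (l.at hp) (l.at hq) :=
    { toFun := fun t => l.at (hm t)
      continuous_toFun := l.continuous_at.comp hc
      source' := e _ _ _ _ h0
      target' := e _ _ _ _ h1 }
  exact ZerothHomotopy.sound δ

/-- A criterion for `Extends` in terms of the parametrisation of the larger ball. -/
lemma Extends.of_param {l l' : LocalSection d I ξ} (hc : l.carrier ⊆ l'.int) (F : Disc d → E)
    (hF : ContinuousOn F {u | l'.ball u ∉ l.int}) (hp : ∀ u, l'.ball u ∉ l.int → ξ (F u) = l'.ball u)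
    (hout : ∀ u : Sph d, F u.toDisc = l'.sec u)
    (hin : ∀ (u : Sph d) (w : Disc d), l'.ball w = l.ball u.toDisc → F w = l.sec u) :
    l.Extends l' := by
  have hinj := l'.isEmbedding.injective
  have hE : ∀ u, Function.extend l'.ball F (fun _ => F (Disc.origin d)) (l'.ball u) = F u :=
    fun u => hinj.extend_apply _ _ u
  -- An extension has to be a function on all of `N`; its values off the larger ball do not matter.
  refine ⟨hc, Function.extend l'.ball F (fun _ => F (Disc.origin d)), ?_, ?_, fun u => ⟨?_, ?_⟩⟩
  · rintro _ ⟨⟨u, rfl⟩, hu⟩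
    have himg : l'.carrier \ l.int = l'.ball '' {u | l'.ball u ∉ l.int} := by
      ext p
      constructor
      · rintro ⟨⟨w, rfl⟩, hw⟩
        exact ⟨w, hw, rfl⟩
      · rintro ⟨w, hw, rfl⟩
        exact ⟨mem_range_self w, hw⟩
    rw [himg, ContinuousWithinAt, ← l'.isEmbedding.map_nhdsWithin_eq, tendsto_map'_iff, hE]
    exact Tendsto.congr (fun w => (hE w).symm) (hF u hu)
  · rintro _ ⟨⟨u, rfl⟩, hu⟩
    rw [hE]
    exact hp u hu
  · obtain ⟨w, -, hw⟩ := hc (mem_range_self u.toDisc)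
    rw [← hw, hE]
    exact hin u w hw
  · rw [hE]
    exact hout u

end LocalSection

lemma ConfMap.continuousOn_ev {N Y : Type*} [TopologicalSpace N] [TopologicalSpace Y] [Nonempty Y]
    (s : ConfMap N Y) : ContinuousOn s.ev {p | p ∉ s.pts} := by
  rw [continuousOn_iff_continuous_domRestrict]
  exact s.sec.continuous.congr fun p => (s.ev_eq p.2).symm

/-- Two local sections, on nested balls, that are restrictions of the same section. -/
lemma LocalSection.Extends.of_sec {d : ℕ} {N E : Type*} [TopologicalSpace N] [TopologicalSpace E]
    [Nonempty E] {I : Set N} {ξ : E → N} {s : ConfMap N E} (hs : ∀ p, ξ (s.sec p) = p.1)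
    {l l' : LocalSection d I ξ} (hc : l'.carrier ⊆ l.int)
    (hpts : ∀ q ∈ s.pts, q ∈ l.carrier → q ∈ l'.int)
    (hl : ∀ u : Sph d, ∃ h : l.ball u.toDisc ∉ s.pts, s.sec ⟨l.ball u.toDisc, h⟩ = l.sec u)
    (hl' : ∀ u : Sph d, ∃ h : l'.ball u.toDisc ∉ s.pts, s.sec ⟨l'.ball u.toDisc, h⟩ = l'.sec u) :
    l'.Extends l := by
  have hn : ∀ u, l.ball u ∉ l'.int → l.ball u ∉ s.pts := fun u hu h =>
    hu (hpts _ h (mem_range_self u))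
  refine Extends.of_param hc (fun u => s.ev (l.ball u)) ?_ (fun u hu => ?_) (fun u => ?_)
    fun u w hw => ?_
  · exact s.continuousOn_ev.comp l.isEmbedding.continuous.continuousOn fun u hu => hn u hu
  · rw [s.ev_eq (hn u hu), hs]
  · obtain ⟨h1, h2⟩ := hl u
    rw [s.ev_eq h1, h2]
  · obtain ⟨h1, h2⟩ := hl' u
    simp only [hw]
    rw [s.ev_eq h1, h2]

/-- The map `v ↦ u + ε v` from the disc to itself. -/
def Disc.affine {d : ℕ} (u : Rn d) {ε : ℝ} (hε : 0 < ε) (hu : ‖u‖ + ε < 1) (v : Disc d) : Disc d :=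
  ⟨u + ε • v.1, mem_closedBall_zero_iff.2
    (norm_lt_of_le_of_add_lt hε.le hu (mem_closedBall_zero_iff.1 v.2)).le⟩

namespace Disc

variable {d : ℕ} {u : Rn d} {ε : ℝ} (hε : 0 < ε) (hu : ‖u‖ + ε < 1)

lemma norm_affine_lt (v : Disc d) : ‖(Disc.affine u hε hu v).1‖ < 1 :=
  norm_lt_of_le_of_add_lt hε.le hu (mem_closedBall_zero_iff.1 v.2)

lemma continuous_affine : Continuous (Disc.affine u hε hu) :=
  Continuous.subtype_mk (by fun_prop) _

lemma isEmbedding_affine : IsEmbedding (Disc.affine u hε hu) := by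
  have : CompactSpace (Disc d) := isCompact_iff_compactSpace.1 (isCompact_closedBall _ _)
  refine (Continuous.isClosedEmbedding (continuous_affine hε hu) ?_).isEmbedding
  intro v w h
  have h1 : u + ε • v.1 = u + ε • w.1 := congrArg Subtype.val h
  exact Subtype.ext (smul_right_injective (Rn d) hε.ne' (add_right_injective u h1))

lemma affine_image_int :
    Disc.affine u hε hu '' {v | ‖v.1‖ < 1} = {w | w.1 ∈ Metric.ball u ε} := by
  ext w
  constructor
  · rintro ⟨v, hv, rfl⟩
    change u + ε • v.1 ∈ Metric.ball u ε
    rw [mem_ball_iff_norm, add_sub_cancel_left, norm_smul, Real.norm_of_nonneg hε.le]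
    have : ‖v.1‖ < 1 := hv
    nlinarith
  · intro hw
    have h2 : ‖w.1 - u‖ < ε := mem_ball_iff_norm.1 hw
    have h3 : ‖ε⁻¹ • (w.1 - u)‖ < 1 := by
      rw [norm_smul, norm_inv, Real.norm_of_nonneg hε.le, inv_mul_lt_iff₀ hε]
      linarith
    refine ⟨⟨ε⁻¹ • (w.1 - u), mem_closedBall_zero_iff.2 h3.le⟩, h3, Subtype.ext ?_⟩
    change u + ε • ε⁻¹ • (w.1 - u) = w.1
    rw [smul_inv_smul₀ hε.ne']
    abel

end Disc

/-- A smaller ball inside the ball of a local section. -/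
def LocalSection.sub {d : ℕ} {N E : Type*} [TopologicalSpace N] [TopologicalSpace E] {I : Set N}
    {ξ : E → N} (l : LocalSection d I ξ) (u : Rn d) {ε : ℝ} (hε : 0 < ε) (hu : ‖u‖ + ε < 1)
    (σ : C(Sph d, E)) (hσ : ∀ v : Sph d, ξ (σ v) = l.ball (Disc.affine u hε hu v.toDisc)) :
    LocalSection d I ξ where
  ball v := l.ball (Disc.affine u hε hu v)
  isEmbedding := l.isEmbedding.comp (Disc.isEmbedding_affine hε hu)
  isOpen_int := by
    have hO : IsOpen {w : Disc d | w.1 ∈ Metric.ball u ε} :=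
      Metric.isOpen_ball.preimage continuous_subtype_val
    obtain ⟨O, hO, hO'⟩ := l.isEmbedding.isInducing.isOpen_iff.1 hO
    have h : (fun v : Disc d => l.ball (Disc.affine u hε hu v)) '' {u | ‖u.1‖ < 1} =
        l.int ∩ O := by
      rw [← image_image l.ball, Disc.affine_image_int, ← hO', image_preimage_eq_inter_range,
        inter_comm]
      ext p
      constructor
      · rintro ⟨⟨w, rfl⟩, hw⟩
        refine ⟨⟨w, ?_, rfl⟩, hw⟩
        have h1 : w ∈ l.ball ⁻¹' O := hw
        rw [hO', ← Disc.affine_image_int hε hu] at h1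
        obtain ⟨v, -, rfl⟩ := h1
        exact Disc.norm_affine_lt hε hu v
      · rintro ⟨h1, h2⟩
        exact ⟨l.int_subset_carrier h1, h2⟩
    rw [h]
    exact l.isOpen_int.inter hO
  int_subset := by
    rintro _ ⟨v, hv, rfl⟩
    exact l.int_subset (mem_image_of_mem _ (Disc.norm_affine_lt hε hu v))
  sec := σ
  sec_proj v := hσ v

/-- The charge of a configuration-section at `p` is determined by the section near `p`. -/
theorem ConfMap.HasCharges.of_agree {d : ℕ} {N E : Type*} [TopologicalSpace N]
    [TopologicalSpace E] [Nonempty E] {I : Set N} {ξ : E → N} {s s' : ConfMap N E}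
    (hs : ∀ p, ξ (s.sec p) = p.1) (hs' : ∀ p, ξ (s'.sec p) = p.1) {c : Set (SingClass d I ξ)}
    (hc : s.HasCharges c) {p : N} (hps : p ∈ s.pts) {O : Set N} (hO : O ∈ 𝓝 p)
    (hpts : ∀ q ∈ O, q ∈ s.pts → q ∈ s'.pts)
    (hsec : ∀ q ∈ O, ∀ (h : q ∉ s.pts) (h' : q ∉ s'.pts), s.sec ⟨q, h⟩ = s'.sec ⟨q, h'⟩)
    (l : LocalSection d I ξ) (hp : p ∈ l.int) (hpl : ∀ q ∈ s'.pts, q ∈ l.carrier → q = p)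
    (hl : ∀ u : Sph d, ∃ h : l.ball u.toDisc ∉ s'.pts, s'.sec ⟨l.ball u.toDisc, h⟩ = l.sec u) :
    ZerothHomotopy.mk (l.at hp) ∈ c := by
  obtain ⟨u, hu, hup⟩ := hp
  have hu' : ‖u.1‖ < 1 := hu
  have hlO : l.ball ⁻¹' O ∈ 𝓝 u :=
    l.isEmbedding.continuous.continuousAt (by rw [hup]; exact hO)
  obtain ⟨δ, hδ, hδb⟩ := Metric.mem_nhds_iff.1 hlO
  -- With this ε the small ball about `p` lies in `O`, where `s` and `s'` agree, and in the interior
  -- of the ball of `l`.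
  obtain ⟨ε, hε, hεδ, hεu⟩ : ∃ ε, 0 < ε ∧ ε < δ ∧ ‖u.1‖ + ε < 1 := by
    have : 0 < min δ (1 - ‖u.1‖) := lt_min hδ (by linarith)
    have := min_le_left δ (1 - ‖u.1‖)
    have := min_le_right δ (1 - ‖u.1‖)
    exact ⟨min δ (1 - ‖u.1‖) / 2, by linarith, by linarith, by linarith⟩
  let w : Disc d → Disc d := Disc.affine u.1 hε hεu
  have hwc : Continuous w := Disc.continuous_affine hε hεu
  have hwO : ∀ v, l.ball (w v) ∈ O := fun v => by
    refine hδb ?_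
    rw [Metric.mem_ball, Subtype.dist_eq]
    change dist (u.1 + ε • v.1) u.1 < δ
    rw [dist_eq_norm, add_sub_cancel_left, norm_smul, Real.norm_of_nonneg hε.le]
    have := mem_closedBall_zero_iff.1 v.2
    nlinarith
  have hw1 : ∀ v : Sph d, w v.toDisc ≠ u := fun v h => by
    have h1 : u.1 + ε • v.1 = u.1 := congrArg Subtype.val h
    have h2 : ε • v.1 = 0 := by simpa using h1
    have h3 : v.1 = 0 := (smul_eq_zero.1 h2).resolve_left hε.ne'
    have h4 : ‖v.1‖ = 1 := mem_sphere_zero_iff_norm.1 v.2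
    rw [h3, norm_zero] at h4
    exact zero_ne_one h4
  have hns' : ∀ v : Sph d, l.ball (w v.toDisc) ∉ s'.pts := fun v h => by
    have h1 := hpl _ h (mem_range_self _)
    exact hw1 v (l.isEmbedding.injective (h1.trans hup.symm))
  have hns : ∀ v : Sph d, l.ball (w v.toDisc) ∉ s.pts := fun v h =>
    hns' v (hpts _ (hwO _) h)
  have htd : Continuous (Sph.toDisc : Sph d → Disc d) :=
    Continuous.subtype_mk continuous_subtype_val _
  let σ : C(Sph d, E) := ⟨fun v => s.sec ⟨_, hns v⟩,
    s.sec.continuous.comp (Continuous.subtype_mk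
      (l.isEmbedding.continuous.comp (hwc.comp htd)) _)⟩
  have hσ : ∀ v : Sph d, ξ (σ v) = l.ball (w v.toDisc) := fun v => hs _
  let l' := l.sub u.1 hε hεu σ hσ
  have hpl' : p ∈ l'.int := by
    have h1 : l'.ball (Disc.origin d) = p := by
      rw [← hup]
      refine congrArg l.ball (Subtype.ext ?_)
      simp [Disc.origin, Disc.affine]
    rw [← h1]
    exact mem_image_of_mem _ (by simp [Disc.origin])
  have hcl : l'.carrier ⊆ l.int := by
    rintro _ ⟨v, rfl⟩
    exact mem_image_of_mem _ (Disc.norm_affine_lt hε hεu v)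
  -- Between the two balls `s'` has no configuration points, so `s'` itself is the required
  -- extension; on the small sphere it equals `s`. Hence `l` has the same germ at `p` as a
  -- restriction of `s`.
  have hext : l'.Extends l := by
    refine LocalSection.Extends.of_sec hs' hcl (fun q hq hql => ?_) hl fun v => ⟨hns' v, ?_⟩
    · rw [hpl q hq hql]
      exact hpl'
    · exact (hsec _ (hwO _) (hns v) (hns' v)).symm
  rw [← hext.at_eq hpl' ⟨u, hu, hup⟩]
  refine hc p hps l' hpl' ?_ fun v => ⟨hns v, rfl⟩
  rintro q hq ⟨v, rfl⟩
  exact hpl _ (hpts _ (hwO v) hq) (mem_range_self _)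

/-! ## Round balls in the cylinder -/

open Classical in
/-- The radial projection onto the sphere. -/
def radial {n : ℕ} (z : Rn (n + 1)) : Sph (n + 1) :=
  if h : z ≠ 0 then ⟨‖z‖⁻¹ • z, by
    rw [mem_sphere_zero_iff_norm, norm_smul, norm_inv, norm_norm,
      inv_mul_cancel₀ (norm_ne_zero_iff.2 h)]⟩
  else ⟨EuclideanSpace.single 0 1, by simp⟩

lemma radial_smul {n : ℕ} (v : Sph (n + 1)) {a : ℝ} (ha : 0 < a) : radial (a • v.1) = v := by
  have hv : ‖v.1‖ = 1 := mem_sphere_zero_iff_norm.1 v.2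
  have h0 : a • v.1 ≠ 0 := by
    rw [← norm_ne_zero_iff, norm_smul, hv, mul_one]
    exact norm_ne_zero_iff.2 ha.ne'
  rw [radial, dif_pos h0]
  refine Subtype.ext ?_
  change ‖a • v.1‖⁻¹ • a • v.1 = v.1
  rw [norm_smul, hv, mul_one, Real.norm_of_nonneg ha.le, inv_smul_smul₀ ha.ne']

lemma continuousOn_radial {n : ℕ} : ContinuousOn (radial : Rn (n + 1) → Sph (n + 1)) {z | z ≠ 0} := by
  rw [continuousOn_iff_continuous_domRestrict]
  have : Continuous fun z : {z : Rn (n + 1) | z ≠ 0} => ‖z.1‖⁻¹ • z.1 :=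
    (continuous_subtype_val.norm.inv₀ fun z => norm_ne_zero_iff.2 z.2).smul continuous_subtype_val
  refine continuous_induced_rng.2 (this.congr fun z => ?_)
  change _ = (radial z.1).1
  rw [radial, dif_pos (show z.1 ≠ 0 from z.2)]

section Round

variable {n : ℕ} {M E X : Type*} [TopologicalSpace M]
  [ChartedSpace (EuclideanHalfSpace (n + 1)) M] [TopologicalSpace E] [TopologicalSpace X]
  {D : BoundaryDisc n M} {ξ : E → M}

/-- `l` lives on the boundary of the round ball about `a` of radius `ρ` in the cylinder, and is
given by the map `g` in the trivialisation. -/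
structure IsRound (T : DiscTrivialization D ξ X)
    (l : LocalSection (n + 1) (hatInt D) (hatProj D ξ)) (a : Rn (n + 1)) (ρ : ℝ)
    (g : C(Sph (n + 1), X)) : Prop where
  radius_pos : 0 < ρ
  mem_openBox : ∀ u : Disc (n + 1), a + ρ • u.1 ∈ openBox n
  ball : ∀ u, (l.ball u).IsAt (a + ρ • u.1)
  sec : ∀ u, (l.sec u).HasValue T (g u)

lemma mem_hatInt_of_isAt {p : Hat D} {q : Rn (n + 1)} (h : p.IsAt q) (hq : q ∈ openBox n) :
    p ∈ hatInt D := by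
  obtain ⟨-, v, h1, h2⟩ := h
  exact Or.inr ⟨v, fun j => by rw [h2]; exact hq.2 j, h1⟩

lemma injOn_pt : InjOn (Hat.pt D) (box n) := fun q hq q' hq' h => by
  have h1 := Hat.isAt_pt (D := D) hq
  rw [h] at h1
  exact h1.unique (Hat.isAt_pt hq')

/-- Supplies the balls with which others are compared: the sphere in the cylinder is lifted by
`HatE.over`, with X-coordinate given by `g`. -/
lemma exists_isRound [T2Space M] (T : DiscTrivialization D ξ X) {a : Rn (n + 1)} {ρ : ℝ}
    (hρ : 0 < ρ) (ha : ∀ u : Disc (n + 1), a + ρ • u.1 ∈ openBox n) (g : C(Sph (n + 1), X)) :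
    ∃ l : LocalSection (n + 1) (hatInt D) (hatProj D ξ), IsRound T l a ρ g := by
  have hAt : ∀ u : Disc (n + 1), (Hat.pt D (a + ρ • u.1)).IsAt (a + ρ • u.1) := fun u =>
    Hat.isAt_pt (openBox_subset_box n (ha u))
  have hpos : ∀ u : Disc (n + 1), 0 < (Hat.pt D (a + ρ • u.1)).height := fun u => by
    rw [(hAt u).1]
    exact (ha u).1
  have hcont : Continuous fun u : Disc (n + 1) => Hat.pt D (a + ρ • u.1) :=
    Hat.continuous_pt.comp (by fun_prop)
  have himg : (fun u : Disc (n + 1) => Hat.pt D (a + ρ • u.1)) '' {u | ‖u.1‖ < 1} =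
      Hat.pt D '' Metric.ball a ρ := by
    ext p
    constructor
    · rintro ⟨u, hu, rfl⟩
      refine mem_image_of_mem _ ?_
      rw [mem_ball_iff_norm, add_sub_cancel_left, norm_smul, Real.norm_of_nonneg hρ.le]
      have : ‖u.1‖ < 1 := hu
      nlinarith
    · rintro ⟨w, hw, rfl⟩
      have h2 : ‖w - a‖ < ρ := mem_ball_iff_norm.1 hw
      have h3 : ‖ρ⁻¹ • (w - a)‖ < 1 := by
        rw [norm_smul, norm_inv, Real.norm_of_nonneg hρ.le, inv_mul_lt_iff₀ hρ]
        linarith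
      refine ⟨⟨ρ⁻¹ • (w - a), mem_closedBall_zero_iff.2 h3.le⟩, h3, congrArg (Hat.pt D) ?_⟩
      rw [smul_inv_smul₀ hρ.ne']
      abel
  have hball : Metric.ball a ρ ⊆ openBox n := by
    intro w hw
    have h2 : ‖w - a‖ < ρ := mem_ball_iff_norm.1 hw
    have h3 : ‖ρ⁻¹ • (w - a)‖ < 1 := by
      rw [norm_smul, norm_inv, Real.norm_of_nonneg hρ.le, inv_mul_lt_iff₀ hρ]
      linarith
    have h4 := ha ⟨ρ⁻¹ • (w - a), mem_closedBall_zero_iff.2 h3.le⟩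
    rw [smul_inv_smul₀ hρ.ne', add_sub_cancel] at h4
    exact h4
  have hsec : Continuous fun u : Sph (n + 1) =>
      HatE.over T (Hat.pt D (a + ρ • u.toDisc.1)) (g u) := by
    refine continuous_iff_continuousAt.2 fun u => ?_
    refine ContinuousAt.hatE_over T ?_ g.continuous.continuousAt (hpos u.toDisc)
    exact (hcont.comp (f := fun u : Sph (n + 1) => u.toDisc)
      (Continuous.subtype_mk continuous_subtype_val _)).continuousAt
  refine ⟨{ ball := fun u => Hat.pt D (a + ρ • u.1)
            isEmbedding := ?_
            isOpen_int := ?_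
            int_subset := ?_
            sec := ⟨_, hsec⟩
            sec_proj := fun u => HatE.hatProj_over T (hAt u.toDisc).mem_carrier _ },
    hρ, ha, hAt, fun u => HatE.hasValue_over T _ _⟩
  · have : CompactSpace (Disc (n + 1)) := isCompact_iff_compactSpace.1 (isCompact_closedBall _ _)
    refine (Continuous.isClosedEmbedding hcont ?_).isEmbedding
    intro v w h
    have h1 := injOn_pt (openBox_subset_box n (ha v)) (openBox_subset_box n (ha w)) h
    exact Subtype.ext (smul_right_injective _ hρ.ne' (add_right_injective a h1))
  · rw [himg]
    exact Hat.isOpen_image_pt Metric.isOpen_ball hball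
  · rintro _ ⟨u, -, rfl⟩
    exact mem_hatInt_of_isAt (hAt u) (ha u)

namespace IsRound

variable {T : DiscTrivialization D ξ X} {l l' : LocalSection (n + 1) (hatInt D) (hatProj D ξ)}
  {a a' : Rn (n + 1)} {ρ ρ' : ℝ} {g g' : C(Sph (n + 1), X)}

lemma mem_int (h : IsRound T l a ρ g) {p : Hat D} {w : Rn (n + 1)} (hp : p.IsAt w)
    (hw : ‖w - a‖ < ρ) : p ∈ l.int := by
  have h3 : ‖ρ⁻¹ • (w - a)‖ < 1 := by
    rw [norm_smul, norm_inv, Real.norm_of_nonneg h.radius_pos.le, inv_mul_lt_iff₀ h.radius_pos]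
    linarith
  have h4 := h.ball ⟨ρ⁻¹ • (w - a), mem_closedBall_zero_iff.2 h3.le⟩
  rw [smul_inv_smul₀ h.radius_pos.ne', add_sub_cancel] at h4
  rw [hp.eq h4]
  exact mem_image_of_mem _ h3

lemma isAt_of_mem_carrier (h : IsRound T l a ρ g) {p : Hat D} (hp : p ∈ l.carrier) :
    ∃ w, p.IsAt w ∧ ‖w - a‖ ≤ ρ := by
  obtain ⟨u, rfl⟩ := hp
  refine ⟨_, h.ball u, ?_⟩
  rw [add_sub_cancel_left, norm_smul, Real.norm_of_nonneg h.radius_pos.le]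
  have := mem_closedBall_zero_iff.1 u.2
  have := h.radius_pos
  nlinarith

lemma centre_mem_openBox (h : IsRound T l a ρ g) : a ∈ openBox n := by
  simpa [Disc.origin] using h.mem_openBox (Disc.origin (n + 1))

lemma pt_mem_int (h : IsRound T l a ρ g) : Hat.pt D a ∈ l.int :=
  h.mem_int (Hat.isAt_pt (openBox_subset_box n h.centre_mem_openBox))
    (by simpa using h.radius_pos)

/-- Nested round balls with homotopic maps are related by an extension. -/
lemma extends_of_homotopic (h : IsRound T l a ρ g) (h' : IsRound T l' a' ρ' g')
    (hg : g'.Homotopic g) (h1 : ‖a - a'‖ < ρ) (h2 : ‖a - a'‖ + ρ < ρ') : l.Extends l' := by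
  obtain ⟨H⟩ := hg
  have hρ := h.radius_pos
  have hρ' := h'.radius_pos
  have hδ : 0 < ρ' - ρ - ‖a - a'‖ := by linarith
  set δ := ρ' - ρ - ‖a - a'‖ with hδd
  let w : Disc (n + 1) → Rn (n + 1) := fun u => a' + ρ' • u.1
  have hw : Continuous w := by fun_prop
  -- A cut-off that is 1 on the inner sphere and 0 at distance at least ρ + δ from `a`; every point
  -- of the outer sphere is that far away.
  let f : Disc (n + 1) → unitInterval := fun u => projIcc 0 1 zero_le_one
    (1 - (‖w u - a‖ - ρ) / δ)
  have hf : Continuous f := continuous_projIcc.comp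
    (continuous_const.sub (((hw.sub continuous_const).norm.sub continuous_const).div_const _))
  -- A moving centre, equal to `a` on the inner sphere and to `a'` on the outer one. The extension
  -- applies the homotopy at time `f` to the direction seen from it.
  let χ : Disc (n + 1) → Rn (n + 1) := fun u => a' + (f u).1 • (a - a')
  have hχ : Continuous χ := by
    have : Continuous fun u => (f u).1 := continuous_subtype_val.comp hf
    fun_prop
  have hnorm : ∀ u : Disc (n + 1), l'.ball u ∉ l.int → ρ ≤ ‖w u - a‖ := fun u hu => by
    by_contra hlt
    exact hu (h.mem_int (h'.ball u) (not_le.1 hlt))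
  -- The moving centre stays at distance at most ‖a - a'‖ < ρ from `a`, so it never reaches a point
  -- outside the inner ball and the direction is defined.
  have hne : ∀ u : Disc (n + 1), l'.ball u ∉ l.int → w u - χ u ≠ 0 := by
    intro u hu h0
    have h3 := hnorm u hu
    have h4 : w u - a = -((1 - (f u).1) • (a - a')) := by
      have : w u = χ u := sub_eq_zero.1 h0
      rw [this]
      simp only [χ]
      module
    rw [h4, norm_neg, norm_smul] at h3
    have h5 : ‖1 - (f u).1‖ ≤ 1 := by
      rw [Real.norm_eq_abs, _root_.abs_le]
      constructor <;> linarith [(f u).2.1, (f u).2.2]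
    nlinarith [norm_nonneg (a - a')]
  have hpos : ∀ u : Disc (n + 1), 0 < (l'.ball u).height := fun u => by
    rw [(h'.ball u).1]
    exact (h'.mem_openBox u).1
  refine LocalSection.Extends.of_param ?_
    (fun u => HatE.over T (l'.ball u) (H (f u, radial (w u - χ u)))) ?_ (fun u _ => ?_)
    (fun u => ?_) (fun u v hv => ?_)
  · intro p hp
    obtain ⟨z, hz, hza⟩ := h.isAt_of_mem_carrier hp
    refine h'.mem_int hz ?_
    have : z - a' = (z - a) + (a - a') := by abel
    rw [this]
    linarith [norm_add_le (z - a) (a - a')]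
  · intro u hu
    refine ContinuousWithinAt.hatE_over T l'.isEmbedding.continuous.continuousWithinAt ?_ (hpos u)
    refine H.continuous.continuousAt.comp_continuousWithinAt ?_
    refine ContinuousWithinAt.prodMk hf.continuousWithinAt ?_
    exact (continuousOn_radial.comp (hw.sub hχ).continuousOn hne) u hu
  · exact HatE.hatProj_over T (h'.ball u).mem_carrier _
  · have hu : ‖u.1‖ = 1 := mem_sphere_zero_iff_norm.1 u.2
    have h3 : δ ≤ ‖w u.toDisc - a‖ - ρ := by
      have h4 : w u.toDisc - a' = ρ' • u.1 := by simp [w, Sph.toDisc]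
      have h5 := norm_add_le (w u.toDisc - a) (a - a')
      rw [sub_add_sub_cancel, h4, norm_smul, hu, Real.norm_of_nonneg hρ'.le] at h5
      linarith
    have h4 : f u.toDisc = 0 := by
      refine projIcc_of_le_left _ ?_
      have := (one_le_div hδ).2 h3
      linarith
    have h5 : w u.toDisc - χ u.toDisc = ρ' • u.1 := by
      have h6 : w u.toDisc = a' + ρ' • u.1 := rfl
      simp only [χ, h4, h6]
      simp
    have h6 : H (f u.toDisc, radial (w u.toDisc - χ u.toDisc)) = g' u := by
      rw [h4, h5, radial_smul u hρ', H.apply_zero]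
    simp only [h6]
    refine (HatE.hasValue_over T _ _).ext (h'.sec u) ?_
    rw [HatE.hatProj_over T (h'.ball u.toDisc).mem_carrier, l'.sec_proj]
  · have h3 : w v = a + ρ • u.1 := by
      have h4 := h'.ball v
      rw [hv] at h4
      exact h4.unique (h.ball u.toDisc)
    have hu : ‖u.1‖ = 1 := mem_sphere_zero_iff_norm.1 u.2
    have h4 : f v = 1 := by
      refine projIcc_of_right_le _ ?_
      rw [h3, add_sub_cancel_left, norm_smul, hu, Real.norm_of_nonneg hρ.le]
      simp
    have h5 : w v - χ v = ρ • u.1 := by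
      simp only [χ, h4, h3]
      simp
    have h6 : H (f v, radial (w v - χ v)) = g u := by
      rw [h4, h5, radial_smul u hρ, H.apply_one]
    simp only [h6, hv]
    refine (HatE.hasValue_over T _ _).ext (h.sec u) ?_
    rw [HatE.hatProj_over T (h.ball u.toDisc).mem_carrier, l.sec_proj]

/-- A smaller round ball that is contained in a given round ball. -/
lemma exists_smaller [T2Space M] (h : IsRound T l a ρ g) {b : Rn (n + 1)} {σ : ℝ} (hσ : 0 < σ)
    (hb : ‖b - a‖ + σ ≤ ρ) (k : C(Sph (n + 1), X)) : ∃ m, IsRound T m b σ k := by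
  refine exists_isRound T hσ (fun u => ?_) k
  have h3 : ‖ρ⁻¹ • (b - a + σ • u.1)‖ ≤ 1 := by
    rw [norm_smul, norm_inv, Real.norm_of_nonneg h.radius_pos.le, inv_mul_le_iff₀ h.radius_pos]
    have h4 := norm_add_le (b - a) (σ • u.1)
    rw [norm_smul, Real.norm_of_nonneg hσ.le] at h4
    have := mem_closedBall_zero_iff.1 u.2
    nlinarith
  have h4 := h.mem_openBox ⟨ρ⁻¹ • (b - a + σ • u.1), mem_closedBall_zero_iff.2 h3⟩
  rw [smul_inv_smul₀ h.radius_pos.ne'] at h4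
  convert h4 using 1
  abel

/-- For concentric balls of arbitrary radii neither need lie in the interior of the other; both are
compared with a smaller concentric ball that carries `g`. -/
lemma at_eq_of_homotopic [T2Space M] (h : IsRound T l a ρ g) (h' : IsRound T l' a ρ' g')
    (hg : g'.Homotopic g) {p : Hat D} (hp : p ∈ l.int) (hp' : p ∈ l'.int) (hpa : p.IsAt a) :
    l.at hp = l'.at hp' := by
  have h1 := h.radius_pos
  have h2 := h'.radius_pos
  have h3 : 0 < min ρ ρ' := lt_min h1 h2
  have h4 := min_le_left ρ ρ'
  have h5 := min_le_right ρ ρ'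
  obtain ⟨m, hm⟩ := h.exists_smaller (b := a) (σ := min ρ ρ' / 2) (by linarith)
    (by simp; linarith) g
  have hpm : p ∈ m.int := hm.mem_int hpa (by simpa using h3)
  rw [← (hm.extends_of_homotopic h (.refl g) (by simpa using h3) (by simp; linarith)).at_eq hpm hp]
  exact (hm.extends_of_homotopic h' hg (by simpa using h3) (by simp; linarith)).at_eq hpm hp'

/-- For `b` close to `a`, the ball of radius ρ/2 about `b` with the same map extends to `l`, so the
germ at `b` is a germ of `l`; all germs of `l` lie in one component. -/
lemma eventually_mk_eq [T2Space M] (h : IsRound T l a ρ g) :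
    ∀ᶠ b in 𝓝 a, ∀ (k : LocalSection (n + 1) (hatInt D) (hatProj D ξ)) (σ : ℝ),
      IsRound T k b σ g → ∀ (p q : Hat D) (hp : p ∈ l.int) (hq : q ∈ k.int), p.IsAt a → q.IsAt b →
        ZerothHomotopy.mk (k.at hq) = ZerothHomotopy.mk (l.at hp) := by
  have hρ := h.radius_pos
  filter_upwards [Metric.ball_mem_nhds a (half_pos hρ)] with b hb k σ hk p q hp hq hpa hqb
  have hb' : ‖b - a‖ < ρ / 2 := mem_ball_iff_norm.1 hb
  obtain ⟨m, hm⟩ := h.exists_smaller (b := b) (half_pos hρ) (by linarith) g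
  have hqm : q ∈ m.int := hm.mem_int hqb (by simpa using hρ)
  have hql : q ∈ l.int := h.mem_int hqb (by linarith)
  rw [hk.at_eq_of_homotopic hm (.refl g) hq hqm hqb,
    (hm.extends_of_homotopic h (.refl g) hb' (by linarith)).at_eq hqm hql]
  exact l.mk_at_eq hql hp

/-- The component of the germ of a round ball only depends on the homotopy class of the map. -/
theorem mk_eq [T2Space M] (h : IsRound T l a ρ g) (h' : IsRound T l' a' ρ' g')
    (hg : g'.Homotopic g) {p p' : Hat D} (hp : p ∈ l.int) (hp' : p' ∈ l'.int) (hpa : p.IsAt a)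
    (hpa' : p'.IsAt a') :
    ZerothHomotopy.mk (l.at hp) = ZerothHomotopy.mk (l'.at hp') := by
  have hex : ∀ b : openBox n, ∃ (k : LocalSection (n + 1) (hatInt D) (hatProj D ξ)) (σ : ℝ),
      IsRound T k b.1 σ g := by
    intro b
    obtain ⟨δ, hδ, hδb⟩ := Metric.isOpen_iff.1 (isOpen_openBox n) b.1 b.2
    have hin : ∀ u : Disc (n + 1), b.1 + (δ / 2) • u.1 ∈ openBox n := fun u => by
      refine hδb ?_
      rw [mem_ball_iff_norm, add_sub_cancel_left, norm_smul, Real.norm_of_nonneg (by linarith)]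
      have := mem_closedBall_zero_iff.1 u.2
      nlinarith
    obtain ⟨k, hk⟩ := exists_isRound T (half_pos hδ) hin g
    exact ⟨k, _, hk⟩
  choose k σ hk using hex
  -- The component as a function of the centre alone: it is locally constant on the convex, hence
  -- connected, open box.
  let Φ : openBox n → SingClass (n + 1) (hatInt D) (hatProj D ξ) := fun b =>
    ZerothHomotopy.mk ((k b).at (hk b).pt_mem_int)
  have hΦ : IsLocallyConstant Φ := by
    refine (IsLocallyConstant.iff_eventually_eq Φ).2 fun b => ?_
    filter_upwards [continuous_subtype_val.continuousAt.eventually (hk b).eventually_mk_eq]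
      with b' hb'
    exact hb' (k b') (σ b') (hk b') _ _ _ _ (Hat.isAt_pt (openBox_subset_box n b.2))
      (Hat.isAt_pt (openBox_subset_box n b'.2))
  have : PreconnectedSpace (openBox n) :=
    Subtype.preconnectedSpace (convex_openBox n).isPreconnected
  have e : ∀ {l' a' ρ' g'} (h' : IsRound T l' a' ρ' g') (hg : g'.Homotopic g) {p' : Hat D}
      (hp' : p' ∈ l'.int) (hpa' : p'.IsAt a'),
      ZerothHomotopy.mk (l'.at hp') = Φ ⟨a', h'.centre_mem_openBox⟩ := by
    intro l' a' ρ' g' h' hg p' hp' hpa'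
    have h1 := Hat.isAt_pt (D := D) (openBox_subset_box n h'.centre_mem_openBox)
    have h2 := hpa'.eq h1
    subst h2
    have h3 := (hk ⟨a', h'.centre_mem_openBox⟩).at_eq_of_homotopic h' hg
      (hk ⟨a', h'.centre_mem_openBox⟩).pt_mem_int hp' h1
    exact congrArg ZerothHomotopy.mk h3.symm
  rw [e h (.refl g) hp hpa, e h' hg hp' hpa']
  exact hΦ.apply_eq_of_preconnectedSpace _ _

end IsRound

/-- Brings the representatives that define `discClass` within reach of the comparison of round
balls. -/
lemma isRound_stdSection (T : DiscTrivialization D ξ X) (g : C(Sph (n + 1), X)) :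
    IsRound T (stdSection T g) (horiz 1) (1 / 2) g := by
  have h0 : ∀ u : Disc (n + 1), ((horiz 1 : Rn (n + 1)) + (1 / 2 : ℝ) • u.1) 0 = stdHeight u := by
    intro u
    simp [horiz, stdHeight]
    ring
  have h1 : ∀ (u : Disc (n + 1)) (j : Fin n),
      ((horiz 1 : Rn (n + 1)) + (1 / 2 : ℝ) • u.1) j.succ = (stdCube u).1 j := by
    intro u j
    simp [horiz, stdCube]
    ring
  refine ⟨by norm_num, fun u => ⟨?_, fun j => ?_⟩, fun u => ?_, fun u => ?_⟩
  · rw [h0]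
    exact stdHeight_pos u
  · rw [h1]
    have h : ‖u.1‖ ≤ 1 := mem_closedBall_zero_iff.1 u.2
    have := (coord_abs_le u.1 j.succ).trans h
    change |u.1 j.succ / 2| < 1
    rw [abs_div, abs_two]
    linarith
  · exact ⟨(h0 u).symm, stdCube u, rfl, fun j => (h1 u j).symm⟩
  · refine ⟨(T.homeo.symm (stdCube u.toDisc, g u)).2, ?_⟩
    change (T.homeo (T.homeo.symm (stdCube u.toDisc, g u))).2 = g u
    rw [Homeomorph.apply_symm_apply]

lemma isAt_stdSection_origin (T : DiscTrivialization D ξ X) (g : C(Sph (n + 1), X)) :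
    ((stdSection T g).ball (Disc.origin (n + 1))).IsAt (horiz 1) := by
  simpa [Disc.origin] using (isRound_stdSection T g).ball (Disc.origin (n + 1))

/-- `discClass` only provides some map homotopic to `g` whose standard section has its charge in ĉ;
by `IsRound.mk_eq` neither the choice of this map nor the position of the ball matters. -/
lemma IsRound.mk_mem_hatClass [T2Space M] {T : DiscTrivialization D ξ X}
    {c : Set (SingClass (n + 1) ((𝓡∂ (n + 1)).interior M) ξ)} {g : C(Sph (n + 1), X)}
    {l : LocalSection (n + 1) (hatInt D) (hatProj D ξ)} {a : Rn (n + 1)} {ρ : ℝ}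
    (h : IsRound T l a ρ g) {p : Hat D} (hp : p ∈ l.int) (hpa : p.IsAt a)
    (hg : SphClass.mk g ∈ discClass T c) : ZerothHomotopy.mk (l.at hp) ∈ hatClass D ξ c := by
  obtain ⟨g', hg', hc⟩ := hg
  have h1 : g'.Homotopic g := Quotient.exact hg'
  rw [h.mk_eq (isRound_stdSection T g') h1 hp (stdSection_origin_mem T g') hpa
    (isAt_stdSection_origin T g')]
  exact hc

/-- The charge of a configuration-section at a point of the cylinder near which it is given by a
rescaled configuration-map on the disc. -/
theorem mem_hatClass_of_agree [T2Space M] [Nonempty (HatE D ξ)] {T : DiscTrivialization D ξ X}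
    {c : Set (SingClass (n + 1) ((𝓡∂ (n + 1)).interior M) ξ)}
    {x : ConfMap (Disc (n + 1)) X} (hx : x.HasMonodromy (discClass T c))
    {s : ConfMap (Hat D) (HatE D ξ)} (hs : ∀ p, hatProj D ξ (s.sec p) = p.1)
    {C : Rn (n + 1)} {r : ℝ} (hr : 0 < r) {y : Disc (n + 1)} (hyx : y ∈ x.pts) (hy : ‖y.1‖ < 1)
    {p : Hat D} (hp : p.IsAt (C + r • y.1)) (hbox : C + r • y.1 ∈ openBox n)
    (hpts : ∀ (w : Disc (n + 1)) (q : Hat D), q.IsAt (C + r • w.1) → w ∈ x.pts → q ∈ s.pts)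
    (hsec : ∀ (w : Disc (n + 1)) (q : Hat D) (hw : w ∉ x.pts) (hq : q ∉ s.pts),
      q.IsAt (C + r • w.1) → (s.sec ⟨q, hq⟩).HasValue T (x.sec ⟨w, hw⟩))
    (l : LocalSection (n + 1) (hatInt D) (hatProj D ξ)) (hpl : p ∈ l.int)
    (huniq : ∀ q ∈ s.pts, q ∈ l.carrier → q = p)
    (hl : ∀ u : Sph (n + 1), ∃ h : l.ball u.toDisc ∉ s.pts,
      s.sec ⟨l.ball u.toDisc, h⟩ = l.sec u) :
    ZerothHomotopy.mk (l.at hpl) ∈ hatClass D ξ c := by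
  have hev : ∀ᶠ w in 𝓝 (C + r • y.1), Hat.pt D w ∈ l.int ∧ w ∈ openBox n := by
    refine (Hat.continuous_pt.continuousAt.eventually ?_).and ((isOpen_openBox n).mem_nhds hbox)
    rw [← hp.eq_pt]
    exact l.isOpen_int.mem_nhds hpl
  obtain ⟨δ, hδ, hδb⟩ := Metric.eventually_nhds_iff.1 hev
  -- The radius is chosen so that the copy of y + εD in the cylinder lies in the interior of `l` and
  -- in the open box.
  obtain ⟨ε, hε, hεδ, hεu⟩ : ∃ ε, 0 < ε ∧ r * ε < δ ∧ ‖y.1‖ + ε < 1 := by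
    have h0 : 0 < min (δ / r) (1 - ‖y.1‖) := lt_min (div_pos hδ hr) (by linarith)
    have h1 := min_le_left (δ / r) (1 - ‖y.1‖)
    have h2 := min_le_right (δ / r) (1 - ‖y.1‖)
    refine ⟨min (δ / r) (1 - ‖y.1‖) / 2, by linarith, ?_, by linarith⟩
    rw [mul_comm, ← lt_div_iff₀ hr]
    linarith
  let w : Disc (n + 1) → Disc (n + 1) := Disc.affine y.1 hε hεu
  have hw : ∀ v, C + r • (w v).1 = (C + r • y.1) + (r * ε) • v.1 := fun v => by
    change C + r • (y.1 + ε • v.1) = _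
    module
  have hwδ : ∀ v, Hat.pt D (C + r • (w v).1) ∈ l.int ∧ C + r • (w v).1 ∈ openBox n := fun v => by
    refine hδb ?_
    rw [hw, dist_eq_norm, add_sub_cancel_left, norm_smul, Real.norm_of_nonneg (by positivity)]
    have := mem_closedBall_zero_iff.1 v.2
    have : 0 < r * ε := by positivity
    nlinarith
  have hwAt : ∀ v, (Hat.pt D (C + r • (w v).1)).IsAt (C + r • (w v).1) := fun v =>
    Hat.isAt_pt (openBox_subset_box n (hwδ v).2)
  have hwy : ∀ v, w v ∈ x.pts → v.1 = 0 := fun v hv => by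
    have h1 := huniq _ (hpts _ _ (hwAt v) hv) (l.int_subset_carrier (hwδ v).1)
    have h2 := hwAt v
    rw [h1] at h2
    have h3 := hp.unique h2
    rw [hw] at h3
    have h4 : (r * ε) • v.1 = 0 := by simpa using h3
    exact (smul_eq_zero.1 h4).resolve_left (by positivity)
  have hns : ∀ v : Sph (n + 1), w v.toDisc ∉ x.pts := fun v hv => by
    have h1 : v.1 = 0 := hwy _ hv
    have h4 : ‖v.1‖ = 1 := mem_sphere_zero_iff_norm.1 v.2
    rw [h1, norm_zero] at h4
    exact zero_ne_one h4
  let g : C(Sph (n + 1), X) := ⟨fun v => x.sec ⟨_, hns v⟩, x.sec.continuous.comp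
    (Continuous.subtype_mk ((Disc.continuous_affine hε hεu).comp
      (Continuous.subtype_mk continuous_subtype_val _)) _)⟩
  -- The affine map v ↦ y + εv is an oriented embedding whose image contains no point of `x` except
  -- `y`, so the monodromy condition applies to it.
  have hg : SphClass.mk g ∈ discClass T c := by
    refine hx _ (isOrientedDiscEmbedding_affine hε hεu) y hyx ⟨0, by simp, by simp⟩ ?_ g
      fun v => ⟨_, hns v, rfl, rfl⟩
    rintro q hq ⟨v, hv, hvq⟩
    have h1 : w ⟨v, hv⟩ = q := Subtype.ext hvq
    have h2 : v = 0 := hwy ⟨v, hv⟩ (h1 ▸ hq)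
    exact Subtype.ext (by rw [← hvq, h2]; simp)
  obtain ⟨m, hm⟩ := exists_isRound T (a := C + r • y.1) (ρ := r * ε) (by positivity)
    (fun u => by rw [← hw]; exact (hwδ u).2) g
  have hmb : ∀ v, m.ball v = Hat.pt D (C + r • (w v).1) := fun v => by
    rw [hw]
    exact (hm.ball v).eq_pt
  have hpm : p ∈ m.int := hm.mem_int hp (by simpa using by positivity)
  have hns' : ∀ v : Sph (n + 1), m.ball v.toDisc ∉ s.pts := fun v h => by
    rw [hmb] at h
    have h1 := huniq _ h (l.int_subset_carrier (hwδ v.toDisc).1)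
    have h2 := hwAt v.toDisc
    rw [h1] at h2
    have h3 := hp.unique h2
    rw [hw] at h3
    have h4 : (r * ε) • v.1 = 0 := by simpa [Sph.toDisc] using h3
    have h5 : v.1 = 0 := (smul_eq_zero.1 h4).resolve_left (by positivity)
    have h6 : ‖v.1‖ = 1 := mem_sphere_zero_iff_norm.1 v.2
    rw [h5, norm_zero] at h6
    exact zero_ne_one h6
  -- The arbitrary ball `l` is compared with the round ball `m` through `s` itself, whose only
  -- configuration point in `l` is `p`.
  have hext : m.Extends l := by
    refine LocalSection.Extends.of_sec hs ?_ (fun q hq hql => ?_) hl fun v => ⟨hns' v, ?_⟩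
    · rintro _ ⟨v, rfl⟩
      rw [hmb]
      exact (hwδ v).1
    · rw [huniq q hq hql]
      exact hpm
    · refine (hsec (w v.toDisc) _ (hns v) _ ?_).ext (hm.sec v) ?_
      · rw [hmb]
        exact hwAt _
      · rw [hs, m.sec_proj]
  rw [← hext.at_eq hpm hpl]
  exact hm.mk_mem_hatClass hpm hp hg

end Round

/-! ## Shapes: the regions into which data are inserted -/

/-- A region of `ℝ^d` that contains the unit disc, with a retraction to the disc along which maps
on the disc are extended. Maps that are trivial on `A` are extended to maps that are trivial outside
the core of the region. -/
structure Shape (d : ℕ) (A : Set (Rn d)) where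
  reg : Set (Rn d)
  ret : Rn d → Disc d
  isClosed_reg : IsClosed reg
  continuous_ret : Continuous ret
  mem_reg : ∀ y : Disc d, y.1 ∈ reg
  ret_self : ∀ y : Disc d, ret y.1 = y
  isOpen_core : IsOpen {q | q ∈ reg ∧ (ret q).1 ∉ A}
  ret_eq : ∀ q ∈ reg, ‖(ret q).1‖ < 1 → (ret q).1 = q

/-- The part of the region where the extended maps may be non-trivial. -/
def Shape.core {d : ℕ} {A : Set (Rn d)} (S : Shape d A) : Set (Rn d) :=
  {q | q ∈ S.reg ∧ (S.ret q).1 ∉ A}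

/-- The inverse of `y ↦ C + r y`. -/
def nrm {d : ℕ} (C : Rn d) (r : ℝ) (q : Rn d) : Rn d := r⁻¹ • (q - C)

lemma nrm_apply {d : ℕ} {C : Rn d} {r : ℝ} (hr : 0 < r) (y : Rn d) : nrm C r (C + r • y) = y := by
  rw [nrm, add_sub_cancel_left, inv_smul_smul₀ hr.ne']

lemma apply_nrm {d : ℕ} {C : Rn d} {r : ℝ} (hr : 0 < r) (q : Rn d) : C + r • nrm C r q = q := by
  rw [nrm, smul_inv_smul₀ hr.ne', add_sub_cancel]

lemma nrm_nrm {d : ℕ} {C c : Rn d} {r s : ℝ} (hr : 0 < r) (q : Rn d) :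
    nrm (C + r • c) (r * s) q = nrm c s (nrm C r q) := by
  simp only [nrm, mul_inv, mul_smul, smul_sub, smul_add]
  rw [smul_comm r⁻¹ s⁻¹ (r • c), inv_smul_smul₀ hr.ne', smul_comm r⁻¹ s⁻¹ q,
    smul_comm r⁻¹ s⁻¹ C]
  abel

/-! ### Gluing maps along rescaled regions: values and joint continuity. -/

section Glue

variable {d : ℕ} {A : Set (Rn d)} {ι : Type} {X : Type*} [TopologicalSpace X]

/-- `q` lies in the region with centre `C` and scale `r`, and retracts to the point corresponding
to `y`. -/
def Shape.Rel (S : Shape d A) (C : Rn d) (r : ℝ) (y q : Rn d) : Prop :=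
  nrm C r q ∈ S.reg ∧ (S.ret (nrm C r q)).1 = y

lemma Shape.rel_apply (S : Shape d A) (C : Rn d) {r : ℝ} (hr : 0 < r) (y : Disc d) :
    S.Rel C r y.1 (C + r • y.1) := by
  rw [Shape.Rel, nrm_apply hr]
  exact ⟨S.mem_reg y, congrArg Subtype.val (S.ret_self y)⟩

/-- The retraction does not move points over the open disc. On configuration points, which are
interior, every shape thus acts by the affine map, and the glued configuration does not depend on
the shape. -/
lemma Shape.Rel.eq {S : Shape d A} {C : Rn d} {r : ℝ} {y q : Rn d} (h : S.Rel C r y q)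
    (hr : 0 < r) (hy : ‖y‖ < 1) : q = C + r • y := by
  obtain ⟨h1, rfl⟩ := h
  rw [S.ret_eq _ h1 hy, apply_nrm hr]

/-- Each region is disjoint from the cores of the other ones. -/
def Shape.Sep (S : Shape d A) (C : ι → Rn d) (r : ι → ℝ) : Prop :=
  ∀ i j q, nrm (C i) (r i) q ∈ S.reg → nrm (C j) (r j) q ∈ S.core → i = j

variable [Nonempty X] {x₀ : X} {c : Set (SphClass d X)}

open Classical in
/-- The value at `q` of the map that is glued from the maps `x i` and the constant `x₀`. -/
def glueVal (S : Shape d A) (C : ι → Rn d) (r : ι → ℝ) (x : ι → CMapDisc A x₀ c) (q : Rn d) : X :=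
  if h : ∃ i, nrm (C i) (r i) q ∈ S.core then
    (x h.choose).1.ev (S.ret (nrm (C h.choose) (r h.choose) q)) else x₀

lemma glueVal_of_notMem (S : Shape d A) {C : ι → Rn d} {r : ι → ℝ} (x : ι → CMapDisc A x₀ c)
    {q : Rn d} (h : ∀ i, nrm (C i) (r i) q ∉ S.core) : glueVal S C r x q = x₀ := by
  rw [glueVal, dif_neg]
  push Not
  exact h

/-- The formula is valid on the whole region and not only on its core: on the rest of the region the
retraction lands in `A`, where `x i` is x₀. -/
lemma glueVal_of_mem {S : Shape d A} {C : ι → Rn d} {r : ι → ℝ} (hS : S.Sep C r)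
    (x : ι → CMapDisc A x₀ c) {q : Rn d} {i : ι} (h : nrm (C i) (r i) q ∈ S.reg)
    (h' : S.ret (nrm (C i) (r i) q) ∉ (x i).1.pts) :
    glueVal S C r x q = (x i).1.ev (S.ret (nrm (C i) (r i) q)) := by
  by_cases hq : ∃ i, nrm (C i) (r i) q ∈ S.core
  · rw [glueVal, dif_pos hq, ← hS i _ q h hq.choose_spec]
  · push Not at hq
    rw [glueVal_of_notMem S x hq, ConfMap.ev_eq _ h']
    have h1 : (S.ret (nrm (C i) (r i) q)).1 ∈ A := by
      by_contra hA
      exact hq i ⟨h, hA⟩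
    exact ((x i).2.2.1 _ h' h1).symm

instance (d : ℕ) : CompactSpace (Disc d) := isCompact_iff_compactSpace.1 (isCompact_closedBall _ _)

/-- The closed cover consists of the regions and of the complement of all cores. On a region the
value is an evaluation composed with continuous maps; on the complement of the cores it is x₀. -/
theorem continuousAt_glueVal {Z : Type*} [TopologicalSpace Z] [Finite ι] {S : Shape d A}
    {C : Z → ι → Rn d} {r : Z → ι → ℝ} {x : Z → ι → CMapDisc A x₀ c} (hC : Continuous C)
    (hr : Continuous r) (hx : Continuous x) (hpos : ∀ z i, 0 < r z i) (hS : ∀ z, S.Sep (C z) (r z))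
    {z : Z} {q : Rn d}
    (hq : ∀ i, nrm (C z i) (r z i) q ∈ S.reg → S.ret (nrm (C z i) (r z i) q) ∉ (x z i).1.pts) :
    ContinuousAt (fun p : Z × Rn d => glueVal S (C p.1) (r p.1) (x p.1) p.2) (z, q) := by
  have hn : ∀ i, Continuous fun p : Z × Rn d => nrm (C p.1 i) (r p.1 i) p.2 := fun i => by
    have h1 : Continuous fun p : Z × Rn d => C p.1 i := (continuous_apply i).comp (hC.comp continuous_fst)
    have h2 : Continuous fun p : Z × Rn d => r p.1 i := (continuous_apply i).comp (hr.comp continuous_fst)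
    exact (h2.inv₀ fun p => (hpos _ _).ne').smul (continuous_snd.sub h1)
  have hxi : ∀ i, Continuous fun p : Z × Rn d => (x p.1 i).1 := fun i =>
    continuous_subtype_val.comp ((continuous_apply i).comp (hx.comp continuous_fst))
  refine continuousAt_of_closed_cover (κ := Option ι)
    (fun k => k.elim {p | ∀ i, nrm (C p.1 i) (r p.1 i) p.2 ∉ S.core}
      fun i => {p | nrm (C p.1 i) (r p.1 i) p.2 ∈ S.reg}) ?_ ?_ ?_
  · rintro (_ | i)
    · have : {p : Z × Rn d | ∀ i, nrm (C p.1 i) (r p.1 i) p.2 ∉ S.core} =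
          ⋂ i, ((fun p : Z × Rn d => nrm (C p.1 i) (r p.1 i) p.2) ⁻¹' S.core)ᶜ := by
        ext
        simp
      change IsClosed {p : Z × Rn d | ∀ i, nrm (C p.1 i) (r p.1 i) p.2 ∉ S.core}
      rw [this]
      exact isClosed_iInter fun i => (S.isOpen_core.preimage (hn i)).isClosed_compl
    · exact S.isClosed_reg.preimage (hn i)
  · intro p
    by_cases h : ∃ i, nrm (C p.1 i) (r p.1 i) p.2 ∈ S.core
    · obtain ⟨i, hi⟩ := h
      exact ⟨some i, hi.1⟩
    · push Not at h
      exact ⟨none, h⟩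
  · rintro (_ | i) hk
    · refine ContinuousWithinAt.congr (f := fun _ => x₀) continuousWithinAt_const
        (fun p hp => ?_) ?_
      · exact glueVal_of_notMem S _ hp
      · exact glueVal_of_notMem S _ hk
    · have h1 : Tendsto (fun p : Z × Rn d => ((x p.1 i).1, S.ret (nrm (C p.1 i) (r p.1 i) p.2)))
          (𝓝 (z, q)) (𝓝 ((x z i).1, S.ret (nrm (C z i) (r z i) q))) :=
        ((hxi i).prodMk (S.continuous_ret.comp (hn i))).tendsto (z, q)
      have h2 := (((hxi i).prodMk (S.continuous_ret.comp (hn i))).continuousAt (x := (z, q)))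
      have h3 : ContinuousAt (fun p : Z × Rn d =>
          (x p.1 i).1.ev (S.ret (nrm (C p.1 i) (r p.1 i) p.2))) (z, q) :=
        ((x z i).1.continuousAt_ev (hq i hk)).comp_of_eq h2 rfl
      -- The formula on a region is known only off the configuration, which is an open condition.
      have h4 : ∀ᶠ p in 𝓝 (z, q), S.ret (nrm (C p.1 i) (r p.1 i) p.2) ∉ (x p.1 i).1.pts := by
        have h5 : Tendsto (fun p : Z × Rn d =>
            ((x p.1 i).1.toConf, S.ret (nrm (C p.1 i) (r p.1 i) p.2)))
            (𝓝 (z, q)) (𝓝 ((x z i).1.toConf, S.ret (nrm (C z i) (r z i) q))) :=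
          ((ConfMap.continuous_toConf.comp (hxi i)).prodMk
            (S.continuous_ret.comp (hn i))).tendsto (z, q)
        exact h5.eventually (Conf.eventually_notMem _ (hq i hk))
      refine h3.continuousWithinAt.congr_of_eventuallyEq ?_ ?_
      · filter_upwards [self_mem_nhdsWithin, mem_nhdsWithin_of_mem_nhds h4] with p hp hp'
        exact glueVal_of_mem (hS _) _ hp hp'
      · exact glueVal_of_mem (hS _) _ hk (hq i hk)

/-! ## Insertion of configurations into little discs -/

/-- It is enough that one of the two points is interior: if i ≠ j, the centres would be at distance
less than r i + r j. -/
lemma disc_eq_of_apply_eq {C : ι → Rn d} {r : ι → ℝ} (hpos : ∀ i, 0 < r i)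
    (hsep : ∀ i j, i ≠ j → r i + r j ≤ dist (C i) (C j)) {i j : ι} {y y' : Disc d}
    (hy : ‖y.1‖ < 1) (h : C i + r i • y.1 = C j + r j • y'.1) :
    (⟨i, y⟩ : ι × Disc d) = ⟨j, y'⟩ := by
  by_cases hij : i = j
  · subst hij
    have h1 : y = y' :=
      Subtype.ext (smul_right_injective _ (hpos i).ne' (add_right_injective _ h))
    rw [h1]
  · exfalso
    have h1 := hsep i j hij
    have h2 : C i - C j = r j • y'.1 - r i • y.1 := by
      rw [sub_eq_sub_iff_add_eq_add, h, add_comm]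
    rw [dist_eq_norm, h2] at h1
    have h3 := norm_sub_le (r j • y'.1) (r i • y.1)
    rw [norm_smul, norm_smul, Real.norm_of_nonneg (hpos i).le, Real.norm_of_nonneg (hpos j).le]
      at h3
    have h4 := mem_closedBall_zero_iff.1 y'.2
    nlinarith [hpos i, hpos j]

end Glue

namespace LittleDiscs

variable {d : ℕ} {ι : Type}

lemma continuous_centre : Continuous (centre : LittleDiscs d ι → ι → Rn d) :=
  continuous_fst.comp (continuous_induced_dom (f := fun θ : LittleDiscs d ι => (θ.centre, θ.radius)))

lemma continuous_radius : Continuous (radius : LittleDiscs d ι → ι → ℝ) :=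
  continuous_snd.comp (continuous_induced_dom (f := fun θ : LittleDiscs d ι => (θ.centre, θ.radius)))

lemma norm_apply_le (θ : LittleDiscs d ι) (i : ι) (y : Rn d) :
    ‖θ.centre i + θ.radius i • y‖ ≤ 1 - θ.radius i + θ.radius i * ‖y‖ := by
  have h1 := norm_add_le (θ.centre i) (θ.radius i • y)
  rw [norm_smul, Real.norm_of_nonneg (θ.radius_pos i).le] at h1
  linarith [θ.inside i]

/-- The point of the disc that corresponds to the point `y` of the `i`-th little disc. -/
def apply (θ : LittleDiscs d ι) (i : ι) (y : Disc d) : Disc d :=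
  ⟨θ.centre i + θ.radius i • y.1, mem_closedBall_zero_iff.2 ((θ.norm_apply_le i y.1).trans (by
    have := mem_closedBall_zero_iff.1 y.2
    have := θ.radius_pos i
    nlinarith))⟩

lemma norm_apply_lt (θ : LittleDiscs d ι) (i : ι) {y : Disc d} (hy : ‖y.1‖ < 1) :
    ‖(θ.apply i y).1‖ < 1 := by
  have := θ.norm_apply_le i y.1
  have := θ.radius_pos i
  change ‖θ.centre i + θ.radius i • y.1‖ < 1
  nlinarith

/-- The union of the configurations `z i`, inserted into the little discs. -/
def conf [Finite ι] (θ : LittleDiscs d ι) (z : ι → CDisc d) : CDisc d :=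
  ⟨{ pts := ⋃ i, θ.apply i '' (z i).1.pts
     finite := finite_iUnion fun i => (z i).1.finite.image _ }, by
    intro p hp
    obtain ⟨i, y, hy, rfl⟩ := mem_iUnion.1 hp
    exact θ.norm_apply_lt i ((z i).2 y hy)⟩

lemma mem_conf [Finite ι] (θ : LittleDiscs d ι) (z : ι → CDisc d) (p : Disc d) :
    p ∈ (θ.conf z).1.pts ↔ ∃ i, ∃ y ∈ (z i).1.pts, p.1 = θ.centre i + θ.radius i • y.1 := by
  change p ∈ ⋃ i, θ.apply i '' (z i).1.pts ↔ _
  rw [mem_iUnion]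
  refine exists_congr fun i => exists_congr fun y => and_congr_right fun _ => ?_
  constructor
  · rintro rfl
    rfl
  · exact fun h => Subtype.ext h.symm

lemma continuous_conf [Finite ι] {Z : Type*} [TopologicalSpace Z] {θ : Z → LittleDiscs d ι}
    {z : Z → ι → CDisc d} (hθ : Continuous θ) (hz : Continuous z) :
    Continuous fun ζ => (θ ζ).conf (z ζ) := by
  refine Continuous.subtype_mk (continuous_iff_continuousAt.2 fun a => ?_) _
  refine Conf.continuousAt_iUnion_image (fun ζ i => (z ζ i).1) (fun ζ i => (θ ζ).apply i) _ a
    (fun i => ?_) (fun i p _ => ?_) (fun i j p q hp _ h => ?_) fun ζ p => ?_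
  · exact (continuous_subtype_val.comp ((continuous_apply i).comp hz)).continuousAt
  · refine Continuous.continuousAt (Continuous.subtype_mk ?_ _)
    have h1 : Continuous fun q : Z × Disc d => (θ q.1).centre i :=
      (continuous_apply i).comp (continuous_centre.comp (hθ.comp continuous_fst))
    have h2 : Continuous fun q : Z × Disc d => (θ q.1).radius i :=
      (continuous_apply i).comp (continuous_radius.comp (hθ.comp continuous_fst))
    exact h1.add (h2.smul (continuous_subtype_val.comp continuous_snd))
  · exact disc_eq_of_apply_eq (θ a).radius_pos (θ a).sep ((z a i).2 p hp)
      (congrArg Subtype.val h)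
  · exact mem_iUnion

end LittleDiscs

/-! ## Insertion of configuration-maps into little discs -/

section GlueMap

variable {d : ℕ} {A : Set (Rn d)} {ι : Type} {X : Type*} [TopologicalSpace X]

/-- The little discs `θ` are compatible with the shape `S`. -/
structure Shape.Fits (S : Shape d A) (θ : LittleDiscs d ι) : Prop where
  sep : S.Sep θ.centre θ.radius
  notMem : ∀ i q, nrm (θ.centre i) (θ.radius i) q ∈ S.core → q ∉ A
  comp_mem : ∀ i q, nrm (θ.centre i) (θ.radius i) q ∈ S.reg ↔
    q ∈ S.reg ∧ nrm (θ.centre i) (θ.radius i) (S.ret q).1 ∈ S.reg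
  comp_ret : ∀ i q, nrm (θ.centre i) (θ.radius i) q ∈ S.reg →
    S.ret (nrm (θ.centre i) (θ.radius i) (S.ret q).1) = S.ret (nrm (θ.centre i) (θ.radius i) q)

variable {x₀ : X} {c : Set (SphClass d X)}

lemma Shape.ret_notMem_of_notMem (S : Shape d A) {C : ι → Rn d} {r : ι → ℝ} (hr : ∀ i, 0 < r i)
    (x : ι → CMapDisc A x₀ c) {q : Rn d}
    (hq : ¬ ∃ i, ∃ y ∈ (x i).1.pts, q = C i + r i • y.1) (i : ι)
    (h : nrm (C i) (r i) q ∈ S.reg) : S.ret (nrm (C i) (r i) q) ∉ (x i).1.pts := fun hy =>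
  hq ⟨i, _, hy, Shape.Rel.eq ⟨h, rfl⟩ (hr i) ((x i).2.1 _ hy)⟩

/-! ### Gluing relations on the disc: uniqueness and composition. -/

lemma IsGluedMap.congr {R R' : ι → Rn d → Rn d → Prop} {x : ι → ConfMap (Disc d) X}
    {s : ConfMap (Disc d) X} (h : IsGluedMap R x₀ x s)
    (hR : ∀ i (y : Disc d) q, R i y.1 q ↔ R' i y.1 q) : IsGluedMap R' x₀ x s where
  conf p := by
    rw [h.conf p]
    simp only [hR]
  sec_in p i y hy := h.sec_in p i y ((hR _ _ _).2 hy)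
  sec_out p hp := h.sec_out p fun i y hy => hp i y ((hR _ _ _).1 hy)

/-- A point outside the configuration either is related to a point of some disc or is related to
none, and its value is prescribed in both cases. The algebra laws follow by checking that both sides
are glued from the same data. -/
lemma IsGluedMap.unique {R : ι → Rn d → Rn d → Prop} {x : ι → ConfMap (Disc d) X}
    {s s' : ConfMap (Disc d) X} (h : IsGluedMap R x₀ x s) (h' : IsGluedMap R x₀ x s') : s = s' := by
  refine ConfMap.ext_of_sec (fun p => (h.conf p).trans (h'.conf p).symm) fun p hp hp' => ?_
  by_cases hR : ∃ i, ∃ y : Disc d, R i y.1 p.1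
  · obtain ⟨i, y, hy⟩ := hR
    have hyx : y ∉ (x i).pts := fun hyx => hp ((h.conf p).2 ⟨i, y, hyx, hy⟩)
    rw [h.sec_in ⟨p, hp⟩ i ⟨y, hyx⟩ hy, h'.sec_in ⟨p, hp'⟩ i ⟨y, hyx⟩ hy]
  · push Not at hR
    rw [h.sec_out ⟨p, hp⟩ hR, h'.sec_out ⟨p, hp'⟩ hR]

/-- Gluing in two steps is gluing along the composite relations. -/
lemma IsGluedMap.comp {κ : ι → Type} {R : ι → Rn d → Rn d → Prop}
    {R' : ∀ i, κ i → Rn d → Rn d → Prop} {R'' : (Σ i, κ i) → Rn d → Rn d → Prop}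
    {x : (Σ i, κ i) → ConfMap (Disc d) X} {s : ι → ConfMap (Disc d) X} {s' : ConfMap (Disc d) X}
    (h : ∀ i, IsGluedMap (R' i) x₀ (fun j => x ⟨i, j⟩) (s i)) (h' : IsGluedMap R x₀ s s')
    (hR : ∀ i j (y : Disc d) q, R'' ⟨i, j⟩ y.1 q ↔ ∃ y' : Disc d, R' i j y.1 y'.1 ∧ R i y'.1 q) :
    IsGluedMap R'' x₀ x s' where
  conf p := by
    rw [h'.conf p]
    constructor
    · rintro ⟨i, y', hy', hp⟩
      obtain ⟨j, y, hy, hyy⟩ := ((h i).conf y').1 hy'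
      exact ⟨⟨i, j⟩, y, hy, (hR i j y p.1).2 ⟨y', hyy, hp⟩⟩
    · rintro ⟨⟨i, j⟩, y, hy, hp⟩
      obtain ⟨y', hyy, hp⟩ := (hR i j y p.1).1 hp
      exact ⟨i, y', ((h i).conf y').2 ⟨j, y, hy, hyy⟩, hp⟩
  sec_in := by
    rintro p ⟨i, j⟩ y hy
    obtain ⟨y', hyy, hp⟩ := (hR i j y.1 p.1).1 hy
    -- The intermediate point is not in the intermediate configuration, since otherwise `p` would
    -- belong to the final one.
    have hy' : y' ∉ (s i).pts := fun hn => p.2 ((h'.conf p.1).2 ⟨i, y', hn, hp⟩)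
    rw [h'.sec_in p i ⟨y', hy'⟩ hp]
    exact (h i).sec_in ⟨y', hy'⟩ j y hyy
  sec_out := by
    intro p hp
    by_cases hex : ∃ i, ∃ y' : Disc d, R i y'.1 p.1
    · obtain ⟨i, y', hyp⟩ := hex
      have hy' : y' ∉ (s i).pts := fun hn => p.2 ((h'.conf p.1).2 ⟨i, y', hn, hyp⟩)
      rw [h'.sec_in p i ⟨y', hy'⟩ hyp]
      exact (h i).sec_out ⟨y', hy'⟩ fun j y hyy => hp ⟨i, j⟩ y ((hR i j y p.1).2 ⟨y', hyy, hyp⟩)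
    · push Not at hex
      exact h'.sec_out p hex

/-- The intermediate point has to be the retraction to the outer disc; `comp_mem` and `comp_ret`
state that retracting to the outer disc first does not affect the retraction to an inner one. -/
lemma Shape.rel_comp (S : Shape d A) {κ : Type} {φ : LittleDiscs d κ} (hφ : S.Fits φ) (C : Rn d) {r : ℝ}
    (hr : 0 < r) (j : κ) (y q : Rn d) :
    S.Rel (C + r • φ.centre j) (r * φ.radius j) y q ↔
      ∃ y' : Disc d, S.Rel (φ.centre j) (φ.radius j) y y'.1 ∧ S.Rel C r y'.1 q := by
  simp only [Shape.Rel, nrm_nrm hr]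
  set u := nrm C r q
  constructor
  · rintro ⟨h1, rfl⟩
    have h2 := (hφ.comp_mem j u).1 h1
    exact ⟨S.ret u, ⟨h2.2, congrArg Subtype.val (hφ.comp_ret j u h1)⟩, h2.1, rfl⟩
  · rintro ⟨y', ⟨h1, rfl⟩, h2, h3⟩
    obtain rfl : S.ret u = y' := Subtype.ext h3
    have h4 := (hφ.comp_mem j u).2 ⟨h2, h1⟩
    exact ⟨h4, congrArg Subtype.val (hφ.comp_ret j u h4).symm⟩

variable [Nonempty X]

/-- The configuration-map that is glued from the configuration-maps `x i`. -/
def Shape.glueMap [Finite ι] (S : Shape d A) (θ : LittleDiscs d ι) (hθ : S.Fits θ)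
    (x : ι → CMapDisc A x₀ c) : ConfMap (Disc d) X :=
  ConfMap.ofFun (θ.conf fun i => (x i).forget).1
    (fun p => glueVal S θ.centre θ.radius x p.1) fun p hp => by
      have h := continuousAt_glueVal (Z := Unit) (S := S) (C := fun _ => θ.centre)
        (r := fun _ => θ.radius) (x := fun _ => x) continuous_const continuous_const
        continuous_const (fun _ => θ.radius_pos) (fun _ => hθ.sep) (z := ()) (q := p.1)
        (S.ret_notMem_of_notMem θ.radius_pos x fun h => hp ((θ.mem_conf _ p).2 h))
      exact h.comp_of_eq (f := fun p : Disc d => ((), p.1))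
        (continuous_const.prodMk continuous_subtype_val).continuousAt rfl

variable [Finite ι] (S : Shape d A) {θ : LittleDiscs d ι} (hθ : S.Fits θ) (x : ι → CMapDisc A x₀ c)

lemma Shape.mem_glueMap_pts (p : Disc d) : p ∈ (S.glueMap θ hθ x).pts ↔
    ∃ i, ∃ y ∈ (x i).1.pts, p.1 = θ.centre i + θ.radius i • y.1 := θ.mem_conf _ p

lemma Shape.glueMap_sec (p : {p // p ∉ (S.glueMap θ hθ x).pts}) :
    (S.glueMap θ hθ x).sec p = glueVal S θ.centre θ.radius x p.1.1 := rfl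

lemma Shape.isGluedMap_glueMap : IsGluedMap (fun i => S.Rel (θ.centre i) (θ.radius i)) x₀
    (fun i => (x i).1) (S.glueMap θ hθ x) where
  conf p := by
    refine (θ.mem_conf _ p).trans (exists_congr fun i => exists_congr fun y =>
      and_congr_right fun hy => ?_)
    constructor
    · intro h
      rw [h]
      exact S.rel_apply _ (θ.radius_pos i) y
    · exact fun h => h.eq (θ.radius_pos i) ((x i).2.1 y hy)
  sec_in := by
    rintro ⟨p, hp⟩ i ⟨y, hy⟩ ⟨h1, h2⟩
    have h3 : S.ret (nrm (θ.centre i) (θ.radius i) p.1) = y := Subtype.ext h2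
    subst h3
    rw [S.glueMap_sec hθ x, glueVal_of_mem hθ.sep x h1 hy, ConfMap.ev_eq _ hy]
  sec_out := by
    rintro ⟨p, hp⟩ h
    exact glueVal_of_notMem S x fun i hi => h i (S.ret (nrm (θ.centre i) (θ.radius i) p.1))
      ⟨hi.1, rfl⟩

/-- The action of little discs on configuration-mapping spaces of discs. -/
def Shape.actA (θ : LittleDiscs d ι) (hθ : S.Fits θ) (x : ι → CMapDisc A x₀ c) :
    CMapDisc A x₀ c :=
  -- The boundary condition holds because no core meets `A`.
  ⟨S.glueMap θ hθ x, (θ.conf fun i => (x i).forget).2, fun p hp hA =>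
    glueVal_of_notMem S x fun i hi => hθ.notMem i p.1 hi hA, by
    intro e he p hp hpe huniq g hg
    obtain ⟨i, y, hy, hpy⟩ := (S.mem_glueMap_pts hθ x p).1 hp
    -- A point of the union comes from some disc `i`, on which the glued map is a rescaled copy of
    -- `x i`.
    refine mem_sphClass_of_agree (x i).2.2.2 (θ.radius_pos i) hy ((x i).2.1 y hy) hpy
      (fun w q hq hw => ?_) (fun w q hw hq hqw => ?_) he hpe huniq g hg
    · exact (S.mem_glueMap_pts hθ x q).2 ⟨i, w, hw, hq⟩
    · refine (S.isGluedMap_glueMap hθ x).sec_in ⟨q, hq⟩ i ⟨w, hw⟩ ?_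
      change S.Rel _ _ w.1 q.1
      rw [hqw]
      exact S.rel_apply _ (θ.radius_pos i) w⟩

lemma Shape.actA_eq_of_isGluedMap {t : CMapDisc A x₀ c}
    (h : IsGluedMap (fun i => S.Rel (θ.centre i) (θ.radius i)) x₀ (fun i => (x i).1) t.1) :
    S.actA θ hθ x = t :=
  Subtype.ext ((S.isGluedMap_glueMap hθ x).unique h)

lemma Shape.continuous_actA {Z : Type*} [TopologicalSpace Z] {θ : Z → LittleDiscs d ι}
    (hθ : ∀ ζ, S.Fits (θ ζ)) {x : Z → ι → CMapDisc A x₀ c} (hθc : Continuous θ)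
    (hx : Continuous x) : Continuous fun ζ => S.actA (θ ζ) (hθ ζ) (x ζ) := by
  refine Continuous.subtype_mk (ConfMap.continuous_ofFun _ ?_ fun ζ p hp => ?_) _
  · refine continuous_subtype_val.comp (LittleDiscs.continuous_conf hθc
      (z := fun ζ i => (x ζ i).forget) (continuous_pi fun i => ?_))
    exact Continuous.subtype_mk (ConfMap.continuous_toConf.comp
      (continuous_subtype_val.comp ((continuous_apply i).comp hx))) _
  · have h := continuousAt_glueVal (S := S) (LittleDiscs.continuous_centre.comp hθc)
      (LittleDiscs.continuous_radius.comp hθc) hx (fun ζ => (θ ζ).radius_pos)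
      (fun ζ => (hθ ζ).sep) (z := ζ) (q := p.1)
      (S.ret_notMem_of_notMem (θ ζ).radius_pos (x ζ) fun h => hp (((θ ζ).mem_conf _ p).2 h))
    exact h.comp_of_eq (f := fun q : Z × Disc d => (q.1, q.2.1))
      (continuous_fst.prodMk (continuous_subtype_val.comp continuous_snd)).continuousAt rfl

end GlueMap

/-! ## Insertion of configurations into the cylinder -/

lemma horiz_add {n : ℕ} [NeZero n] (a b : ℝ) : (horiz (a + b) : Rn n) = horiz a + horiz b := by
  ext j
  by_cases h : j = 0 <;> simp [horiz, h]

lemma horiz_apply_zero {n : ℕ} [NeZero n] (a : ℝ) : (horiz a : Rn n) 0 = a := by simp [horiz]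

lemma horiz_apply_succ {n : ℕ} (a : ℝ) (j : Fin n) : (horiz a : Rn (n + 1)) j.succ = 0 := by
  simp [horiz]

lemma continuous_horiz {n : ℕ} [NeZero n] : Continuous (horiz : ℝ → Rn n) :=
  (PiLp.continuous_toLp 2 _).comp (continuous_single (A := fun _ : Fin n => ℝ) 0)

namespace LinearDiscs

variable {n : ℕ} {ι : Type}

lemma continuous_centre [NeZero n] : Continuous (centre : LinearDiscs n ι → ι → Rn n) :=
  continuous_fst.comp (continuous_induced_dom
    (f := fun θ : LinearDiscs n ι => (θ.centre, θ.radius, θ.width)))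

lemma continuous_radius [NeZero n] : Continuous (radius : LinearDiscs n ι → ι → ℝ) :=
  (continuous_fst.comp continuous_snd).comp (continuous_induced_dom
    (f := fun θ : LinearDiscs n ι => (θ.centre, θ.radius, θ.width)))

lemma continuous_width [NeZero n] : Continuous (width : LinearDiscs n ι → ℝ) :=
  (continuous_snd.comp continuous_snd).comp (continuous_induced_dom
    (f := fun θ : LinearDiscs n ι => (θ.centre, θ.radius, θ.width)))

lemma apply_mem_openBox (θ : LinearDiscs (n + 1) ι) (i : ι) {y : Rn (n + 1)} (hy : ‖y‖ < 1) :
    θ.centre i + θ.radius i • y ∈ openBox n := by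
  have hr := θ.radius_pos i
  have hj : ∀ j, |y j| < 1 := fun j => (coord_abs_le y j).trans_lt hy
  constructor
  · have h1 := abs_lt.1 (hj 0)
    have h2 := θ.inside_zero i
    simp only [PiLp.add_apply, PiLp.smul_apply, smul_eq_mul]
    nlinarith
  · intro j
    have h1 := abs_lt.1 (hj j.succ)
    have h2 := θ.inside i j.succ (Fin.succ_ne_zero j)
    simp only [PiLp.add_apply, PiLp.smul_apply, smul_eq_mul]
    rw [abs_lt]
    constructor <;> nlinarith

lemma apply_zero_lt (θ : LinearDiscs (n + 1) ι) (i : ι) {y : Rn (n + 1)} (hy : ‖y‖ < 1) :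
    (θ.centre i + θ.radius i • y) 0 < θ.width := by
  have hr := θ.radius_pos i
  have h1 := abs_lt.1 ((coord_abs_le y 0).trans_lt hy)
  have h2 := θ.inside_zero i
  simp only [PiLp.add_apply, PiLp.smul_apply, smul_eq_mul]
  nlinarith

lemma horiz_add_mem_openBox {t : ℝ} (ht : 0 ≤ t) {q : Rn (n + 1)} (hq : q ∈ openBox n) :
    horiz t + q ∈ openBox n := by
  constructor
  · have := hq.1
    rw [PiLp.add_apply, horiz_apply_zero]
    linarith
  · intro j
    rw [PiLp.add_apply, horiz_apply_succ, zero_add]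
    exact hq.2 j

variable {M : Type*} [TopologicalSpace M] [ChartedSpace (EuclideanHalfSpace (n + 1)) M]
  {D : BoundaryDisc n M}

/-- The union of the configurations `z i`, inserted into `[t,∞) × D`. -/
def newConf [Finite ι] (θ : LinearDiscs (n + 1) ι) (z : ι → CDisc (n + 1)) (t : ℝ) :
    Conf (Hat D) where
  pts := ⋃ i, (fun y : Disc (n + 1) =>
    Hat.pt D (horiz t + (θ.centre i + θ.radius i • y.1))) '' (z i).1.pts
  finite := finite_iUnion fun i => (z i).1.finite.image _

lemma mem_newConf [Finite ι] (θ : LinearDiscs (n + 1) ι) (z : ι → CDisc (n + 1)) {t : ℝ}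
    (ht : 0 ≤ t) (p : Hat D) : p ∈ (θ.newConf z t : Conf (Hat D)).pts ↔
      ∃ i, ∃ y ∈ (z i).1.pts, p.IsAt (horiz t + (θ.centre i + θ.radius i • y.1)) := by
  change p ∈ ⋃ i, _ '' _ ↔ _
  rw [mem_iUnion]
  refine exists_congr fun i => exists_congr fun y => and_congr_right fun hy => ?_
  constructor
  · rintro rfl
    exact Hat.isAt_pt (openBox_subset_box n
      (horiz_add_mem_openBox ht (θ.apply_mem_openBox i ((z i).2 y hy))))
  · exact fun h => h.eq_pt.symm

/-- The union of `w` with the configurations `z i`, inserted into the cylinder. -/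
def conf [Finite ι] (θ : LinearDiscs (n + 1) ι) (z : ι → CDisc (n + 1)) (w : CDot D) : CDot D :=
  ⟨({ pts := w.1.1.pts ∪ (θ.newConf z w.1.2 : Conf (Hat D)).pts
      finite := w.1.1.finite.union (θ.newConf z w.1.2 : Conf (Hat D)).finite },
    w.1.2 + θ.width), add_pos_of_pos_of_nonneg w.2.1 θ.width_nonneg, by
    have hw := θ.width_nonneg
    rintro p (hp | hp)
    · obtain ⟨h1, h2⟩ := w.2.2 hp
      exact ⟨h1, h2.trans_le (by linarith)⟩
    · obtain ⟨i, y, hy, h⟩ := (θ.mem_newConf z w.2.1.le p).1 hp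
      refine ⟨mem_hatInt_of_isAt h (horiz_add_mem_openBox w.2.1.le
        (θ.apply_mem_openBox i ((z i).2 y hy))), ?_⟩
      have := θ.apply_zero_lt i ((z i).2 y hy)
      rw [h.1, PiLp.add_apply, horiz_apply_zero]
      linarith⟩

lemma mem_conf [Finite ι] (θ : LinearDiscs (n + 1) ι) (z : ι → CDisc (n + 1)) (w : CDot D)
    (p : Hat D) : p ∈ (θ.conf z w).1.1.pts ↔ p ∈ w.1.1.pts ∨
      ∃ i, ∃ y ∈ (z i).1.pts, p.IsAt (horiz w.1.2 + (θ.centre i + θ.radius i • y.1)) :=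
  or_congr_right (θ.mem_newConf z w.2.1.le p)

lemma continuous_conf [T2Space M] [Finite ι] {Z : Type*} [TopologicalSpace Z]
    {θ : Z → LinearDiscs (n + 1) ι} {z : Z → ι → CDisc (n + 1)} {w : Z → CDot D}
    (hθ : Continuous θ) (hz : Continuous z) (hw : Continuous w) :
    Continuous fun ζ => (θ ζ).conf (z ζ) (w ζ) := by
  have ht : Continuous fun ζ => (w ζ).1.2 :=
    continuous_snd.comp (continuous_subtype_val.comp hw)
  have hnew : Continuous fun ζ => ((θ ζ).newConf (z ζ) (w ζ).1.2 : Conf (Hat D)) := by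
    refine continuous_iff_continuousAt.2 fun a => ?_
    refine Conf.continuousAt_iUnion_image (fun ζ i => (z ζ i).1)
      (fun ζ i y => Hat.pt D (horiz (w ζ).1.2 + ((θ ζ).centre i + (θ ζ).radius i • y.1))) _ a
      (fun i => ?_) (fun i p _ => ?_) (fun i j p q hp hq h => ?_) fun ζ p => ?_
    · exact (continuous_subtype_val.comp ((continuous_apply i).comp hz)).continuousAt
    · refine Continuous.continuousAt (Hat.continuous_pt.comp ?_)
      have h1 : Continuous fun q : Z × Disc (n + 1) => (θ q.1).centre i :=
        (continuous_apply i).comp (continuous_centre.comp (hθ.comp continuous_fst))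
      have h2 : Continuous fun q : Z × Disc (n + 1) => (θ q.1).radius i :=
        (continuous_apply i).comp (continuous_radius.comp (hθ.comp continuous_fst))
      exact (continuous_horiz.comp (ht.comp continuous_fst)).add
        (h1.add (h2.smul (continuous_subtype_val.comp continuous_snd)))
    · have hb : ∀ i, ∀ y ∈ (z a i).1.pts,
          horiz (w a).1.2 + ((θ a).centre i + (θ a).radius i • y.1) ∈ box n := fun i y hy =>
        openBox_subset_box n (horiz_add_mem_openBox (w a).2.1.le
          ((θ a).apply_mem_openBox i ((z a i).2 y hy)))
      exact disc_eq_of_apply_eq (θ a).radius_pos (θ a).sep ((z a i).2 p hp)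
        (add_right_injective _ (injOn_pt (hb i p hp) (hb j q hq) h))
    · exact mem_iUnion
  refine Continuous.subtype_mk (Continuous.prodMk ?_
    (ht.add (continuous_width.comp hθ))) _
  refine continuous_iff_continuousAt.2 fun a => ?_
  -- Old points have height less than t, new ones height greater than t.
  have hdisj : ∀ p q : Hat D, p ∈ (w a).1.1.pts →
      q ∈ ((θ a).newConf (z a) (w a).1.2 : Conf (Hat D)).pts → p ≠ q := by
    rintro p q hp hq rfl
    have h1 := ((w a).2.2 hp).2
    obtain ⟨i, y, hy, h⟩ := ((θ a).mem_newConf (z a) (w a).2.1.le p).1 hq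
    have h2 := ((θ a).apply_mem_openBox i ((z a i).2 y hy)).1
    rw [h.1, PiLp.add_apply, horiz_apply_zero] at h1
    linarith
  -- The union of old and new points is an instance of the general statement, with two summands and
  -- identity maps.
  refine Conf.continuousAt_iUnion_image (ι := Bool)
    (fun ζ b => if b then (w ζ).1.1 else (θ ζ).newConf (z ζ) (w ζ).1.2) (fun _ _ p => p) _ a
    ?_ (fun _ _ _ => continuous_snd.continuousAt) ?_ fun ζ p => ?_
  · rintro (_ | _)
    · simpa using hnew.continuousAt
    · exact (continuous_fst.comp (continuous_subtype_val.comp hw)).continuousAt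
  · rintro (_ | _) (_ | _) p q hp hq h
    · exact Prod.ext rfl h
    · exact absurd h.symm (hdisj q p (by simpa using hq) (by simpa using hp))
    · exact absurd h (hdisj p q (by simpa using hp) (by simpa using hq))
    · exact Prod.ext rfl h
  · simp [or_comm]

end LinearDiscs

/-! ## Insertion of configuration-maps into the cylinder -/

section GlueSec

variable {n : ℕ} {ι : Type} {M E X : Type*} [TopologicalSpace M]
  [ChartedSpace (EuclideanHalfSpace (n + 1)) M] [TopologicalSpace E] [TopologicalSpace X]
  {D : BoundaryDisc n M} {ξ : E → M} {T : DiscTrivialization D ξ X} {x₀ : X}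
  {A : Set (Rn (n + 1))}

/-- The little discs `θ` in a cuboid are compatible with the shape `S`. -/
structure Shape.FitsLinear (S : Shape (n + 1) A) (θ : LinearDiscs (n + 1) ι) : Prop where
  sep : S.Sep θ.centre θ.radius
  reg_range : ∀ i q, nrm (θ.centre i) (θ.radius i) q ∈ S.reg → 0 ≤ q 0 ∧ q 0 ≤ θ.width
  core_range : ∀ i q, nrm (θ.centre i) (θ.radius i) q ∈ S.core → 0 < q 0 ∧ q 0 < θ.width

/-! ### Gluing relations on the cylinder: uniqueness and composition. -/

lemma IsGluedSec.congr {R R' : ι → Rn (n + 1) → Rn (n + 1) → Prop} {t : ℝ}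
    {x : ι → ConfMap (Disc (n + 1)) X} {s s' : ConfMap (Hat D) (HatE D ξ)}
    (h : IsGluedSec T R x₀ t x s s')
    (hR : ∀ i (y : Disc (n + 1)) q, R i y.1 q ↔ R' i y.1 q) : IsGluedSec T R' x₀ t x s s' where
  conf p := by
    rw [h.conf p]
    simp only [hR]
  sec_old := h.sec_old
  sec_in p i y q hy := h.sec_in p i y q ((hR _ _ _).2 hy)
  sec_out p hp hp' := h.sec_out p hp fun i y q hy => hp' i y q ((hR _ _ _).1 hy)

lemma IsGluedSec.notMem {R : ι → Rn (n + 1) → Rn (n + 1) → Prop} {t : ℝ}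
    {x : ι → ConfMap (Disc (n + 1)) X} {s s' : ConfMap (Hat D) (HatE D ξ)}
    (h : IsGluedSec T R x₀ t x s s') {p : Hat D} (hp : p ∉ s'.pts) : p ∉ s.pts := fun hs =>
  hp ((h.conf p).2 (Or.inl hs))

/-- The gluing conditions on the cylinder fix only X-coordinates, so the projection conditions are
needed to determine the points of Ê. -/
lemma IsGluedSec.unique {R : ι → Rn (n + 1) → Rn (n + 1) → Prop} {t : ℝ}
    {x : ι → ConfMap (Disc (n + 1)) X} {s s' s'' : ConfMap (Hat D) (HatE D ξ)}
    (h : IsGluedSec T R x₀ t x s s') (h' : IsGluedSec T R x₀ t x s s'')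
    (hs' : ∀ p, hatProj D ξ (s'.sec p) = p.1) (hs'' : ∀ p, hatProj D ξ (s''.sec p) = p.1) :
    s' = s'' := by
  refine ConfMap.ext_of_sec (fun p => (h.conf p).trans (h'.conf p).symm) fun p hp hp' => ?_
  have hproj : hatProj D ξ (s'.sec ⟨p, hp⟩) = hatProj D ξ (s''.sec ⟨p, hp'⟩) := by rw [hs', hs'']
  rcases le_total p.height t with ht | ht
  · rw [h.sec_old p hp (h.notMem hp) ht, h'.sec_old p hp' (h.notMem hp) ht]
  · by_cases hR : ∃ i, ∃ (y : Disc (n + 1)) (q : Rn (n + 1)), R i y.1 q ∧ p.IsAt (horiz t + q)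
    · obtain ⟨i, y, q, hy, hq⟩ := hR
      have hyx : y ∉ (x i).pts := fun hyx =>
        hp ((h.conf p).2 (Or.inr ⟨i, y, hyx, q, hy, hq⟩))
      exact (h.sec_in ⟨p, hp⟩ i ⟨y, hyx⟩ q hy hq).ext (h'.sec_in ⟨p, hp'⟩ i ⟨y, hyx⟩ q hy hq) hproj
    · push Not at hR
      exact (h.sec_out ⟨p, hp⟩ ht hR).ext (h'.sec_out ⟨p, hp'⟩ ht hR) hproj

/-- Gluing in two steps is gluing along the composite relations. -/
lemma IsGluedSec.comp {κ : ι → Type} {μ : Type} {R : ι → Rn (n + 1) → Rn (n + 1) → Prop}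
    {R' : ∀ i, κ i → Rn (n + 1) → Rn (n + 1) → Prop} {Q : μ → Rn (n + 1) → Rn (n + 1) → Prop}
    {R'' : (Σ i, κ i) ⊕ μ → Rn (n + 1) → Rn (n + 1) → Prop} {t a : ℝ}
    {x : (Σ i, κ i) ⊕ μ → ConfMap (Disc (n + 1)) X} {y : ι → ConfMap (Disc (n + 1)) X}
    {s s' s'' : ConfMap (Hat D) (HatE D ξ)} (ha : 0 ≤ a)
    (h : ∀ i, IsGluedMap (R' i) x₀ (fun j => x (Sum.inl ⟨i, j⟩)) (y i))
    (hs : IsGluedSec T Q x₀ t (fun k => x (Sum.inr k)) s s')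
    (hs' : IsGluedSec T R x₀ (t + a) y s' s'')
    (hQ : ∀ k (y : Disc (n + 1)) q, Q k y.1 q → q 0 ≤ a)
    (hR : ∀ i j (y : Disc (n + 1)) q, R'' (Sum.inl ⟨i, j⟩) y.1 q ↔
      ∃ y' : Disc (n + 1), R' i j y.1 y'.1 ∧ R i y'.1 (q - horiz a))
    (hR' : ∀ k (y : Disc (n + 1)) q, R'' (Sum.inr k) y.1 q ↔ Q k y.1 q) :
    IsGluedSec T R'' x₀ t x s s'' := by
  -- The outer operation is placed from height t + a upwards, the composite operation from height t;
  -- the shift by `horiz a` translates between them.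
  have hadd : ∀ q : Rn (n + 1), horiz (t + a) + (q - horiz a) = horiz t + q := fun q => by
    rw [horiz_add]
    abel
  have hadd' : ∀ q : Rn (n + 1), horiz (t + a) + q = horiz t + (q + horiz a) := fun q => by
    rw [horiz_add]
    abel
  constructor
  · intro p
    rw [hs'.conf p, hs.conf p]
    constructor
    · rintro ((hp | ⟨k, z, hz, q, hq, hpq⟩) | ⟨i, y', hy', q, hq, hpq⟩)
      · exact Or.inl hp
      · exact Or.inr ⟨Sum.inr k, z, hz, q, (hR' k z q).2 hq, hpq⟩
      · obtain ⟨j, z, hz, hzy⟩ := ((h i).conf y').1 hy'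
        refine Or.inr ⟨Sum.inl ⟨i, j⟩, z, hz, q + horiz a, (hR i j z _).2 ⟨y', hzy, ?_⟩, ?_⟩
        · rwa [add_sub_cancel_right]
        · rwa [← hadd']
    · rintro (hp | ⟨⟨i, j⟩ | k, z, hz, q, hq, hpq⟩)
      · exact Or.inl (Or.inl hp)
      · obtain ⟨y', hzy, hy'⟩ := (hR i j z q).1 hq
        exact Or.inr ⟨i, y', ((h i).conf y').2 ⟨j, z, hz, hzy⟩, q - horiz a, hy', by rwa [hadd]⟩
      · exact Or.inl (Or.inr ⟨k, z, hz, q, (hR' k z q).1 hq, hpq⟩)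
  · intro p hp'' hp ht
    have hp' := hs'.notMem hp''
    rw [hs'.sec_old p hp'' hp' (by linarith), hs.sec_old p hp' hp ht]
  · rintro ⟨p, hp⟩ (⟨i, j⟩ | k) z q hq hpq
    · obtain ⟨y', hzy, hy'⟩ := (hR i j z.1 q).1 hq
      rw [← hadd] at hpq
      have hy'' : y' ∉ (y i).pts := fun hn =>
        hp ((hs'.conf p).2 (Or.inr ⟨i, y', hn, _, hy', hpq⟩))
      rw [← (h i).sec_in ⟨y', hy''⟩ j z hzy]
      exact hs'.sec_in ⟨p, hp⟩ i ⟨y', hy''⟩ _ hy' hpq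
    · have hq' := (hR' k z.1 q).1 hq
      have h1 : p.height = t + q 0 := by
        have := hpq.1
        rwa [PiLp.add_apply, horiz_apply_zero] at this
      -- Regions of the operation inserted first stay within its width, so they lie in the part that
      -- the second gluing leaves unchanged.
      have h2 := hQ k z.1 q hq'
      rw [hs'.sec_old p hp (hs'.notMem hp) (by linarith)]
      exact hs.sec_in ⟨p, hs'.notMem hp⟩ k z q hq' hpq
  · rintro ⟨p, hp⟩ ht hout
    rcases le_total p.height (t + a) with hta | hta
    · rw [hs'.sec_old p hp (hs'.notMem hp) hta]
      exact hs.sec_out ⟨p, hs'.notMem hp⟩ ht fun k z q hq => hout (Sum.inr k) z q ((hR' k z q).2 hq)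
    · by_cases hex : ∃ i, ∃ (y' : Disc (n + 1)) (q : Rn (n + 1)),
          R i y'.1 q ∧ p.IsAt (horiz (t + a) + q)
      · obtain ⟨i, y', q, hy', hpq⟩ := hex
        have hy'' : y' ∉ (y i).pts := fun hn =>
          hp ((hs'.conf p).2 (Or.inr ⟨i, y', hn, _, hy', hpq⟩))
        have h1 := hs'.sec_in ⟨p, hp⟩ i ⟨y', hy''⟩ q hy' hpq
        rwa [(h i).sec_out ⟨y', hy''⟩ fun j z hzy => hout (Sum.inl ⟨i, j⟩) z (q + horiz a)
          ((hR i j z _).2 ⟨y', hzy, by rwa [add_sub_cancel_right]⟩) (by rwa [← hadd'])] at h1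
      · push Not at hex
        exact hs'.sec_out ⟨p, hp⟩ hta hex

lemma isAt_horiz_add_iff {p : Hat D} (hp : p.1.1 ∈ D.carrier) {t : ℝ} {q : Rn (n + 1)} :
    p.IsAt (horiz t + q) ↔ p.coord - horiz t = q := by
  rw [sub_eq_iff_eq_add']
  constructor
  · exact fun h => (Hat.isAt_coord hp).unique h
  · intro h
    rw [← h]
    exact Hat.isAt_coord hp

lemma coord_sub_horiz_zero (p : Hat D) (t : ℝ) : (p.coord - horiz t : Rn (n + 1)) 0 = p.height - t := by
  rw [PiLp.sub_apply, horiz_apply_zero, Hat.coord_zero]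

lemma continuous_cMapDisc_forget {d : ℕ} {A : Set (Rn d)} {c : Set (SphClass d X)} :
    Continuous (CMapDisc.forget : CMapDisc A x₀ c → CDisc d) :=
  Continuous.subtype_mk (ConfMap.continuous_toConf.comp continuous_subtype_val) _

lemma continuous_cGammaDot_forget
    {c : Set (SingClass (n + 1) ((𝓡∂ (n + 1)).interior M) ξ)} :
    Continuous (CGammaDot.forget : CGammaDot T x₀ c → CDot D) :=
  Continuous.subtype_mk ((ConfMap.continuous_toConf.comp
    (continuous_fst.comp continuous_subtype_val)).prodMk
      (continuous_snd.comp continuous_subtype_val)) _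

variable [Nonempty X] [Nonempty (HatE D ξ)] {cD : Set (SphClass (n + 1) X)}
  {c : Set (SingClass (n + 1) ((𝓡∂ (n + 1)).interior M) ξ)}

open Classical in
/-- The value at `p` of the section that is glued from `s`, the maps `x i` and the constant. -/
def glueHatVal (T : DiscTrivialization D ξ X) (S : Shape (n + 1) A) (C : ι → Rn (n + 1))
    (r : ι → ℝ) (t : ℝ) (x : ι → CMapDisc A x₀ cD) (s : ConfMap (Hat D) (HatE D ξ)) (p : Hat D) :
    HatE D ξ :=
  if p.height ≤ t then s.ev p else HatE.over T p (glueVal S C r x (p.coord - horiz t))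

lemma glueHatVal_of_le {S : Shape (n + 1) A} {C : ι → Rn (n + 1)} {r : ι → ℝ} {t : ℝ}
    (x : ι → CMapDisc A x₀ cD) (s : ConfMap (Hat D) (HatE D ξ)) {p : Hat D} (hp : p.height ≤ t) :
    glueHatVal T S C r t x s p = s.ev p := if_pos hp

/-- At height exactly t both formulas have to agree: the old section is x₀ there by definition of
the space, and cores only start strictly beyond t. -/
lemma glueHatVal_of_ge {S : Shape (n + 1) A} {θ : LinearDiscs (n + 1) ι} (hθ : S.FitsLinear θ)
    (x : ι → CMapDisc A x₀ cD) (w : CGammaDot T x₀ c) {p : Hat D} (hp : w.1.2 ≤ p.height) :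
    glueHatVal T S θ.centre θ.radius w.1.2 x w.1.1 p =
      HatE.over T p (glueVal S θ.centre θ.radius x (p.coord - horiz w.1.2)) := by
  rcases hp.eq_or_lt with h | h
  · have h1 : p ∉ w.1.1.pts := fun h1 => (w.2.2.1 h1).2.not_ge hp
    rw [glueHatVal_of_le _ _ h.ge, ConfMap.ev_eq _ h1, glueVal_of_notMem S x]
    · rw [(w.2.2.2.2.2 ⟨p, h1⟩ hp).eq_over, w.2.2.2.1]
    · intro i hi
      have h2 := (hθ.core_range i _ hi).1
      rw [coord_sub_horiz_zero] at h2
      linarith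
  · exact if_neg h.not_ge

variable [T2Space M]

/-- The cover consists of the closed sets where the height is at most, or at least, the parameter t,
which varies with `w`; on each of them one formula holds. -/
lemma continuousAt_glueHatVal {Z : Type*} [TopologicalSpace Z] [Finite ι] {S : Shape (n + 1) A}
    {θ : Z → LinearDiscs (n + 1) ι} (hθ : ∀ ζ, S.FitsLinear (θ ζ)) {x : Z → ι → CMapDisc A x₀ cD}
    {w : Z → CGammaDot T x₀ c} (hθc : Continuous θ) (hx : Continuous x) (hw : Continuous w)
    {ζ : Z} {p : Hat D}
    (hp : p ∉ ((θ ζ).conf (fun i => (x ζ i).forget) (w ζ).forget).1.1.pts) :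
    ContinuousAt (fun q : Z × Hat D => glueHatVal T S (θ q.1).centre (θ q.1).radius (w q.1).1.2
      (x q.1) (w q.1).1.1 q.2) (ζ, p) := by
  have : LocallyCompactSpace (Hat D) := Hat.locallyCompactSpace
  have hh : Continuous fun q : Z × Hat D => q.2.height :=
    Hat.continuous_height.comp continuous_snd
  have ht : Continuous fun q : Z × Hat D => (w q.1).1.2 :=
    continuous_snd.comp (continuous_subtype_val.comp (hw.comp continuous_fst))
  rw [LinearDiscs.mem_conf] at hp
  refine continuousAt_of_closed_cover (κ := Bool)
    (fun b => if b then {q | q.2.height ≤ (w q.1).1.2} else {q | (w q.1).1.2 ≤ q.2.height})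
    ?_ (fun q => ?_) ?_
  · rintro (_ | _)
    · simpa using isClosed_le ht hh
    · simpa using isClosed_le hh ht
  · rcases le_total q.2.height (w q.1).1.2 with h | h
    · exact ⟨true, by simpa using h⟩
    · exact ⟨false, by simpa using h⟩
  · rintro (_ | _) hk
    · have hk' : (w ζ).1.2 ≤ p.height := by simpa using hk
      -- The condition t > 0 enters here: the coordinates on the cylinder are continuous only at
      -- positive height.
      have hpos : 0 < p.height := (w ζ).2.1.trans_le hk'
      have hcar := Hat.mem_carrier_of_height_pos hpos
      have h1 := continuousAt_glueVal (S := S) (LinearDiscs.continuous_centre.comp hθc)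
        (LinearDiscs.continuous_radius.comp hθc) hx (fun ζ => (θ ζ).radius_pos)
        (fun ζ => (hθ ζ).sep) (z := ζ) (q := p.coord - horiz (w ζ).1.2)
        (S.ret_notMem_of_notMem (θ ζ).radius_pos (x ζ) ?_)
      · have h2 : ContinuousAt (fun q : Z × Hat D => q.2.coord - horiz (w q.1).1.2) (ζ, p) := by
          refine ContinuousAt.sub ?_ (continuous_horiz.comp ht).continuousAt
          exact ContinuousAt.comp (f := Prod.snd) (g := Hat.coord) (Hat.continuousAt_coord hpos)
            continuous_snd.continuousAt
        have h3 := h1.comp_of_eq (f := fun q : Z × Hat D => (q.1, q.2.coord - horiz (w q.1).1.2))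
          (continuous_fst.continuousAt.prodMk h2) rfl
        have h4 := ContinuousAt.hatE_over T (f := fun q : Z × Hat D => q.2) (a := (ζ, p))
          continuous_snd.continuousAt h3 hpos
        refine h4.continuousWithinAt.congr (fun q hq => ?_) ?_
        · exact glueHatVal_of_ge (hθ _) _ _ (by simpa using hq)
        · exact glueHatVal_of_ge (hθ _) _ _ hk'
      · rintro ⟨i, y, hy, h⟩
        exact hp (Or.inr ⟨i, y, hy, (isAt_horiz_add_iff hcar).2 h⟩)
    · have hk' : p.height ≤ (w ζ).1.2 := by simpa using hk
      have h1 : p ∉ (w ζ).1.1.pts := fun h => hp (Or.inl h)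
      have h2 : Continuous fun q : Z × Hat D => ((w q.1).1.1, q.2) :=
        (continuous_fst.comp (continuous_subtype_val.comp (hw.comp continuous_fst))).prodMk
          continuous_snd
      have h3 := ((w ζ).1.1.continuousAt_ev h1).comp_of_eq (h2.continuousAt (x := (ζ, p))) rfl
      refine h3.continuousWithinAt.congr (fun q hq => ?_) ?_
      · exact glueHatVal_of_le _ _ (by simpa using hq)
      · exact glueHatVal_of_le _ _ hk'

/-- The section that is glued from `w`, the maps `x i` and the constant section. -/
def Shape.glueSec [Finite ι] (S : Shape (n + 1) A) (θ : LinearDiscs (n + 1) ι)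
    (hθ : S.FitsLinear θ) (x : ι → CMapDisc A x₀ cD) (w : CGammaDot T x₀ c) :
    ConfMap (Hat D) (HatE D ξ) :=
  ConfMap.ofFun (θ.conf (fun i => (x i).forget) w.forget).1.1
    (glueHatVal T S θ.centre θ.radius w.1.2 x w.1.1) fun _ hp =>
      (continuousAt_glueHatVal (Z := Unit) (θ := fun _ => θ) (fun _ => hθ) (x := fun _ => x)
        (w := fun _ => w) continuous_const continuous_const continuous_const (ζ := ()) hp).comp_of_eq
        (f := fun p : Hat D => ((), p)) (continuous_const.prodMk continuous_id).continuousAt rfl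

variable [Finite ι] (S : Shape (n + 1) A) {θ : LinearDiscs (n + 1) ι} (hθ : S.FitsLinear θ)
  (x : ι → CMapDisc A x₀ cD) (w : CGammaDot T x₀ c)

lemma Shape.mem_glueSec_pts (p : Hat D) : p ∈ (S.glueSec θ hθ x w).pts ↔ p ∈ w.1.1.pts ∨
    ∃ i, ∃ y ∈ (x i).1.pts, p.IsAt (horiz w.1.2 + (θ.centre i + θ.radius i • y.1)) :=
  θ.mem_conf _ _ p

lemma Shape.glueSec_of_le {p : Hat D} (h : p.height ≤ w.1.2) (hp : p ∉ (S.glueSec θ hθ x w).pts)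
    (hp' : p ∉ w.1.1.pts) : (S.glueSec θ hθ x w).sec ⟨p, hp⟩ = w.1.1.sec ⟨p, hp'⟩ :=
  (glueHatVal_of_le x w.1.1 h).trans (w.1.1.ev_eq hp')

lemma Shape.glueSec_of_ge {p : Hat D} (h : w.1.2 ≤ p.height) (hp : p ∉ (S.glueSec θ hθ x w).pts) :
    (S.glueSec θ hθ x w).sec ⟨p, hp⟩ =
      HatE.over T p (glueVal S θ.centre θ.radius x (p.coord - horiz w.1.2)) :=
  glueHatVal_of_ge hθ x w h

lemma Shape.hatProj_glueSec (p : {p // p ∉ (S.glueSec θ hθ x w).pts}) :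
    hatProj D ξ ((S.glueSec θ hθ x w).sec p) = p.1 := by
  obtain ⟨p, hp⟩ := p
  rcases le_total p.height w.1.2 with h | h
  · rw [S.glueSec_of_le hθ x w h hp fun h => hp ((S.mem_glueSec_pts hθ x w p).2 (Or.inl h))]
    exact w.2.2.2.1 _
  · rw [S.glueSec_of_ge hθ x w h]
    exact HatE.hatProj_over T (Hat.mem_carrier_of_height_pos (w.2.1.trans_le h)) _

lemma Shape.isGluedSec_glueSec : IsGluedSec T (fun i => S.Rel (θ.centre i) (θ.radius i)) x₀ w.1.2
    (fun i => (x i).1) w.1.1 (S.glueSec θ hθ x w) where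
  conf p := by
    refine (S.mem_glueSec_pts hθ x w p).trans (or_congr_right (exists_congr fun i =>
      exists_congr fun y => and_congr_right fun hy => ?_))
    constructor
    · exact fun h => ⟨_, S.rel_apply _ (θ.radius_pos i) y, h⟩
    · rintro ⟨q, hq, h⟩
      rwa [hq.eq (θ.radius_pos i) ((x i).2.1 y hy)] at h
  sec_old p h' h ht := S.glueSec_of_le hθ x w ht h' h
  sec_in := by
    rintro ⟨p, hp⟩ i ⟨y, hy⟩ q ⟨h1, h2⟩ hpq
    have h3 : S.ret (nrm (θ.centre i) (θ.radius i) q) = y := Subtype.ext h2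
    subst h3
    have hpq' := (isAt_horiz_add_iff hpq.mem_carrier).1 hpq
    have hle : w.1.2 ≤ p.height := by
      have h4 := coord_sub_horiz_zero p w.1.2
      rw [hpq'] at h4
      have h5 := (hθ.reg_range i q h1).1
      linarith
    rw [S.glueSec_of_ge hθ x w hle hp, hpq', glueVal_of_mem hθ.sep x h1 hy, ConfMap.ev_eq _ hy]
    exact HatE.hasValue_over T _ _
  sec_out := by
    rintro ⟨p, hp⟩ ht h
    have hcar := Hat.mem_carrier_of_height_pos (w.2.1.trans_le ht)
    rw [S.glueSec_of_ge hθ x w ht hp, glueVal_of_notMem S x]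
    · exact HatE.hasValue_over T _ _
    · intro i hi
      exact h i _ _ ⟨hi.1, rfl⟩ ((isAt_horiz_add_iff hcar).2 rfl)

/-- The action of little discs in a cuboid on configuration-section spaces. -/
def Shape.actM (θ : LinearDiscs (n + 1) ι) (hθ : S.FitsLinear θ)
    (x : ι → CMapDisc A x₀ (discClass T c)) (w : CGammaDot T x₀ c) : CGammaDot T x₀ c :=
  ⟨(S.glueSec θ hθ x w, w.1.2 + θ.width),
    (θ.conf (fun i => (x i).forget) w.forget).2.1, (θ.conf (fun i => (x i).forget) w.forget).2.2,
    S.hatProj_glueSec hθ x w, by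
    intro p hp l hpl huniq hl
    -- At an old point the section is unchanged on the open set of height less than t, so its charge
    -- is the old one. At a new point the section is a rescaled copy of `x i`, whose monodromy
    -- determines the charge.
    rcases (S.mem_glueSec_pts hθ x w p).1 hp with hp' | ⟨i, y, hy, hpy⟩
    · refine ConfMap.HasCharges.of_agree w.2.2.2.1 (S.hatProj_glueSec hθ x w) w.2.2.2.2.1 hp'
        ((isOpen_lt Hat.continuous_height continuous_const).mem_nhds (w.2.2.1 hp').2)
        (fun q _ hq => (S.mem_glueSec_pts hθ x w q).2 (Or.inl hq)) (fun q hq h h' => ?_)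
        l hpl huniq hl
      have hq' : q.height < w.1.2 := hq
      exact (S.glueSec_of_le hθ x w hq'.le h' h).symm
    · have hbox := LinearDiscs.horiz_add_mem_openBox w.2.1.le
        (θ.apply_mem_openBox i ((x i).2.1 y hy))
      rw [← add_assoc] at hbox hpy
      refine mem_hatClass_of_agree (x i).2.2.2 (S.hatProj_glueSec hθ x w) (θ.radius_pos i) hy
        ((x i).2.1 y hy) hpy hbox (fun v q hq hv => ?_) (fun v q hv hq hqv => ?_) l hpl huniq hl
      · rw [add_assoc] at hq
        exact (S.mem_glueSec_pts hθ x w q).2 (Or.inr ⟨i, v, hv, hq⟩)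
      · rw [add_assoc] at hqv
        exact (S.isGluedSec_glueSec hθ x w).sec_in ⟨q, hq⟩ i ⟨v, hv⟩ _
          (S.rel_apply _ (θ.radius_pos i) v) hqv,
    by
    rintro ⟨p, hp⟩ ht
    have hw := θ.width_nonneg
    have ht' : w.1.2 + θ.width ≤ p.height := ht
    rw [S.glueSec_of_ge hθ x w (by linarith) hp, glueVal_of_notMem S x]
    · exact HatE.hasValue_over T _ _
    -- No core reaches the height t + width, so the section is x₀ from there on.
    · intro i hi
      have h2 := (hθ.core_range i _ hi).2
      rw [coord_sub_horiz_zero] at h2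
      linarith⟩

lemma Shape.actM_eq_of_isGluedSec (x : ι → CMapDisc A x₀ (discClass T c)) {w' : CGammaDot T x₀ c}
    (h : IsGluedSec T (fun i => S.Rel (θ.centre i) (θ.radius i)) x₀ w.1.2 (fun i => (x i).1)
      w.1.1 w'.1.1) (h' : w'.1.2 = w.1.2 + θ.width) : S.actM θ hθ x w = w' :=
  Subtype.ext (Prod.ext ((S.isGluedSec_glueSec hθ x w).unique h (S.hatProj_glueSec hθ x w)
    w'.2.2.2.1) h'.symm)

lemma Shape.continuous_actM {Z : Type*} [TopologicalSpace Z] {θ : Z → LinearDiscs (n + 1) ι}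
    (hθ : ∀ ζ, S.FitsLinear (θ ζ)) {x : Z → ι → CMapDisc A x₀ (discClass T c)}
    {w : Z → CGammaDot T x₀ c} (hθc : Continuous θ) (hx : Continuous x) (hw : Continuous w) :
    Continuous fun ζ => S.actM (θ ζ) (hθ ζ) (x ζ) (w ζ) := by
  have hconf := LinearDiscs.continuous_conf hθc
    (z := fun ζ i => (x ζ i).forget) (continuous_pi fun i =>
      continuous_cMapDisc_forget.comp ((continuous_apply i).comp hx))
    (continuous_cGammaDot_forget.comp hw)
  refine Continuous.subtype_mk (Continuous.prodMk (ConfMap.continuous_ofFun _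
    (continuous_fst.comp (continuous_subtype_val.comp hconf)) fun ζ p hp => ?_)
    (continuous_snd.comp (continuous_subtype_val.comp hconf))) _
  exact continuousAt_glueHatVal hθ hθc hx hw hp

end GlueSec

lemma norm_nrm_le_one {d : ℕ} {C q : Rn d} {r : ℝ} (hr : 0 < r) : ‖nrm C r q‖ ≤ 1 ↔ ‖q - C‖ ≤ r := by
  rw [nrm, norm_smul, norm_inv, Real.norm_of_nonneg hr.le, inv_mul_le_iff₀ hr, mul_one]

lemma norm_nrm_lt_one {d : ℕ} {C q : Rn d} {r : ℝ} (hr : 0 < r) : ‖nrm C r q‖ < 1 ↔ ‖q - C‖ < r := by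
  rw [nrm, norm_smul, norm_inv, Real.norm_of_nonneg hr.le, inv_mul_lt_iff₀ hr, mul_one]

lemma eq_of_norm_nrm {d : ℕ} {ι : Type} {C : ι → Rn d} {r : ι → ℝ} (hpos : ∀ i, 0 < r i)
    (hsep : ∀ i j, i ≠ j → r i + r j ≤ dist (C i) (C j)) {i j : ι} {q : Rn d}
    (hi : ‖nrm (C i) (r i) q‖ ≤ 1) (hj : ‖nrm (C j) (r j) q‖ < 1) : i = j := by
  by_contra hij
  have h1 := hsep i j hij
  rw [norm_nrm_le_one (hpos i)] at hi
  rw [norm_nrm_lt_one (hpos j)] at hj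
  have h2 := dist_triangle_left (C i) (C j) q
  rw [dist_eq_norm q, dist_eq_norm q] at h2
  linarith

/-! ## The disc as a shape -/

/-- The retraction onto the unit disc. -/
def discRet {d : ℕ} (q : Rn d) : Disc d :=
  ⟨(max 1 ‖q‖)⁻¹ • q, by
    rw [mem_closedBall_zero_iff, norm_smul, norm_inv,
      Real.norm_of_nonneg (zero_le_one.trans (le_max_left _ _)),
      inv_mul_le_iff₀ (zero_lt_one.trans_le (le_max_left _ _)), mul_one]
    exact le_max_right _ _⟩

lemma continuous_discRet {d : ℕ} : Continuous (discRet : Rn d → Disc d) := by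
  have h : Continuous fun q : Rn d => max 1 ‖q‖ := continuous_const.max continuous_norm
  exact Continuous.subtype_mk ((h.inv₀ fun q =>
    (zero_lt_one.trans_le (le_max_left _ _)).ne').smul continuous_id) _

lemma discRet_of_le {d : ℕ} {q : Rn d} (h : ‖q‖ ≤ 1) : (discRet q).1 = q := by
  simp [discRet, max_eq_left h]

/-- The unit disc. -/
def discShape (d : ℕ) : Shape d (bdry d) where
  reg := Metric.closedBall 0 1
  ret := discRet
  isClosed_reg := Metric.isClosed_closedBall
  continuous_ret := continuous_discRet
  mem_reg y := y.2
  ret_self y := Subtype.ext (discRet_of_le (mem_closedBall_zero_iff.1 y.2))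
  isOpen_core := by
    have : {q : Rn d | q ∈ Metric.closedBall 0 1 ∧ (discRet q).1 ∉ bdry d} = Metric.ball 0 1 := by
      ext q
      rw [mem_ball_zero_iff]
      constructor
      · rintro ⟨h1, h2⟩
        rw [mem_closedBall_zero_iff] at h1
        rw [discRet_of_le h1] at h2
        exact lt_of_le_of_ne h1 h2
      · intro h
        refine ⟨mem_closedBall_zero_iff.2 h.le, ?_⟩
        rw [discRet_of_le h.le]
        exact h.ne
    rw [this]
    exact Metric.isOpen_ball
  ret_eq q hq _ := discRet_of_le (mem_closedBall_zero_iff.1 hq)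

lemma mem_discShape_reg {d : ℕ} {q : Rn d} : q ∈ (discShape d).reg ↔ ‖q‖ ≤ 1 :=
  mem_closedBall_zero_iff

lemma discShape_ret {d : ℕ} {q : Rn d} (h : ‖q‖ ≤ 1) : ((discShape d).ret q).1 = q :=
  discRet_of_le h

lemma mem_discShape_core {d : ℕ} {q : Rn d} : q ∈ (discShape d).core ↔ ‖q‖ < 1 := by
  change q ∈ (discShape d).reg ∧ ((discShape d).ret q).1 ∉ bdry d ↔ _
  rw [mem_discShape_reg]
  constructor
  · rintro ⟨h1, h2⟩
    rw [discShape_ret h1] at h2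
    exact lt_of_le_of_ne h1 h2
  · intro h
    refine ⟨h.le, ?_⟩
    rw [discShape_ret h.le]
    exact h.ne

lemma inDisc_iff_rel {d : ℕ} {C : Rn d} {r : ℝ} (hr : 0 < r) (y : Disc d) (q : Rn d) :
    InDisc C r y.1 q ↔ (discShape d).Rel C r y.1 q := by
  constructor
  · rintro rfl
    exact Shape.rel_apply _ C hr y
  · rintro ⟨h1, h2⟩
    rw [discShape_ret (mem_discShape_reg.1 h1)] at h2
    rw [InDisc, ← h2, apply_nrm hr]

lemma discShape_sep {d : ℕ} {ι : Type} {C : ι → Rn d} {r : ι → ℝ} (hpos : ∀ i, 0 < r i)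
    (hsep : ∀ i j, i ≠ j → r i + r j ≤ dist (C i) (C j)) : (discShape d).Sep C r :=
  fun _ _ _ hi hj => eq_of_norm_nrm hpos hsep (mem_discShape_reg.1 hi) (mem_discShape_core.1 hj)

/-- The little discs lie in the unit disc, on which the outer retraction is the identity; their open
discs do not reach the sphere. -/
lemma discShape_fits {d : ℕ} {ι : Type} (θ : LittleDiscs d ι) : (discShape d).Fits θ := by
  have hreg : ∀ i q, nrm (θ.centre i) (θ.radius i) q ∈ (discShape d).reg → ‖q‖ ≤ 1 := by
    intro i q hq
    have h1 := θ.norm_apply_le i (nrm (θ.centre i) (θ.radius i) q)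
    rw [apply_nrm (θ.radius_pos i)] at h1
    have h2 := mem_discShape_reg.1 hq
    have := θ.radius_pos i
    nlinarith
  refine ⟨discShape_sep θ.radius_pos θ.sep, fun i q hq hA => ?_, fun i q => ?_, fun i q hq => ?_⟩
  · have h1 := θ.norm_apply_le i (nrm (θ.centre i) (θ.radius i) q)
    rw [apply_nrm (θ.radius_pos i)] at h1
    have h2 := mem_discShape_core.1 hq
    have h3 : ‖q‖ = 1 := hA
    have := θ.radius_pos i
    nlinarith
  · constructor
    · intro hq
      rw [discShape_ret (hreg i q hq)]
      exact ⟨mem_discShape_reg.2 (hreg i q hq), hq⟩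
    · rintro ⟨h1, h2⟩
      rwa [discShape_ret (mem_discShape_reg.1 h1)] at h2
  · rw [discShape_ret (hreg i q hq)]

lemma discShape_fitsLinear {n : ℕ} {ι : Type} (θ : LinearDiscs (n + 1) ι) :
    (discShape (n + 1)).FitsLinear θ := by
  refine ⟨discShape_sep θ.radius_pos θ.sep, fun i q hq => ?_, fun i q hq => ?_⟩
  · have h1 := (coord_abs_le _ 0).trans ((norm_nrm_le_one (θ.radius_pos i)).1
      (mem_discShape_reg.1 hq))
    rw [PiLp.sub_apply] at h1
    have h2 := abs_le.1 h1
    have h3 := θ.inside_zero i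
    constructor <;> linarith
  · have h1 := (coord_abs_le _ 0).trans_lt ((norm_nrm_lt_one (θ.radius_pos i)).1
      (mem_discShape_core.1 hq))
    rw [PiLp.sub_apply] at h1
    have h2 := abs_lt.1 h1
    have h3 := θ.inside_zero i
    constructor <;> linarith

/-! ## The column over the disc as a shape -/

/-- The vertical projection `ℝ^{n+1} → ℝ^n`. -/
def vproj {n : ℕ} (q : Rn (n + 1)) : Rn n := WithLp.toLp 2 fun j => q j.castSucc

section Vproj

variable {n : ℕ}

@[simp] lemma vproj_apply (q : Rn (n + 1)) (j : Fin n) : vproj q j = q j.castSucc := rfl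

lemma continuous_vproj : Continuous (vproj : Rn (n + 1) → Rn n) :=
  (PiLp.continuous_toLp 2 _).comp (by fun_prop)

lemma ext_vproj {p q : Rn (n + 1)} (h : vproj p = vproj q)
    (h' : p (Fin.last n) = q (Fin.last n)) : p = q := by
  ext j
  refine Fin.lastCases h' (fun j => ?_) j
  rw [← vproj_apply, h, vproj_apply]

lemma norm_sq_eq (q : Rn (n + 1)) : ‖q‖ ^ 2 = ‖vproj q‖ ^ 2 + q (Fin.last n) ^ 2 := by
  simp [EuclideanSpace.norm_sq_eq, Fin.sum_univ_castSucc]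

@[simp] lemma vproj_susp_add_vert (a : Rn n) (b : ℝ) : vproj (susp a + vert b) = a := by
  ext j
  simp [vert, (Fin.castSucc_lt_last j).ne]

@[simp] lemma susp_add_vert_last (a : Rn n) (b : ℝ) :
    (susp a + vert b : Rn (n + 1)) (Fin.last n) = b := by
  simp [vert]

lemma vproj_nrm (c : Rn n) (r : ℝ) (q : Rn (n + 1)) :
    vproj (nrm (susp c) r q) = nrm c r (vproj q) := by
  ext j
  simp [nrm]

lemma nrm_last (c : Rn n) (r : ℝ) (q : Rn (n + 1)) :
    nrm (susp c) r q (Fin.last n) = r⁻¹ * q (Fin.last n) := by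
  simp [nrm]

/-- The height of the northern hemisphere over a point of the disc. -/
def north (a : Rn n) : ℝ := √(1 - ‖a‖ ^ 2)

lemma north_nonneg (a : Rn n) : 0 ≤ north a := Real.sqrt_nonneg _

lemma north_sq {a : Rn n} (h : ‖a‖ ≤ 1) : north a ^ 2 = 1 - ‖a‖ ^ 2 :=
  Real.sq_sqrt (by nlinarith [norm_nonneg a])

lemma continuous_north : Continuous (north : Rn n → ℝ) :=
  Real.continuous_sqrt.comp (by fun_prop)

/-- The disc lies between the graphs of the southern and the northern hemisphere over its
projection; in this form the vertical retraction clamps the last coordinate. -/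
lemma norm_le_one_iff (q : Rn (n + 1)) :
    ‖q‖ ≤ 1 ↔ ‖vproj q‖ ≤ 1 ∧ -north (vproj q) ≤ q (Fin.last n) ∧
      q (Fin.last n) ≤ north (vproj q) := by
  rw [← abs_le, ← sq_le_one_iff₀ (norm_nonneg q), norm_sq_eq]
  constructor
  · intro h
    have h1 : ‖vproj q‖ ≤ 1 := by
      rw [← sq_le_one_iff₀ (norm_nonneg _)]
      nlinarith [sq_nonneg (q (Fin.last n))]
    refine ⟨h1, ?_⟩
    rw [← abs_of_nonneg (north_nonneg (vproj q)), ← sq_le_sq, north_sq h1]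
    linarith
  · rintro ⟨h1, h2⟩
    rw [← abs_of_nonneg (north_nonneg (vproj q)), ← sq_le_sq, north_sq h1] at h2
    linarith

/-- The retraction of `ℝ^{n+1}` to the disc that moves points of the column over the disc
vertically. -/
def columnRet (q : Rn (n + 1)) : Disc (n + 1) :=
  ⟨susp (discRet (vproj q)).1 + vert (max (-north (discRet (vproj q)).1)
    (min (q (Fin.last n)) (north (discRet (vproj q)).1))), by
    have h := north_nonneg (discRet (vproj q)).1
    rw [mem_closedBall_zero_iff, norm_le_one_iff, vproj_susp_add_vert, susp_add_vert_last]
    exact ⟨mem_closedBall_zero_iff.1 (discRet (vproj q)).2, le_max_left _ _,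
      max_le (by linarith) (min_le_right _ _)⟩⟩

lemma continuous_vert : Continuous (vert : ℝ → Rn (n + 1)) :=
  (PiLp.continuous_toLp 2 _).comp (continuous_single (A := fun _ : Fin (n + 1) => ℝ) _)

lemma continuous_columnRet : Continuous (columnRet : Rn (n + 1) → Disc (n + 1)) := by
  have h1 : Continuous fun q : Rn (n + 1) => (discRet (vproj q)).1 :=
    continuous_subtype_val.comp (continuous_discRet.comp continuous_vproj)
  have h2 := continuous_north.comp h1
  have h3 := continuous_coord (Fin.last n)
  exact Continuous.subtype_mk ((continuous_susp.comp h1).add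
    (continuous_vert.comp (h2.neg.max (h3.min h2)))) _

/-- The column over the disc: the disc and all points above it. -/
def column (n : ℕ) : Set (Rn (n + 1)) :=
  {q | ‖vproj q‖ ≤ 1 ∧ -north (vproj q) ≤ q (Fin.last n)}

lemma columnRet_of_mem {q : Rn (n + 1)} (h : q ∈ column n) : (columnRet q).1 =
    susp (vproj q) + vert (min (q (Fin.last n)) (north (vproj q))) := by
  have h1 := north_nonneg (vproj q)
  have h2 := h.2
  change susp (discRet (vproj q)).1 + vert (max (-north (discRet (vproj q)).1)
    (min (q (Fin.last n)) (north (discRet (vproj q)).1))) = _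
  rw [discRet_of_le h.1, max_eq_right (le_min h2 (by linarith))]

lemma vproj_columnRet {q : Rn (n + 1)} (h : q ∈ column n) : vproj (columnRet q).1 = vproj q := by
  rw [columnRet_of_mem h, vproj_susp_add_vert]

lemma columnRet_last {q : Rn (n + 1)} (h : q ∈ column n) :
    (columnRet q).1 (Fin.last n) = min (q (Fin.last n)) (north (vproj q)) := by
  rw [columnRet_of_mem h, susp_add_vert_last]

lemma mem_column_of_norm_le {q : Rn (n + 1)} (h : ‖q‖ ≤ 1) : q ∈ column n :=
  ⟨((norm_le_one_iff q).1 h).1, ((norm_le_one_iff q).1 h).2.1⟩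

lemma columnRet_of_norm_le {q : Rn (n + 1)} (h : ‖q‖ ≤ 1) : (columnRet q).1 = q := by
  have h1 := mem_column_of_norm_le h
  refine ext_vproj (vproj_columnRet h1) ?_
  rw [columnRet_last h1, min_eq_left ((norm_le_one_iff q).1 h).2.2]

/-- Points of the column outside the disc are retracted to the northern hemisphere. -/
lemma columnRet_last_of_lt {q : Rn (n + 1)} (h : q ∈ column n) (h' : 1 < ‖q‖) :
    (columnRet q).1 (Fin.last n) = north (vproj q) ∧ north (vproj q) < q (Fin.last n) := by
  have h1 : north (vproj q) < q (Fin.last n) := by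
    by_contra hle
    exact h'.not_ge ((norm_le_one_iff q).2 ⟨h.1, h.2, not_lt.1 hle⟩)
  exact ⟨by rw [columnRet_last h, min_eq_right h1.le], h1⟩

lemma norm_columnRet_of_lt {q : Rn (n + 1)} (h : q ∈ column n) (h' : 1 < ‖q‖) :
    ‖(columnRet q).1‖ = 1 := by
  have h1 : ‖(columnRet q).1‖ ^ 2 = 1 := by
    rw [norm_sq_eq, vproj_columnRet h, (columnRet_last_of_lt h h').1, north_sq h.1]
    ring
  exact (pow_eq_one_iff_of_nonneg (norm_nonneg _) two_ne_zero).1 h1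

/-- The column minus its core consists of the southern hemisphere and the points above the equator,
which retract to the equator. What remains is given by strict inequalities, hence is open. -/
lemma column_core_iff (q : Rn (n + 1)) : (q ∈ column n ∧ (columnRet q).1 ∉ halfBdry n) ↔
    ‖vproj q‖ < 1 ∧ -north (vproj q) < q (Fin.last n) := by
  have hsq : ∀ h : q ∈ column n, ‖(columnRet q).1‖ ^ 2 =
      ‖vproj q‖ ^ 2 + min (q (Fin.last n)) (north (vproj q)) ^ 2 := fun h => by
    rw [norm_sq_eq, vproj_columnRet h, columnRet_last h]
  have hn := north_nonneg (vproj q)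
  constructor
  · rintro ⟨h, hA⟩
    by_contra hcon
    refine hA ?_
    have h1 := north_sq h.1
    have h3 : (‖vproj q‖ = 1 ∧ north (vproj q) = 0) ∨ q (Fin.last n) = -north (vproj q) := by
      rcases h.1.lt_or_eq with h2 | h2
      · right
        exact le_antisymm (not_lt.1 fun h3 => hcon ⟨h2, h3⟩) h.2
      · left
        rw [h2] at h1
        exact ⟨h2, by nlinarith⟩
    have h4 : ‖(columnRet q).1‖ ^ 2 = 1 ∧ (columnRet q).1 (Fin.last n) ≤ 0 := by
      rw [hsq h, columnRet_last h]
      rcases h3 with ⟨h3, h4⟩ | h3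
      · have h5 := h.2
        rw [h4, neg_zero] at h5
        rw [h3, h4, min_eq_right h5]
        norm_num
      · rw [h3, min_eq_left (by linarith), neg_sq, h1]
        constructor <;> linarith
    exact ⟨(pow_eq_one_iff_of_nonneg (norm_nonneg _) two_ne_zero).1 h4.1, h4.2⟩
  · rintro ⟨h1, h2⟩
    have h : q ∈ column n := ⟨h1.le, h2.le⟩
    refine ⟨h, ?_⟩
    rintro ⟨h3, h4⟩
    have h5 := hsq h
    rw [h3] at h5
    rw [columnRet_last h] at h4
    have h6 := north_sq h1.le
    have h7 : 0 < north (vproj q) := Real.sqrt_pos.2 (by nlinarith [norm_nonneg (vproj q)])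
    rcases min_choice (q (Fin.last n)) (north (vproj q)) with h8 | h8
    · rw [h8] at h4 h5
      nlinarith
    · rw [h8] at h4
      linarith

/-- The column over the disc. -/
def columnShape (n : ℕ) : Shape (n + 1) (halfBdry n) where
  reg := column n
  ret := columnRet
  isClosed_reg := (isClosed_le continuous_vproj.norm continuous_const).inter
    (isClosed_le (continuous_north.comp continuous_vproj).neg (continuous_coord _))
  continuous_ret := continuous_columnRet
  mem_reg y := mem_column_of_norm_le (mem_closedBall_zero_iff.1 y.2)
  ret_self y := Subtype.ext (columnRet_of_norm_le (mem_closedBall_zero_iff.1 y.2))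
  isOpen_core := by
    have : {q : Rn (n + 1) | q ∈ column n ∧ (columnRet q).1 ∉ halfBdry n} =
        {q | ‖vproj q‖ < 1} ∩ {q | -north (vproj q) < q (Fin.last n)} :=
      Set.ext fun q => column_core_iff q
    rw [this]
    exact (isOpen_lt continuous_vproj.norm continuous_const).inter
      (isOpen_lt (continuous_north.comp continuous_vproj).neg (continuous_coord _))
  ret_eq q hq h := by
    by_cases h1 : 1 < ‖q‖
    · rw [norm_columnRet_of_lt hq h1] at h
      exact absurd h (lt_irrefl 1)
    · exact columnRet_of_norm_le (not_lt.1 h1)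

lemma mem_columnShape_core {q : Rn (n + 1)} : q ∈ (columnShape n).core ↔
    ‖vproj q‖ < 1 ∧ -north (vproj q) < q (Fin.last n) := column_core_iff q

/-- The fibre of the retraction of the column over a point of the northern hemisphere is the
vertical ray above it; over any other point of the disc it is that point alone. -/
lemma inColumn_iff_rel {c : Rn n} {r : ℝ} (hr : 0 < r) (y : Disc (n + 1)) (q : Rn (n + 1)) :
    InColumn c r y.1 q ↔ (columnShape n).Rel (susp c) r y.1 q := by
  constructor
  · rintro (rfl | ⟨h1, h2, h, hh, rfl⟩)
    · exact Shape.rel_apply _ _ hr y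
    · have h3 : nrm (susp c) r (susp c + r • y.1 + vert h) = y.1 + vert (r⁻¹ * h) := by
        have : (vert (r⁻¹ * h) : Rn (n + 1)) = r⁻¹ • vert h := by
          ext j
          simp [vert]
        rw [this, nrm, add_assoc, add_sub_cancel_left, smul_add, inv_smul_smul₀ hr.ne']
      have h4 : vproj (y.1 + vert (r⁻¹ * h)) = vproj y.1 := by
        ext j
        simp [vert, (Fin.castSucc_lt_last j).ne]
      have h5 : (y.1 + vert (r⁻¹ * h) : Rn (n + 1)) (Fin.last n) = y.1 (Fin.last n) + r⁻¹ * h := by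
        simp [vert]
      have h6 := (norm_le_one_iff y.1).1 h1.le
      have h7 : y.1 (Fin.last n) = north (vproj y.1) := by
        have h8 := norm_sq_eq y.1
        have h9 := north_sq h6.1
        rw [h1] at h8
        exact (sq_eq_sq₀ h2 (north_nonneg _)).1 (by linarith)
      have h8 : 0 ≤ r⁻¹ * h := by positivity
      have h9 : y.1 + vert (r⁻¹ * h) ∈ column n := by
        refine ⟨by rw [h4]; exact h6.1, ?_⟩
        rw [h4, h5]
        linarith
      rw [Shape.Rel, h3]
      refine ⟨h9, ext_vproj ?_ ?_⟩
      · exact (vproj_columnRet h9).trans h4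
      · refine (columnRet_last h9).trans ?_
        rw [h4, h5, ← h7, min_eq_right (by linarith)]
  · rintro ⟨h1, h2⟩
    have h1' : nrm (susp c) r q ∈ column n := h1
    have h2' : (columnRet (nrm (susp c) r q)).1 = y.1 := h2
    by_cases h3 : 1 < ‖nrm (susp c) r q‖
    · right
      have h4 := columnRet_last_of_lt h1' h3
      have h5 := norm_columnRet_of_lt h1' h3
      have h6 := vproj_columnRet h1'
      rw [h2'] at h4 h5 h6
      refine ⟨h5, ?_, r * (nrm (susp c) r q (Fin.last n) - y.1 (Fin.last n)), ?_, ?_⟩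
      · rw [h4.1]
        exact north_nonneg _
      · refine mul_nonneg hr.le ?_
        rw [h4.1]
        linarith
      · have h7 : nrm (susp c) r q =
            y.1 + vert (nrm (susp c) r q (Fin.last n) - y.1 (Fin.last n)) := by
          refine ext_vproj ?_ ?_
          · rw [← h6]
            ext j
            simp [vert, (Fin.castSucc_lt_last j).ne]
          · simp [vert]
        have h8 : (vert (r * (nrm (susp c) r q (Fin.last n) - y.1 (Fin.last n))) : Rn (n + 1)) =
            r • vert (nrm (susp c) r q (Fin.last n) - y.1 (Fin.last n)) := by
          ext j
          simp [vert]
        rw [h8, add_assoc, ← smul_add, ← h7, apply_nrm hr]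
    · left
      rw [columnRet_of_norm_le (not_lt.1 h3)] at h2'
      rw [InDisc, ← h2', apply_nrm hr]

/-- Vertical projection reduces the claim to the little n-discs at the base, whose interiors are
disjoint. -/
lemma columnShape_sep {ι : Type} {c : ι → Rn n} {r : ι → ℝ} (hpos : ∀ i, 0 < r i)
    (hsep : ∀ i j, i ≠ j → r i + r j ≤ dist (c i) (c j)) :
    (columnShape n).Sep (fun i => susp (c i)) r := by
  intro i j q hi hj
  have h1 : nrm (susp (c i)) (r i) q ∈ column n := hi
  have h2 := (mem_columnShape_core.1 hj).1
  have h3 := h1.1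
  rw [vproj_nrm] at h2 h3
  exact eq_of_norm_nrm hpos hsep h3 h2

/-- The northern hemisphere of a disc in the unit disc lies below that of the unit disc. -/
lemma mul_north_nrm_le {a c : Rn n} {r : ℝ} (hr : 0 < r) (hc : ‖c‖ ≤ 1 - r)
    (h : ‖nrm c r a‖ ≤ 1) : ‖a‖ ≤ 1 ∧ r * north (nrm c r a) ≤ north a := by
  have h1 : ‖a‖ ≤ ‖c‖ + r * ‖nrm c r a‖ := by
    have h2 := norm_add_le c (r • nrm c r a)
    rwa [apply_nrm hr, norm_smul, Real.norm_of_nonneg hr.le] at h2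
  have h0 := norm_nonneg (nrm c r a)
  have hc0 := norm_nonneg c
  have h2 : ‖a‖ ≤ 1 := by nlinarith
  refine ⟨h2, ?_⟩
  rw [← sq_le_sq₀ (mul_nonneg hr.le (north_nonneg _)) (north_nonneg _), mul_pow, north_sq h,
    north_sq h2]
  set p := ‖nrm c r a‖
  -- After this estimate the claim is r²(1 - p²) ≤ 1 - (1 - r + rp)²; the difference of the two
  -- sides is 2r(1 - r)(1 - p).
  have h3 : ‖a‖ ^ 2 ≤ (1 - r + r * p) ^ 2 := by
    have := norm_nonneg a
    gcongr
    linarith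
  nlinarith [mul_nonneg hr.le (mul_nonneg (sub_nonneg.2 h) (by linarith : 0 ≤ 1 - r))]

/-- By `mul_north_nrm_le` the hemispheres of a small disc lie between those of the unit disc. Hence
small columns lie in the large one, and clamping the height first at the upper hemisphere has no
effect on clamping it at the lower one. -/
lemma columnShape_fits {ι : Type} (θ : LittleDiscs n ι) : (columnShape n).Fits θ.suspend := by
  have hkey : ∀ i (q : Rn (n + 1)), nrm (susp (θ.centre i)) (θ.radius i) q ∈ column n →
      q ∈ column n := by
    rintro i q ⟨h1, h2⟩
    rw [vproj_nrm] at h1 h2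
    have hr := θ.radius_pos i
    have h3 := mul_north_nrm_le hr (θ.inside i) h1
    rw [nrm_last, le_inv_mul_iff₀ hr] at h2
    exact ⟨h3.1, by linarith⟩
  have hproj : ∀ i (q : Rn (n + 1)), q ∈ column n →
      vproj (nrm (susp (θ.centre i)) (θ.radius i) (columnRet q).1) =
        nrm (θ.centre i) (θ.radius i) (vproj q) := fun i q hq => by
    rw [vproj_nrm, vproj_columnRet hq]
  have hmem : ∀ i (q : Rn (n + 1)), nrm (susp (θ.centre i)) (θ.radius i) q ∈ column n ↔
      q ∈ column n ∧ nrm (susp (θ.centre i)) (θ.radius i) (columnRet q).1 ∈ column n := by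
    intro i q
    have hr := θ.radius_pos i
    constructor
    · intro h
      refine ⟨hkey i q h, ?_, ?_⟩
      · rw [hproj i q (hkey i q h), ← vproj_nrm]
        exact h.1
      · have h2 := h.2
        rw [hproj i q (hkey i q h), nrm_last, columnRet_last (hkey i q h), le_inv_mul_iff₀ hr]
        rw [vproj_nrm, nrm_last, le_inv_mul_iff₀ hr] at h2
        have h3 := mul_nonneg hr.le (north_nonneg (nrm (θ.centre i) (θ.radius i) (vproj q)))
        have h4 := north_nonneg (vproj q)
        exact le_min h2 (by linarith)
    · rintro ⟨hq, h1, h2⟩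
      rw [hproj i q hq] at h1 h2
      refine ⟨by rw [vproj_nrm]; exact h1, ?_⟩
      rw [nrm_last, columnRet_last hq, le_inv_mul_iff₀ hr] at h2
      rw [vproj_nrm, nrm_last, le_inv_mul_iff₀ hr]
      exact h2.trans (min_le_left _ _)
  refine ⟨columnShape_sep θ.radius_pos θ.sep, fun i q hq hA => ?_, hmem, fun i q hq => ?_⟩
  · obtain ⟨hA1, hA2⟩ := hA
    have hr := θ.radius_pos i
    obtain ⟨h1, h2⟩ := mem_columnShape_core.1 hq
    set u := nrm (susp (θ.centre i)) (θ.radius i) q with hu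
    have h1 : ‖vproj u‖ < 1 := h1
    have h2 : -north (vproj u) < u (Fin.last n) := h2
    -- A core point that is not above the equatorial plane is interior to its thickened disc, hence
    -- interior to the unit disc; so it is not on the southern hemisphere.
    have h3 : u (Fin.last n) ≤ 0 := by
      rw [hu, nrm_last]
      exact mul_nonpos_of_nonneg_of_nonpos (inv_nonneg.2 hr.le) hA2
    have h4 : ‖u‖ < 1 := by
      have h5 := north_sq h1.le
      have h6 := norm_sq_eq u
      have h7 : u (Fin.last n) ^ 2 < north (vproj u) ^ 2 := by nlinarith
      rw [← sq_lt_one_iff₀ (norm_nonneg _)]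
      linarith
    have h5 := θ.suspend.norm_apply_le i u
    have h6 : q = θ.suspend.centre i + θ.suspend.radius i • u := (apply_nrm hr q).symm
    rw [← h6, hA1] at h5
    have h7 : θ.suspend.radius i = θ.radius i := rfl
    rw [h7] at h5
    nlinarith
  · have hq' : nrm (susp (θ.centre i)) (θ.radius i) q ∈ column n := hq
    have hqc := hkey i q hq'
    have hm := ((hmem i q).1 hq').2
    have hr := θ.radius_pos i
    have h1 := hq'.1
    rw [vproj_nrm] at h1
    have h3 := (mul_north_nrm_le hr (θ.inside i) h1).2
    refine Subtype.ext (ext_vproj ?_ ?_)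
    · refine (vproj_columnRet hm).trans (Eq.trans ?_ (vproj_columnRet hq').symm)
      rw [hproj i q hqc, vproj_nrm]
    · refine (columnRet_last hm).trans (Eq.trans ?_ (columnRet_last hq').symm)
      rw [hproj i q hqc, vproj_nrm, nrm_last, nrm_last, columnRet_last hqc,
        mul_min_of_nonneg _ _ (inv_nonneg.2 hr.le), min_assoc]
      congr 1
      refine min_eq_right ?_
      rwa [le_inv_mul_iff₀ hr]

/-- Widths are measured along coordinate 0, which is not the vertical one as n ≠ 0. Vertical
projection preserves it, so the bounds are those of the discs at the base. -/
lemma columnShape_fitsLinear [NeZero n] {ι : Type} (θ : LinearDiscs n ι) :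
    (columnShape n).FitsLinear θ.suspend := by
  have h0 : ∀ i (q : Rn (n + 1)), (vproj q - θ.centre i) 0 = q 0 - θ.centre i 0 := fun i q => by
    rw [PiLp.sub_apply, vproj_apply, Fin.castSucc_zero']
  refine ⟨columnShape_sep θ.radius_pos θ.sep, fun i q hq => ?_, fun i q hq => ?_⟩
  · have h : nrm (susp (θ.centre i)) (θ.radius i) q ∈ column n := hq
    have h1 := h.1
    rw [vproj_nrm, norm_nrm_le_one (θ.radius_pos i)] at h1
    have h2 := (coord_abs_le _ 0).trans h1
    rw [h0] at h2
    have h2 := abs_le.1 h2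
    have h3 := θ.inside_zero i
    change 0 ≤ q 0 ∧ q 0 ≤ θ.width
    constructor <;> linarith
  · have h1 := (mem_columnShape_core.1 hq).1
    have h1' : ‖vproj (nrm (susp (θ.centre i)) (θ.radius i) q)‖ < 1 := h1
    rw [vproj_nrm, norm_nrm_lt_one (θ.radius_pos i)] at h1'
    have h2 := (coord_abs_le _ 0).trans_lt h1'
    rw [h0] at h2
    have h2 := abs_lt.1 h2
    have h3 := θ.inside_zero i
    change 0 < q 0 ∧ q 0 < θ.width
    constructor <;> linarith

/-- Maps that are x₀ on the whole sphere are extended upwards by x₀, so the part of a column above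
its disc contributes nothing new. -/
lemma glueVal_discShape_eq {ι : Type} {X : Type*} [TopologicalSpace X] [Nonempty X] {x₀ : X}
    {cX : Set (SphClass (n + 1) X)} {c : ι → Rn n} {r : ι → ℝ}
    (hpos : ∀ i, 0 < r i) (hsep : ∀ i j, i ≠ j → r i + r j ≤ dist (c i) (c j))
    (x : ι → CMapDisc (bdry (n + 1)) x₀ cX) {q : Rn (n + 1)}
    (hq : ¬ ∃ i, ∃ y ∈ (x i).1.pts, q = susp (c i) + r i • y.1) :
    glueVal (discShape (n + 1)) (fun i => susp (c i)) r x q =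
      glueVal (columnShape n) (fun i => susp (c i)) r (fun i => (x i).incl) q := by
  have hS := columnShape_sep hpos hsep
  have hS' : (discShape (n + 1)).Sep (fun i => susp (c i)) r :=
    discShape_sep hpos fun i j h => by rw [dist_susp]; exact hsep i j h
  have hcore : ∀ u : Rn (n + 1), ‖u‖ < 1 → u ∈ (columnShape n).core := fun u hu => by
    refine ⟨mem_column_of_norm_le hu.le, fun h => ?_⟩
    have h1 : (columnRet u).1 ∈ halfBdry n := h
    rw [columnRet_of_norm_le hu.le] at h1
    exact hu.ne h1.1
  by_cases hex : ∃ i, nrm (susp (c i)) (r i) q ∈ (columnShape n).core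
  · obtain ⟨i, hi⟩ := hex
    have hreg : nrm (susp (c i)) (r i) q ∈ column n := hi.1
    have hn := (columnShape n).ret_notMem_of_notMem hpos (fun i => (x i).incl) hq i hi.1
    rw [glueVal_of_mem hS _ hi.1 hn]
    by_cases h1 : 1 < ‖nrm (susp (c i)) (r i) q‖
    · rw [glueVal_of_notMem, ConfMap.ev_eq _ hn]
      · exact ((x i).2.2.1 _ hn (norm_columnRet_of_lt hreg h1)).symm
      -- The disc of another index cannot contain the point in its interior, as that interior is
      -- part of the core of another column.
      · intro j hj
        have h2 := mem_discShape_core.1 hj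
        have h3 := hS i j q hi.1 (hcore _ h2)
        subst h3
        linarith
    · have h2 := not_lt.1 h1
      have h3 : (discShape (n + 1)).ret (nrm (susp (c i)) (r i) q) =
          (columnShape n).ret (nrm (susp (c i)) (r i) q) :=
        Subtype.ext ((discShape_ret h2).trans (columnRet_of_norm_le h2).symm)
      rw [← h3] at hn ⊢
      exact glueVal_of_mem hS' x (mem_discShape_reg.2 h2) hn
  · push Not at hex
    rw [glueVal_of_notMem _ _ hex, glueVal_of_notMem]
    exact fun i hi => hex i (hcore _ (mem_discShape_core.1 hi))

end Vproj

/-! ## The algebra of configurations -/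

namespace LittleDiscs

variable {d : ℕ} {ι κ : Type}

lemma ext_conf {z z' : CDisc d} (h : ∀ p, p ∈ z.1.pts ↔ p ∈ z'.1.pts) : z = z' :=
  Subtype.ext (Conf.ext (Set.ext h))

lemma conf_one (z : Unit → CDisc d) : (one d).conf z = z () := by
  refine ext_conf fun p => ?_
  rw [mem_conf]
  constructor
  · rintro ⟨i, y, hy, h⟩
    have : p = y := Subtype.ext (by simpa [one] using h)
    rwa [this]
  · exact fun h => ⟨(), p, h, by simp [one]⟩

lemma conf_reindex [Finite ι] [Finite κ] (e : ι ≃ κ) (θ : LittleDiscs d ι) (z : κ → CDisc d) :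
    (θ.reindex e).conf z = θ.conf (z ∘ e) := by
  refine ext_conf fun p => ?_
  rw [mem_conf, mem_conf, ← e.exists_congr_right]
  simp [reindex]

lemma conf_comp {κ : ι → Type} [Finite ι] [∀ i, Finite (κ i)] (θ : LittleDiscs d ι)
    (φ : ∀ i, LittleDiscs d (κ i)) (z : (Σ i, κ i) → CDisc d) :
    (θ.comp φ).conf z = θ.conf fun i => (φ i).conf fun j => z ⟨i, j⟩ := by
  refine ext_conf fun p => ?_
  rw [mem_conf, mem_conf]
  constructor
  · rintro ⟨⟨i, j⟩, y, hy, h⟩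
    refine ⟨i, (φ i).apply j y, ((φ i).mem_conf _ _).2 ⟨j, y, hy, rfl⟩, ?_⟩
    rw [h]
    simp only [comp, apply, smul_add, mul_smul, add_assoc]
  · rintro ⟨i, y', hy', h⟩
    obtain ⟨j, y, hy, h'⟩ := ((φ i).mem_conf _ _).1 hy'
    refine ⟨⟨i, j⟩, y, hy, ?_⟩
    rw [h, h']
    simp only [comp, smul_add, mul_smul, add_assoc]

end LittleDiscs

namespace LinearDiscs

variable {n : ℕ} {ι κ : Type} {M : Type*} [TopologicalSpace M]
  [ChartedSpace (EuclideanHalfSpace (n + 1)) M] {D : BoundaryDisc n M}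

lemma ext_conf {w w' : CDot D} (h : ∀ p, p ∈ w.1.1.pts ↔ p ∈ w'.1.1.pts)
    (h' : w.1.2 = w'.1.2) : w = w' :=
  Subtype.ext (Prod.ext (Conf.ext (Set.ext h)) h')

lemma conf_one (z : Empty → CDisc (n + 1)) (w : CDot D) : (one (n + 1)).conf z w = w := by
  refine ext_conf (fun p => ?_) (add_zero _)
  rw [mem_conf]
  exact or_iff_left fun ⟨i, _⟩ => i.elim

lemma conf_reindex [Finite ι] [Finite κ] (e : ι ≃ κ) (θ : LinearDiscs (n + 1) ι)
    (z : κ → CDisc (n + 1)) (w : CDot D) : (θ.reindex e).conf z w = θ.conf (z ∘ e) w := by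
  refine ext_conf (fun p => ?_) rfl
  rw [mem_conf, mem_conf, ← e.exists_congr_right]
  simp [reindex]

lemma conf_comp {κ : ι → Type} {μ : Type} [Finite ι] [Finite μ] [∀ i, Finite (κ i)]
    (θ : LinearDiscs (n + 1) ι) (φ : ∀ i, LittleDiscs (n + 1) (κ i)) (ψ : LinearDiscs (n + 1) μ)
    (z : (Σ i, κ i) ⊕ μ → CDisc (n + 1)) (w : CDot D) :
    (θ.comp φ ψ).conf z w =
      θ.conf (fun i => (φ i).conf fun j => z (Sum.inl ⟨i, j⟩))
        (ψ.conf (fun k => z (Sum.inr k)) w) := by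
  have key : ∀ i j (y : Rn (n + 1)), horiz w.1.2 + ((θ.comp φ ψ).centre (Sum.inl ⟨i, j⟩) +
      (θ.comp φ ψ).radius (Sum.inl ⟨i, j⟩) • y) =
      horiz (w.1.2 + ψ.width) + (θ.centre i + θ.radius i •
        ((φ i).centre j + (φ i).radius j • y)) := fun i j y => by
    simp only [comp, Sum.elim_inl, smul_add, mul_smul, add_assoc, horiz_add]
  refine ext_conf (fun p => ?_) (add_assoc _ _ _).symm
  rw [mem_conf, mem_conf, mem_conf]
  constructor
  · rintro (h | ⟨⟨i, j⟩ | k, y, hy, h⟩)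
    · exact Or.inl (Or.inl h)
    · rw [key] at h
      exact Or.inr ⟨i, (φ i).apply j y, ((φ i).mem_conf _ _).2 ⟨j, y, hy, rfl⟩, h⟩
    · exact Or.inl (Or.inr ⟨k, y, hy, h⟩)
  · rintro ((h | ⟨k, y, hy, h⟩) | ⟨i, y', hy', h⟩)
    · exact Or.inl h
    · exact Or.inr ⟨Sum.inr k, y, hy, h⟩
    · obtain ⟨j, y, hy, h'⟩ := ((φ i).mem_conf _ _).1 hy'
      refine Or.inr ⟨Sum.inl ⟨i, j⟩, y, hy, ?_⟩
      rw [key, ← h']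
      exact h

end LinearDiscs

/-- The action of `LSC_{n+1}` on configurations. -/
def confAlgebra {n : ℕ} {M : Type*} [TopologicalSpace M] [T2Space M]
    [ChartedSpace (EuclideanHalfSpace (n + 1)) M] (D : BoundaryDisc n M) :
    LSCAlgebra (n + 1) (CDot D) (CDisc (n + 1)) where
  actA θ z := θ.conf z
  actM θ z w := θ.conf z w
  continuous_actA := LittleDiscs.continuous_conf continuous_fst continuous_snd
  continuous_actM := LinearDiscs.continuous_conf continuous_fst
    (continuous_fst.comp continuous_snd) (continuous_snd.comp continuous_snd)
  actA_one := LittleDiscs.conf_one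
  actM_one := LinearDiscs.conf_one
  actA_reindex := LittleDiscs.conf_reindex
  actM_reindex := LinearDiscs.conf_reindex
  actA_comp := LittleDiscs.conf_comp
  actM_comp := LinearDiscs.conf_comp

lemma isConfAction_confAlgebra {n : ℕ} {M : Type*} [TopologicalSpace M] [T2Space M]
    [ChartedSpace (EuclideanHalfSpace (n + 1)) M] (D : BoundaryDisc n M) :
    IsConfAction (confAlgebra D) where
  actA θ z := θ.mem_conf z
  actM θ z w p := (θ.mem_conf z w p).trans <| or_congr_right <| exists_congr fun _ =>
    exists_congr fun _ => and_congr_right fun _ =>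
      ⟨fun h => ⟨_, rfl, h⟩, fun ⟨_, hq, h⟩ => by rwa [hq] at h⟩
  actM_width _ _ _ := rfl

/-! ## The algebras of configuration-maps -/

section Laws

variable {d : ℕ} {A : Set (Rn d)} {ι κ : Type} {X : Type*} [TopologicalSpace X]

lemma Shape.rel_zero_one (S : Shape d A) (y p : Disc d) : S.Rel 0 1 y.1 p.1 ↔ y = p := by
  have h : nrm 0 1 p.1 = p.1 := by simp [nrm]
  rw [Shape.Rel, h, S.ret_self p]
  exact ⟨fun h => Subtype.ext h.2.symm, fun h => ⟨S.mem_reg p, by rw [h]⟩⟩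

lemma Shape.rel_add_left (S : Shape d A) (v C : Rn d) (r : ℝ) (y q : Rn d) :
    S.Rel (v + C) r y q ↔ S.Rel C r y (q - v) := by
  rw [Shape.Rel, Shape.Rel, nrm, nrm, sub_sub]

lemma IsGluedMap.reindex {R : κ → Rn d → Rn d → Prop} {x₀ : X} {x : κ → ConfMap (Disc d) X}
    {s : ConfMap (Disc d) X} (e : ι ≃ κ)
    (h : IsGluedMap (fun i => R (e i)) x₀ (fun i => x (e i)) s) : IsGluedMap R x₀ x s where
  conf p := by
    rw [h.conf p, ← e.exists_congr_right]
  sec_in p i y hy := by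
    obtain ⟨i, rfl⟩ := e.surjective i
    exact h.sec_in p i y hy
  sec_out p hp := h.sec_out p fun i => hp (e i)

variable [Nonempty X] {x₀ : X} {c : Set (SphClass d X)}

/-- The operation is a variable with an equation, here and in the laws below, so that they also
apply to suspended operations, where the equation is a lemma. -/
lemma Shape.actA_one (S : Shape d A) {θ : LittleDiscs d Unit} (hθ : S.Fits θ)
    (h : θ = LittleDiscs.one d) (x : Unit → CMapDisc A x₀ c) : S.actA θ hθ x = x () := by
  subst h
  refine S.actA_eq_of_isGluedMap hθ x ⟨fun p => ?_, fun p _ y hy => ?_, fun p hp => ?_⟩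
  · constructor
    · exact fun hp => ⟨(), p, hp, (S.rel_zero_one p p).2 rfl⟩
    · rintro ⟨_, y, hy, h⟩
      rwa [← (S.rel_zero_one y p).1 h]
  · exact congrArg _ (Subtype.ext ((S.rel_zero_one y.1 p.1).1 hy).symm)
  · exact absurd ((S.rel_zero_one p.1 p.1).2 rfl) (hp () p.1)

lemma Shape.actA_reindex [Finite ι] [Finite κ] (S : Shape d A) {θ : LittleDiscs d ι}
    {θ' : LittleDiscs d κ} (hθ : S.Fits θ) (hθ' : S.Fits θ') (e : ι ≃ κ) (h : θ' = θ.reindex e)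
    (x : κ → CMapDisc A x₀ c) : S.actA θ' hθ' x = S.actA θ hθ (x ∘ e) := by
  subst h
  refine S.actA_eq_of_isGluedMap hθ' x (IsGluedMap.reindex e ?_)
  have h := S.isGluedMap_glueMap hθ (x ∘ e)
  change IsGluedMap _ _ _ (S.glueMap θ hθ (x ∘ e))
  simpa [LittleDiscs.reindex] using h

lemma Shape.actA_comp {κ : ι → Type} [Finite ι] [∀ i, Finite (κ i)] (S : Shape d A)
    {θ : LittleDiscs d ι} {φ : ∀ i, LittleDiscs d (κ i)} {θ' : LittleDiscs d (Σ i, κ i)}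
    (hθ : S.Fits θ) (hφ : ∀ i, S.Fits (φ i)) (hθ' : S.Fits θ') (h : θ' = θ.comp φ)
    (x : (Σ i, κ i) → CMapDisc A x₀ c) :
    S.actA θ' hθ' x = S.actA θ hθ fun i => S.actA (φ i) (hφ i) fun j => x ⟨i, j⟩ := by
  subst h
  exact S.actA_eq_of_isGluedMap hθ' x (IsGluedMap.comp
    (R := fun i => S.Rel (θ.centre i) (θ.radius i))
    (fun i => S.isGluedMap_glueMap (hφ i) fun j => x ⟨i, j⟩) (S.isGluedMap_glueMap hθ fun i =>
      S.actA (φ i) (hφ i) fun j => x ⟨i, j⟩) fun i j y q => S.rel_comp (hφ i) _ (θ.radius_pos i) j y.1 q)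

end Laws

/-! ### The laws for insertion into the cylinder, and the maps between the algebras. -/

section LinearLaws

variable {n : ℕ} {ι κ : Type} {M E X : Type*} [TopologicalSpace M]
  [ChartedSpace (EuclideanHalfSpace (n + 1)) M] [TopologicalSpace E] [TopologicalSpace X]
  {D : BoundaryDisc n M} {ξ : E → M} {T : DiscTrivialization D ξ X} {x₀ : X}
  {A : Set (Rn (n + 1))}

lemma IsGluedSec.reindex {R : κ → Rn (n + 1) → Rn (n + 1) → Prop} {t : ℝ}
    {x : κ → ConfMap (Disc (n + 1)) X} {s s' : ConfMap (Hat D) (HatE D ξ)} (e : ι ≃ κ)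
    (h : IsGluedSec T (fun i => R (e i)) x₀ t (fun i => x (e i)) s s') :
    IsGluedSec T R x₀ t x s s' where
  conf p := by
    rw [h.conf p, ← e.exists_congr_right]
  sec_old := h.sec_old
  sec_in p i y q hy := by
    obtain ⟨i, rfl⟩ := e.surjective i
    exact h.sec_in p i y q hy
  sec_out p hp hp' := h.sec_out p hp fun i => hp' (e i)

lemma continuous_cMapDisc_incl {cD : Set (SphClass (n + 1) X)} :
    Continuous (CMapDisc.incl : CMapDisc (bdry (n + 1)) x₀ cD → CMapDisc (halfBdry n) x₀ cD) :=
  Continuous.subtype_mk continuous_subtype_val _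

variable [Nonempty X] [Nonempty (HatE D ξ)] [T2Space M]
  {c : Set (SingClass (n + 1) ((𝓡∂ (n + 1)).interior M) ξ)}

lemma Shape.actM_one (S : Shape (n + 1) A) {θ : LinearDiscs (n + 1) Empty} (hθ : S.FitsLinear θ)
    (h : θ = LinearDiscs.one (n + 1)) (x : Empty → CMapDisc A x₀ (discClass T c))
    (w : CGammaDot T x₀ c) : S.actM θ hθ x w = w := by
  subst h
  refine S.actM_eq_of_isGluedSec hθ w x
    ⟨fun p => ?_, fun _ _ _ _ => rfl, fun _ i => i.elim, fun p hp _ => ?_⟩ (add_zero _).symm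
  · exact (or_iff_left fun ⟨i, _⟩ => i.elim).symm
  · exact w.2.2.2.2.2 p hp

lemma Shape.actM_reindex [Finite ι] [Finite κ] (S : Shape (n + 1) A) {θ : LinearDiscs (n + 1) ι}
    {θ' : LinearDiscs (n + 1) κ} (hθ : S.FitsLinear θ) (hθ' : S.FitsLinear θ') (e : ι ≃ κ)
    (h : θ' = θ.reindex e) (x : κ → CMapDisc A x₀ (discClass T c)) (w : CGammaDot T x₀ c) :
    S.actM θ' hθ' x w = S.actM θ hθ (x ∘ e) w := by
  subst h
  refine S.actM_eq_of_isGluedSec hθ' w x (IsGluedSec.reindex e ?_) rfl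
  have h := S.isGluedSec_glueSec hθ (x ∘ e) w
  change IsGluedSec _ _ _ _ _ _ (S.glueSec θ hθ (x ∘ e) w)
  simpa [LinearDiscs.reindex] using h

lemma Shape.actM_comp {κ : ι → Type} {μ : Type} [Finite ι] [Finite μ] [∀ i, Finite (κ i)]
    (S : Shape (n + 1) A) {θ : LinearDiscs (n + 1) ι} {φ : ∀ i, LittleDiscs (n + 1) (κ i)}
    {ψ : LinearDiscs (n + 1) μ} {θ' : LinearDiscs (n + 1) ((Σ i, κ i) ⊕ μ)}
    (hθ : S.FitsLinear θ) (hφ : ∀ i, S.Fits (φ i)) (hψ : S.FitsLinear ψ) (hθ' : S.FitsLinear θ')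
    (h : θ' = θ.comp φ ψ) (x : (Σ i, κ i) ⊕ μ → CMapDisc A x₀ (discClass T c))
    (w : CGammaDot T x₀ c) :
    S.actM θ' hθ' x w = S.actM θ hθ (fun i => S.actA (φ i) (hφ i) fun j => x (Sum.inl ⟨i, j⟩))
      (S.actM ψ hψ (fun k => x (Sum.inr k)) w) := by
  subst h
  refine S.actM_eq_of_isGluedSec hθ' w x (IsGluedSec.comp
    (R := fun i => S.Rel (θ.centre i) (θ.radius i)) ψ.width_nonneg
    (fun i => S.isGluedMap_glueMap (hφ i) fun j => x (Sum.inl ⟨i, j⟩))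
    (S.isGluedSec_glueSec hψ (fun k => x (Sum.inr k)) w) (S.isGluedSec_glueSec hθ
      (fun i => S.actA (φ i) (hφ i) fun j => x (Sum.inl ⟨i, j⟩))
      (S.actM ψ hψ (fun k => x (Sum.inr k)) w))
    (fun k y q hq => (hψ.reg_range k q hq.1).2) (fun i j y q => ?_) fun k y q => Iff.rfl)
    (add_assoc _ _ _)
  rw [← S.rel_comp (hφ i) _ (θ.radius_pos i) j y.1 (q - horiz ψ.width), ← S.rel_add_left]
  simp only [LinearDiscs.comp, Sum.elim_inl, add_assoc]

/-- The action of an operad `LSC_k` on configuration-section spaces by means of a shape, along a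
map of operads `LSC_k → LSC_{n+1}`. -/
def Shape.algebra {k : ℕ} [NeZero k] (S : Shape (n + 1) A) (T : DiscTrivialization D ξ X) (x₀ : X)
    (c : Set (SingClass (n + 1) ((𝓡∂ (n + 1)).interior M) ξ))
    (F : ∀ {ι : Type}, LittleDiscs k ι → LittleDiscs (n + 1) ι)
    (G : ∀ {ι : Type}, LinearDiscs k ι → LinearDiscs (n + 1) ι)
    (hF : ∀ {ι : Type} (θ : LittleDiscs k ι), S.Fits (F θ))
    (hG : ∀ {ι : Type} (θ : LinearDiscs k ι), S.FitsLinear (G θ))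
    (continuous_F : ∀ {ι : Type}, Continuous (F : LittleDiscs k ι → _))
    (continuous_G : ∀ {ι : Type}, Continuous (G : LinearDiscs k ι → _))
    (F_one : F (.one k) = .one (n + 1)) (G_one : G (.one k) = .one (n + 1))
    (F_reindex : ∀ {ι κ : Type} (e : ι ≃ κ) (θ : LittleDiscs k ι),
      F (θ.reindex e) = (F θ).reindex e)
    (G_reindex : ∀ {ι κ : Type} (e : ι ≃ κ) (θ : LinearDiscs k ι),
      G (θ.reindex e) = (G θ).reindex e)
    (F_comp : ∀ {ι : Type} {κ : ι → Type} (θ : LittleDiscs k ι) (φ : ∀ i, LittleDiscs k (κ i)),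
      F (θ.comp φ) = (F θ).comp fun i => F (φ i))
    (G_comp : ∀ {ι μ : Type} {κ : ι → Type} (θ : LinearDiscs k ι) (φ : ∀ i, LittleDiscs k (κ i))
      (ψ : LinearDiscs k μ), G (θ.comp φ ψ) = (G θ).comp (fun i => F (φ i)) (G ψ)) :
    LSCAlgebra k (CGammaDot T x₀ c) (CMapDisc A x₀ (discClass T c)) where
  actA θ x := S.actA (F θ) (hF θ) x
  actM θ x w := S.actM (G θ) (hG θ) x w
  continuous_actA := S.continuous_actA (fun _ => hF _) (continuous_F.comp continuous_fst)
    continuous_snd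
  continuous_actM := S.continuous_actM (fun _ => hG _) (continuous_G.comp continuous_fst)
    (continuous_fst.comp continuous_snd) (continuous_snd.comp continuous_snd)
  actA_one := S.actA_one _ F_one
  actM_one := S.actM_one _ G_one
  actA_reindex e θ := S.actA_reindex _ _ e (F_reindex e θ)
  actM_reindex e θ := S.actM_reindex _ _ e (G_reindex e θ)
  actA_comp θ φ := S.actA_comp (hF θ) (fun i => hF (φ i)) _ (F_comp θ φ)
  actM_comp θ φ ψ := S.actM_comp (hG θ) (fun i => hF (φ i)) (hG ψ) _ (G_comp θ φ ψ)

/-- The action of `LSC_{n+1}` on configuration-sections. -/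
def secAlgebra (T : DiscTrivialization D ξ X) (x₀ : X)
    (c : Set (SingClass (n + 1) ((𝓡∂ (n + 1)).interior M) ξ)) :
    LSCAlgebra (n + 1) (CGammaDot T x₀ c) (CMapDisc (bdry (n + 1)) x₀ (discClass T c)) :=
  (discShape (n + 1)).algebra T x₀ c id id discShape_fits discShape_fitsLinear continuous_id
    continuous_id rfl rfl (fun _ _ => rfl) (fun _ _ => rfl) (fun _ _ => rfl) fun _ _ _ => rfl

/-- The action of `LSC_n` on configuration-sections. -/
def halfSecAlgebra [NeZero n] (T : DiscTrivialization D ξ X) (x₀ : X)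
    (c : Set (SingClass (n + 1) ((𝓡∂ (n + 1)).interior M) ξ)) :
    LSCAlgebra n (CGammaDot T x₀ c) (CMapDisc (halfBdry n) x₀ (discClass T c)) :=
  (columnShape n).algebra T x₀ c LittleDiscs.suspend LinearDiscs.suspend columnShape_fits
    columnShape_fitsLinear LittleDiscs.continuous_suspend LinearDiscs.continuous_suspend
    LittleDiscs.suspend_one LinearDiscs.suspend_one (fun _ _ => rfl) (fun _ _ => rfl)
    LittleDiscs.suspend_comp LinearDiscs.suspend_comp

lemma isSecAction_secAlgebra (T : DiscTrivialization D ξ X) (x₀ : X)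
    (c : Set (SingClass (n + 1) ((𝓡∂ (n + 1)).interior M) ξ)) :
    IsSecAction (secAlgebra T x₀ c) where
  actA θ x := ((discShape (n + 1)).isGluedMap_glueMap (discShape_fits θ) x).congr
    fun i y q => (inDisc_iff_rel (θ.radius_pos i) y q).symm
  actM θ x w := ((discShape (n + 1)).isGluedSec_glueSec (discShape_fitsLinear θ) x w).congr
    fun i y q => (inDisc_iff_rel (θ.radius_pos i) y q).symm
  actM_width _ _ _ := rfl

lemma isHalfSecAction_halfSecAlgebra [NeZero n] (T : DiscTrivialization D ξ X) (x₀ : X)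
    (c : Set (SingClass (n + 1) ((𝓡∂ (n + 1)).interior M) ξ)) :
    IsHalfSecAction (halfSecAlgebra T x₀ c) where
  actA θ x := ((columnShape n).isGluedMap_glueMap (columnShape_fits θ) x).congr
    fun i y q => (inColumn_iff_rel (θ.radius_pos i) y q).symm
  actM θ x w := ((columnShape n).isGluedSec_glueSec (columnShape_fitsLinear θ) x w).congr
    fun i y q => (inColumn_iff_rel (θ.radius_pos i) y q).symm
  actM_width _ _ _ := rfl

/-- The configurations agree definitionally and the values by `glueVal_discShape_eq`; below height t
both sections are the old one. -/
lemma isLSCMap_incl [NeZero n] (T : DiscTrivialization D ξ X) (x₀ : X)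
    (c : Set (SingClass (n + 1) ((𝓡∂ (n + 1)).interior M) ξ)) :
    IsLSCMap (secAlgebra T x₀ c).restrict (halfSecAlgebra T x₀ c) id CMapDisc.incl where
  continuous_left := continuous_id
  continuous_right := continuous_cMapDisc_incl
  map_actA θ x := by
    refine Subtype.ext (ConfMap.ext_of_sec (fun p => Iff.rfl) fun p hp hp' => ?_)
    exact glueVal_discShape_eq θ.radius_pos θ.sep x fun h => hp
      (((discShape (n + 1)).mem_glueMap_pts (discShape_fits θ.suspend) x p).2 h)
  map_actM θ x w := by
    refine Subtype.ext (Prod.ext (ConfMap.ext_of_sec (fun p => Iff.rfl) fun p hp hp' => ?_) rfl)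
    have hθ := discShape_fitsLinear θ.suspend
    have hmem := (discShape (n + 1)).mem_glueSec_pts hθ x w p
    rcases le_total p.height w.1.2 with h | h
    · have hw : p ∉ w.1.1.pts := fun hw => hp (hmem.2 (Or.inl hw))
      exact ((discShape (n + 1)).glueSec_of_le hθ x w h hp hw).trans
        ((columnShape n).glueSec_of_le (columnShape_fitsLinear θ) _ w h hp' hw).symm
    · refine ((discShape (n + 1)).glueSec_of_ge hθ x w h hp).trans (Eq.trans ?_
        ((columnShape n).glueSec_of_ge (columnShape_fitsLinear θ) _ w h hp').symm)
      have hcar := Hat.mem_carrier_of_height_pos (w.2.1.trans_le h)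
      refine congrArg _ (glueVal_discShape_eq θ.radius_pos θ.sep x ?_)
      rintro ⟨i, y, hy, hq⟩
      exact hp (hmem.2 (Or.inr ⟨i, y, hy, (isAt_horiz_add_iff hcar).2 hq⟩))

/-- Glued maps are built on `LittleDiscs.conf` and `LinearDiscs.conf` whatever the shape, so both
sides are the same configuration by definition. -/
lemma isLSCMap_forget [NeZero n] (T : DiscTrivialization D ξ X) (x₀ : X)
    (c : Set (SingClass (n + 1) ((𝓡∂ (n + 1)).interior M) ξ)) :
    IsLSCMap (halfSecAlgebra T x₀ c) (confAlgebra D).restrict CGammaDot.forget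
      CMapDisc.forget where
  continuous_left := continuous_cGammaDot_forget
  continuous_right := continuous_cMapDisc_forget
  map_actA _ _ := rfl
  map_actM _ _ _ := rfl

lemma isLSCMap_forget_incl (T : DiscTrivialization D ξ X) (x₀ : X)
    (c : Set (SingClass (n + 1) ((𝓡∂ (n + 1)).interior M) ξ)) :
    IsLSCMap (secAlgebra T x₀ c) (confAlgebra D) CGammaDot.forget
      (CMapDisc.forget ∘ CMapDisc.incl) where
  continuous_left := continuous_cGammaDot_forget
  continuous_right := continuous_cMapDisc_forget.comp continuous_cMapDisc_incl
  map_actA _ _ := rfl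
  map_actM _ _ _ := rfl

end LinearLaws

end SwissCheese

end

theorem proposition4p8 (n : ℕ) [NeZero n] {M E X : Type*} [TopologicalSpace M] [T2Space M]
    [SecondCountableTopology M] [ChartedSpace (EuclideanHalfSpace (n + 1)) M]
    [IsManifold (𝓡∂ (n + 1)) ∞ M] [TopologicalSpace E] [TopologicalSpace X]
    (D : BoundaryDisc n M) (ξ : E → M)
    (hξ : ∀ p : M, ∃ e : Bundle.Trivialization X ξ, p ∈ e.baseSet)
    (T : DiscTrivialization D ξ X) (x₀ : X)
    (c : Set (SingClass (n + 1) ((𝓡∂ (n + 1)).interior M) ξ)) :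
    ∃ (S₁ : LSCAlgebra (n + 1) (CDot D) (CDisc (n + 1)))
      (S₂ : LSCAlgebra (n + 1) (CGammaDot T x₀ c)
        (CMapDisc (bdry (n + 1)) x₀ (discClass T c)))
      (S₃ : LSCAlgebra n (CGammaDot T x₀ c) (CMapDisc (halfBdry n) x₀ (discClass T c))),
      IsConfAction S₁ ∧ IsSecAction S₂ ∧ IsHalfSecAction S₃ ∧
      IsLSCMap S₂.restrict S₃ id CMapDisc.incl ∧
      IsLSCMap S₃ S₁.restrict CGammaDot.forget CMapDisc.forget ∧
      IsLSCMap S₂ S₁ CGammaDot.forget (CMapDisc.forget ∘ CMapDisc.incl) := by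
  -- Evaluation takes default values on the configuration, so X and Ê have to be inhabited; a point
  -- of Ê is found over the centre of D.
  have : Nonempty X := ⟨x₀⟩
  have : Nonempty (HatE D ξ) :=
    ⟨⟨((T.homeo.symm (clampCube 0, x₀)).1, 0), le_rfl, Or.inl rfl⟩⟩
  exact ⟨confAlgebra D, secAlgebra T x₀ c, halfSecAlgebra T x₀ c, isConfAction_confAlgebra D,
    isSecAction_secAlgebra T x₀ c, isHalfSecAction_halfSecAlgebra T x₀ c, isLSCMap_incl T x₀ c,
    isLSCMap_forget T x₀ c, isLSCMap_forget_incl T x₀ c⟩
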